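/- **Setting.** Let $d\in\mathbb N$ and $T>0$. Let $\mathcal P_1(\mathbb R^d)$ be the set of Borel probability measures on $\mathbb R^d$ with finite first moment, with the distance $d_1(\nu_1,\nu_2)=\inf_\gamma\int|x-y|\,d\gamma(x,y)$ (infimum over couplings). Assume: * (H1) $H(x,p)=\sup_{a\in\mathbb R^d}(\langle a,p\rangle-L(x,a))$, where $L\colon\mathbb R^d\times\mathbb R^d\to\mathbb R$ is of class $C^2$, bounded from below and, for some constants $C_{L,i}>0$ and all $x,a,b,y\in\mathbb R^d$: $L(x,a)\le C_{L,1}|a|^2+C_{L,2}$, $|D_xL(x,a)|\le C_{L,3}(1+|a|^2)$, $C_{L,4}|b|^2\le\langle D^2_{aa}L(x,a)b,b\rangle$, $\langle D^2_{xx}L(x,a)y,y\rangle\le C_{L,5}(1+|a|^2)|y|^2$. * (H2) $F,G\colon\mathbb R^d\times\mathcal P_1(\mathbb R^d)\to\mathbb R$ are continuous and, for $f=F,G$, for some constants $C_{f,i}>0$ and all $x,y\in\mathbb R^d$, $\nu\in\mathcal P_1(\mathbb R^d)$: $|f(x,\nu)|\le C_{f,1}$, $|f(x,\nu)-f(y,\nu)|\le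 C_{f,2}|x-y|$, $f(x+y,\nu)-2f(x,\nu)+f(x-y,\nu)\le C_{f,3}|y|^2$. * (H3) $m_0^*$ is an absolutely continuous probability measure on $\mathbb R^d$ whose support is contained in a closed ball $\overline B_\infty(0,C^*)$ of the maximum norm, with density (also denoted $m_0^*$) in $L^{\mathsf p}(\mathbb R^d)$ for some $\mathsf p\in(1,\infty]$. Let $\rho\in C^\infty(\mathbb R^d)$ be nonnegative with $\int\rho=1$, with bounded derivatives of every order and integrable gradient; put $\rho_\varepsilon(x)=\varepsilon^{-d}\rho(x/\varepsilon)$. Let $C_{\rm b}>0$ be any bound on the controls. **The scheme.** Given $N\in\mathbb N$, $N\ge1$, $\Delta x>0$, $\varepsilon>0$, put $\Delta t=T/N$, $t_k=k\Delta t$, $x_i=i\Delta x$ ($i\in\mathbb Z^d$), $E_i=\{x:|x-x_i|_\infty\le\Delta x/2\}$, $\beta_i^0=\mathbb I_{E_i}$, $\beta_i^1(z)=\prod_{l=1}^d\max\{0,1-|z_l/\Delta x-i_l|\}$, and $I^1[\phi]=\sum_i\beta^1_i\phi_i$ for $\phi\colon\mathbb Z^d\to\mathbb R$. For $\mu\in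 C([0,T];\mathcal P_1(\mathbb R^d))$ define, for $i\in\mathbb Z^d$, first $v_{N,i}=G(x_i,\mu(T))$ and, for $k=N-1,\dots,0$, $$v_{k,i}=\inf_{|a|\le C_{\rm b}}\big[\Delta t\,L(x_i,a)+I^1[v_{k+1}](x_i-\Delta t\,a)\big]+\Delta t\,F(x_i,\mu(t_k)),$$ then $v^\Delta[\mu](t_k,\cdot)=\rho_\varepsilon*I^1[v_k]$ and $\mathsf\Phi_k[\mu](x)=x-\Delta t\,D_pH\big(x,D_xv^\Delta[\mu](t_k,x)\big)$, and finally $$m_{0,i}=\frac1{(\Delta x)^d}\int_{E_i}m_0^*\,dx,\qquad m_{k+1,i}=\frac1{(\Delta x)^d}\sum_{j\in\mathbb Z^d}m_{k,j}\int_{E_j}\beta_i^0(\mathsf\Phi_k[\mu](x))\,dx ,\qquad \mathsf m^\Delta[\mu](t_k,x)=\sum_{j\in\mathbb Z^d}m_{k,j}\beta_j^0(x).$$ Given $c>0$, call $\widetilde C>0$ a *support bound* if, for all $N\ge1$, $\Delta x>0$, $\varepsilon>0$ with $\Delta x\le c\,\Delta t$, all $\mu\in C([0,T];\mathcal P_1(\mathbb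 R^d))$, all $k\in\{0,\dots,N\}$ and all $i\in\mathbb Z^d$ with $x_i\notin\overline B_\infty(0,\widetilde C)$, one has $m_{k,i}=0$. For such a $\widetilde C$ let $\mathcal I_{\Delta x}=\{i\in\mathbb Z^d: x_i\in\overline B_\infty(0,\widetilde C)\}$, let $\mathfrak D$ be the set of arrays $(\mu_{k,i})_{0\le k\le N,\,i\in\mathcal I_{\Delta x}}$ with $\mu_{k,i}\ge0$ and $\sum_{i}\mu_{k,i}(\Delta x)^d=1$ for all $k$, and for $\mu\in\mathfrak D$ let $\tilde\mu\in C([0,T];\mathcal P_1(\mathbb R^d))$ be the curve for which $\tilde\mu(t)$ has the density $$\frac{t-t_k}{\Delta t}\sum_{i\in\mathcal I_{\Delta x}}\mu_{k+1,i}\,\beta_i^0+\frac{t_{k+1}-t}{\Delta t}\sum_{i\in\mathcal I_{\Delta x}}\mu_{k,i}\,\beta_i^0\qquad(t\in[t_k,t_{k+1}],\ 0\le k<N).$$ **Theorem.** Under (H1)–(H3), for every $c>0$ a support bound exists. Moreover, for every $c>0$, every support bound $\widetilde C>0$ for $c$ and every $\overline\varepsilon>0$, there is $\delta>0$ such that for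 all $N\ge1$, $\Delta x>0$ and $\varepsilon\in(0,\overline\varepsilon]$ with $\Delta x\le c\,\Delta t$ and $\Delta t/\varepsilon\le\delta$, the fully discrete mean field games system has at least one solution, i.e. there is $\mu\in\mathfrak D$ such that $$\mu_{k,i}=\mathsf m^\Delta[\tilde\mu](t_k,x_i)\qquad\text{for all }k\in\{0,\dots,N\},\ i\in\mathcal I_{\Delta x}.\tag{MFG$^\Delta$}$$ -/

import Mathlib

open MeasureTheory

namespace MFG

/-- Euclidean space `ℝ^d`. -/
abbrev Space (d : ℕ) := EuclideanSpace ℝ (Fin d)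

/-! ### Probability measures with finite first moment and the distance `d₁` -/

/-- `ν` belongs to `𝒫₁(ℝ^d)`: a Borel probability measure with finite first moment. -/
def IsP1 {d : ℕ} (ν : Measure (Space d)) : Prop :=
  IsProbabilityMeasure ν ∧ Integrable (fun x : Space d => ‖x‖) ν

/-- The distance `d₁(ν₁, ν₂) = inf ∫ |x - y| dγ(x, y)` over the couplings `γ` of `ν₁` and `ν₂`. -/
noncomputable def d1 {d : ℕ} (ν₁ ν₂ : Measure (Space d)) : ℝ :=
  sInf {r : ℝ | ∃ γ : Measure (Space d × Space d), IsProbabilityMeasure γ ∧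
    γ.map Prod.fst = ν₁ ∧ γ.map Prod.snd = ν₂ ∧ r = ∫ z, ‖z.1 - z.2‖ ∂γ}

/-- Continuity of `f : ℝ^d × 𝒫₁(ℝ^d) → ℝ`. Functions on `ℝ^d × 𝒫₁(ℝ^d)` are given as functions of
a point and a measure, of which only the values at measures in `𝒫₁(ℝ^d)` matter. -/
def ContinuousOnP1 {d : ℕ} (f : Space d → Measure (Space d) → ℝ) : Prop :=
  ∀ (x : Space d) (ν : Measure (Space d)), IsP1 ν → ∀ e : ℝ, 0 < e →
    ∃ r : ℝ, 0 < r ∧ ∀ (y : Space d) (ν' : Measure (Space d)), IsP1 ν' →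
      ‖y - x‖ < r → d1 ν' ν < r → |f y ν' - f x ν| < e

/-- `μ ∈ C([0,T]; 𝒫₁(ℝ^d))`; the values of `μ` outside `[0,T]` are irrelevant. -/
def IsP1Curve {d : ℕ} (T : ℝ) (μ : ℝ → Measure (Space d)) : Prop :=
  (∀ t ∈ Set.Icc 0 T, IsP1 (μ t)) ∧
  ∀ t ∈ Set.Icc 0 T, ∀ e : ℝ, 0 < e → ∃ r : ℝ, 0 < r ∧
    ∀ s ∈ Set.Icc 0 T, |s - t| < r → d1 (μ s) (μ t) < e

/-! ### Assumptions on the data -/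

/-- The Hamiltonian `H(x,p) = sup_a (⟨a,p⟩ - L(x,a))`. -/
noncomputable def hamiltonian {d : ℕ} (L : Space d → Space d → ℝ) (x p : Space d) : ℝ :=
  ⨆ a : Space d, (inner ℝ a p - L x a)

/-- The assumption (H1) on the Lagrangian `L`. -/
def HypH1 {d : ℕ} (L : Space d → Space d → ℝ) : Prop :=
  ContDiff ℝ 2 (fun z : Space d × Space d => L z.1 z.2) ∧
  (∃ B : ℝ, ∀ x a, B ≤ L x a) ∧
  ∃ C₁ C₂ C₃ C₄ C₅ : ℝ, 0 < C₁ ∧ 0 < C₂ ∧ 0 < C₃ ∧ 0 < C₄ ∧ 0 < C₅ ∧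
    ∀ x a : Space d,
      L x a ≤ C₁ * ‖a‖ ^ 2 + C₂ ∧
      ‖gradient (fun y => L y a) x‖ ≤ C₃ * (1 + ‖a‖ ^ 2) ∧
      (∀ b : Space d, C₄ * ‖b‖ ^ 2 ≤ fderiv ℝ (fderiv ℝ (L x)) a b b) ∧
      (∀ y : Space d,
        fderiv ℝ (fderiv ℝ (fun x' => L x' a)) x y y ≤ C₅ * (1 + ‖a‖ ^ 2) * ‖y‖ ^ 2)

/-- The assumption (H2) on one coupling function: continuity, and boundedness, Lipschitz
continuity and semiconcavity in the space variable, uniformly in the measure. -/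
def HypCoupling {d : ℕ} (f : Space d → Measure (Space d) → ℝ) : Prop :=
  ContinuousOnP1 f ∧
  ∃ C₁ C₂ C₃ : ℝ, 0 < C₁ ∧ 0 < C₂ ∧ 0 < C₃ ∧
    ∀ (x y : Space d) (ν : Measure (Space d)), IsP1 ν →
      |f x ν| ≤ C₁ ∧
      |f x ν - f y ν| ≤ C₂ * ‖x - y‖ ∧
      f (x + y) ν - 2 * f x ν + f (x - y) ν ≤ C₃ * ‖y‖ ^ 2

/-- The assumption (H2) on the couplings `F` and `G`. -/
def HypH2 {d : ℕ} (F G : Space d → Measure (Space d) → ℝ) : Prop :=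
  HypCoupling F ∧ HypCoupling G

/-- The Lebesgue density of the initial measure. -/
noncomputable def density {d : ℕ} (m₀ : Measure (Space d)) (x : Space d) : ℝ :=
  (m₀.rnDeriv volume x).toReal

/-- The assumption (H3): `m₀` is an absolutely continuous probability measure, supported in a
closed ball of the maximum norm, with density in `L^p` for some `p ∈ (1, ∞]`. -/
def HypH3 {d : ℕ} (m₀ : Measure (Space d)) : Prop :=
  IsProbabilityMeasure m₀ ∧ m₀ ≪ volume ∧
  (∃ C : ℝ, 0 < C ∧ m₀.support ⊆ {x : Space d | ∀ l, |x l| ≤ C}) ∧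
  ∃ p : ENNReal, 1 < p ∧ MemLp (density m₀) p volume

/-- The mollifier profile `ρ`: smooth with bounded derivatives of any order, nonnegative, of
integral one, and with integrable gradient. -/
def IsMollifierProfile {d : ℕ} (ρ : Space d → ℝ) : Prop :=
  ContDiff ℝ (⊤ : ℕ∞) ρ ∧
  (∀ n : ℕ, ∃ C : ℝ, ∀ x, ‖iteratedFDeriv ℝ n ρ x‖ ≤ C) ∧
  (∀ x, 0 ≤ ρ x) ∧
  Integrable ρ ∧ ∫ x, ρ x = 1 ∧
  Integrable (gradient ρ)

/-! ### Grids

`N` is the number of time steps and `Δt = T / N`; `Δx` is the space step. -/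

/-- The time `t_k = k Δt`. -/
noncomputable def timePt (T : ℝ) (N k : ℕ) : ℝ := k * (T / N)

/-- The grid point `x_i = i Δx`. -/
noncomputable def gridPt {d : ℕ} (Δx : ℝ) (i : Fin d → ℤ) : Space d :=
  WithLp.toLp 2 fun l => (i l : ℝ) * Δx

/-- The reference hat function. -/
noncomputable def hat (ξ : ℝ) : ℝ := max 0 (1 - |ξ|)

/-- The `Q₁` basis function `β_i¹`. -/
noncomputable def beta1 {d : ℕ} (Δx : ℝ) (i : Fin d → ℤ) (z : Space d) : ℝ :=
  ∏ l, hat (z l / Δx - i l)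

/-- The interpolate `I¹[φ]` of a function `φ` on the grid (at every point only finitely many terms
are nonzero). -/
noncomputable def interp1 {d : ℕ} (Δx : ℝ) (φ : (Fin d → ℤ) → ℝ) (x : Space d) : ℝ :=
  ∑' i : Fin d → ℤ, beta1 Δx i x * φ i

/-- The cell `E_i`: the closed ball of the maximum norm of center `x_i` and radius `Δx / 2`. -/
def cell {d : ℕ} (Δx : ℝ) (i : Fin d → ℤ) : Set (Space d) :=
  {x | ∀ l, |x l - gridPt Δx i l| ≤ Δx / 2}

/-- `β_i⁰`, the indicator function of `E_i`. -/
noncomputable def beta0 {d : ℕ} (Δx : ℝ) (i : Fin d → ℤ) : Space d → ℝ :=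
  (cell Δx i).indicator 1

/-! ### The semi-Lagrangian scheme for the HJB equation -/

/-- The operator `S_{k,i}[μ](φ)`; `Cb` is the bound on the controls. -/
noncomputable def slOp {d : ℕ} (T : ℝ) (L : Space d → Space d → ℝ)
    (F : Space d → Measure (Space d) → ℝ) (Cb : ℝ) (N : ℕ) (Δx : ℝ)
    (μ : ℝ → Measure (Space d)) (k : ℕ) (φ : (Fin d → ℤ) → ℝ) (i : Fin d → ℤ) : ℝ :=
  (⨅ a : Metric.closedBall (0 : Space d) Cb,
      (T / N * L (gridPt Δx i) a + interp1 Δx φ (gridPt Δx i - (T / N) • (a : Space d)))) +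
    T / N * F (gridPt Δx i) (μ (timePt T N k))

/-- The solution of the semi-Lagrangian scheme, by the number of backward steps from time `T`. -/
noncomputable def slBackward {d : ℕ} (T : ℝ) (L : Space d → Space d → ℝ)
    (F G : Space d → Measure (Space d) → ℝ) (Cb : ℝ) (N : ℕ) (Δx : ℝ)
    (μ : ℝ → Measure (Space d)) : ℕ → (Fin d → ℤ) → ℝ
  | 0 => fun i => G (gridPt Δx i) (μ T)
  | n + 1 => slOp T L F Cb N Δx μ (N - (n + 1)) (slBackward T L F G Cb N Δx μ n)

/-- The solution `v_{k,i}` of the semi-Lagrangian scheme, for `k ≤ N`. -/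
noncomputable def slValue {d : ℕ} (T : ℝ) (L : Space d → Space d → ℝ)
    (F G : Space d → Measure (Space d) → ℝ) (Cb : ℝ) (N : ℕ) (Δx : ℝ)
    (μ : ℝ → Measure (Space d)) (k : ℕ) : (Fin d → ℤ) → ℝ :=
  slBackward T L F G Cb N Δx μ (N - k)

theorem slValue_terminal {d : ℕ} (T : ℝ) (L : Space d → Space d → ℝ)
    (F G : Space d → Measure (Space d) → ℝ) (Cb : ℝ) (N : ℕ) (Δx : ℝ)
    (μ : ℝ → Measure (Space d)) (i : Fin d → ℤ) :
    slValue T L F G Cb N Δx μ N i = G (gridPt Δx i) (μ T) := by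
  simp [slValue, slBackward]

theorem slValue_step {d : ℕ} (T : ℝ) (L : Space d → Space d → ℝ)
    (F G : Space d → Measure (Space d) → ℝ) (Cb : ℝ) (N : ℕ) (Δx : ℝ)
    (μ : ℝ → Measure (Space d)) (k : ℕ) (hk : k < N) (i : Fin d → ℤ) :
    slValue T L F G Cb N Δx μ k i =
      slOp T L F Cb N Δx μ k (slValue T L F G Cb N Δx μ (k + 1)) i := by
  have h : N - k = (N - (k + 1)) + 1 := by omega
  have h' : N - (N - (k + 1) + 1) = k := by omega
  simp only [slValue]
  rw [h, slBackward, h']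

/-- The rescaled mollifier `ρ_ε(x) = ρ(x/ε) / ε^d`. -/
noncomputable def mollifier {d : ℕ} (ρ : Space d → ℝ) (ε : ℝ) (x : Space d) : ℝ :=
  ρ (ε⁻¹ • x) / ε ^ d

/-- The mollified discrete value function `v^Δ[μ](t_k, ·) = ρ_ε * I¹[v_k]`. -/
noncomputable def vDelta {d : ℕ} (T : ℝ) (L : Space d → Space d → ℝ)
    (F G : Space d → Measure (Space d) → ℝ) (ρ : Space d → ℝ) (Cb : ℝ) (N : ℕ) (Δx ε : ℝ)
    (μ : ℝ → Measure (Space d)) (k : ℕ) : Space d → ℝ :=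
  convolution (mollifier ρ ε) (interp1 Δx (slValue T L F G Cb N Δx μ k))
    (ContinuousLinearMap.lsmul ℝ ℝ) volume

/-! ### The Lagrange-Galerkin scheme for the continuity equation -/

/-- The Euler step `Φ_k^Δ[μ](x) = x - Δt D_pH(x, D_x v^Δ[μ](t_k, x))`. -/
noncomputable def eulerFlow {d : ℕ} (T : ℝ) (L : Space d → Space d → ℝ)
    (F G : Space d → Measure (Space d) → ℝ) (ρ : Space d → ℝ) (Cb : ℝ) (N : ℕ) (Δx ε : ℝ)
    (μ : ℝ → Measure (Space d)) (k : ℕ) (x : Space d) : Space d :=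
  x - (T / N) • gradient (hamiltonian L x) (gradient (vDelta T L F G ρ Cb N Δx ε μ k) x)

/-- The solution `m_{k,i}` of the Lagrange-Galerkin scheme driven by `μ`. -/
noncomputable def lgCoeff {d : ℕ} (T : ℝ) (L : Space d → Space d → ℝ)
    (F G : Space d → Measure (Space d) → ℝ) (m₀ : Measure (Space d)) (ρ : Space d → ℝ)
    (Cb : ℝ) (N : ℕ) (Δx ε : ℝ) (μ : ℝ → Measure (Space d)) : ℕ → (Fin d → ℤ) → ℝ
  | 0 => fun i => 1 / Δx ^ d * ∫ x in cell Δx i, density m₀ x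
  | k + 1 => fun i => 1 / Δx ^ d * ∑' j : Fin d → ℤ,
      lgCoeff T L F G m₀ ρ Cb N Δx ε μ k j *
        ∫ x in cell Δx j, beta0 Δx i (eulerFlow T L F G ρ Cb N Δx ε μ k x)

/-- The discrete density `𝗆^Δ[μ](t_k, x) = ∑_j m_{k,j} β_j⁰(x)`. -/
noncomputable def lgDensity {d : ℕ} (T : ℝ) (L : Space d → Space d → ℝ)
    (F G : Space d → Measure (Space d) → ℝ) (m₀ : Measure (Space d)) (ρ : Space d → ℝ)
    (Cb : ℝ) (N : ℕ) (Δx ε : ℝ) (μ : ℝ → Measure (Space d)) (k : ℕ) (x : Space d) : ℝ :=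
  ∑' j : Fin d → ℤ, lgCoeff T L F G m₀ ρ Cb N Δx ε μ k j * beta0 Δx j x

/-- `C` bounds the supports of all the solutions of the Lagrange-Galerkin scheme, for all curves
`μ ∈ C([0,T]; 𝒫₁)` and all discretization steps with `Δx ≤ c Δt`: `m_{k,i} = 0` whenever
`x_i` is outside the closed ball of the maximum norm of center `0` and radius `C`. -/
def IsSupportBound {d : ℕ} (T : ℝ) (L : Space d → Space d → ℝ)
    (F G : Space d → Measure (Space d) → ℝ) (m₀ : Measure (Space d)) (ρ : Space d → ℝ)
    (Cb c C : ℝ) : Prop :=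
  ∀ (N : ℕ) (Δx ε : ℝ) (μ : ℝ → Measure (Space d)),
    0 < N → 0 < Δx → 0 < ε → Δx ≤ c * (T / N) → IsP1Curve T μ →
    ∀ k ≤ N, ∀ i : Fin d → ℤ, ¬ (∀ l, |gridPt Δx i l| ≤ C) →
      lgCoeff T L F G m₀ ρ Cb N Δx ε μ k i = 0

/-! ### The fully discrete mean field games system -/

/-- The finite index set of the grid points `x_i` in the closed ball of the maximum norm of center
`0` and radius `C` (see `mem_indexSet`). -/
noncomputable def indexSet (d : ℕ) (Δx C : ℝ) : Finset (Fin d → ℤ) :=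
  Fintype.piFinset fun _ => Finset.Icc (-⌊C / Δx⌋) ⌊C / Δx⌋

theorem mem_indexSet {d : ℕ} {Δx C : ℝ} (hΔx : 0 < Δx) (i : Fin d → ℤ) :
    i ∈ indexSet d Δx C ↔ ∀ l, |gridPt Δx i l| ≤ C := by
  simp only [indexSet, Fintype.mem_piFinset, Finset.mem_Icc, gridPt]
  refine forall_congr' fun l => ?_
  rw [← abs_le, Int.le_floor, Int.cast_abs, le_div_iff₀ hΔx, abs_mul, abs_of_pos hΔx]

/-- The set of discrete densities. -/
def discreteDensities (d N : ℕ) (Δx C : ℝ) : Set (Fin (N + 1) → indexSet d Δx C → ℝ) :=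
  {μ | ∀ k, (∀ i, 0 ≤ μ k i) ∧ ∑ j, μ k j * Δx ^ d = 1}

/-- The curve `μ̃` of measures associated with the discrete density `μ`: for `t ∈ [t_k, t_{k+1}]`,
`k < N`, the density of `μ̃(t)` is
`(t - t_k)/Δt ∑_i μ_{k+1,i} β_i⁰ + (t_{k+1} - t)/Δt ∑_i μ_{k,i} β_i⁰`. -/
noncomputable def extension {d : ℕ} (T : ℝ) (N : ℕ) (Δx C : ℝ)
    (μ : Fin (N + 1) → indexSet d Δx C → ℝ) (t : ℝ) : Measure (Space d) :=
  let k : ℕ := min ⌊t / (T / N)⌋₊ (N - 1)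
  volume.withDensity fun x => ENNReal.ofReal
    ((t - timePt T N k) / (T / N) * ∑ i, μ (Fin.ofNat (N + 1) (k + 1)) i * beta0 Δx i x +
      (timePt T N (k + 1) - t) / (T / N) * ∑ i, μ (Fin.ofNat (N + 1) k) i * beta0 Δx i x)

/-- `μ` is a solution of the fully discrete system: a discrete density with
`μ_{k,i} = 𝗆^Δ[μ̃](t_k, x_i)` for all `k` and `i`. -/
def IsDiscreteMFGSolution {d : ℕ} (T : ℝ) (L : Space d → Space d → ℝ)
    (F G : Space d → Measure (Space d) → ℝ) (m₀ : Measure (Space d)) (ρ : Space d → ℝ)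
    (Cb C : ℝ) (N : ℕ) (Δx ε : ℝ) (μ : Fin (N + 1) → indexSet d Δx C → ℝ) : Prop :=
  μ ∈ discreteDensities d N Δx C ∧
  ∀ (k : Fin (N + 1)) (i : indexSet d Δx C),
    μ k i = lgDensity T L F G m₀ ρ Cb N Δx ε (extension T N Δx C μ) k (gridPt Δx i)

end MFG

open MFG

namespace MFG

/-! A discrete solution is a fixed point of the map Ψ that takes μ ∈ 𝔇 to the coefficients m_{k,i}
computed along μ̃. The set 𝔇 is a finite product of simplices, so Brouwer's theorem
(`exists_fixedPoint_prod_simplex`) gives the fixed point once Ψ maps 𝔇 into itself and is continuous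
there.

Both properties hinge on one fact: each Euler step Φ_k sends Lebesgue measure on the relevant cells
to an absolutely continuous measure. The closed cells overlap and β_i⁰ jumps at the boundary of E_i,
so if Φ_k carried a set of positive measure into such boundaries, mass could be counted twice and Ψ
could jump.

To exclude this, write Φ_k = id - Δt b. The interpolates I¹[v_k] have a Lipschitz constant V that
does not depend on the discretization, so D_x v^Δ is bounded by V, and convolution with ρ_ε makes it
Lipschitz with constant V‖∇ρ‖₁/ε. Strong convexity of L(x,·) makes D_pH locally Lipschitz. Hence
Lip(b) = O(1 + 1/ε) on the ball containing the cells, and for Δt/ε small with ε bounded, |Φ_k(x) -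
Φ_k(y)| ≥ |x - y|/2 there; preimages of null sets are then null (`volume_inter_preimage_eq_zero`).

Mass conservation (`sum_lgCoeff`) and, by dominated convergence, continuity (`tendsto_lgCoeff`)
follow. The latter also needs Φ_k[μ̃](x) to be continuous in μ: d₁ is controlled by the weights
(`d1_stepMeasure_le`), the values v_k follow F and G (`SchemeBounds.tendsto_slBackward`), and their
mollified gradients converge because they are equi-Lipschitz
(`SchemeBounds.tendsto_gradient_vDelta`).

The support bound comes from |Φ_k(x) - x| ≤ KΔt, a consequence of the bound V and the linear growth
of D_pH: each of the N steps enlarges the support by at most Δx + KΔt ≤ (c + K)Δt. -/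

open Metric Set Polynomial in
-- Lagrange interpolation at n + 1 nodes in (0, τ). The weights do not depend on the polynomial, so
-- an identity between integrals known for small t passes to t = 1 by linearity, without handling
-- the coefficients of the polynomials.
theorem exists_extrapolation_weights (n : ℕ) {τ : ℝ} (hτ : 0 < τ) :
    ∃ (s : Finset ℝ) (c : ℝ → ℝ), (∀ t ∈ s, 0 < t ∧ t < τ) ∧
      ∀ p : ℝ[X], p.natDegree ≤ n → p.eval 1 = ∑ t ∈ s, c t * p.eval t := by
  obtain ⟨s, hs, hcard⟩ := (Set.Ioo_infinite hτ).exists_subset_card_eq (n + 1)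
  refine ⟨s, fun t => (Lagrange.basis s id t).eval 1, fun t ht => hs ht, fun p hp => ?_⟩
  have hdeg : p.degree < s.card := by
    rw [hcard]
    exact lt_of_le_of_lt degree_le_natDegree (by exact_mod_cast Nat.lt_succ_of_le hp)
  have h := Lagrange.eq_interpolate (v := id) (s := s) (Function.injective_id.injOn) hdeg
  conv_lhs => rw [h]
  simp only [Lagrange.interpolate_apply, eval_finsetSum, eval_mul, eval_C, id]
  exact Finset.sum_congr rfl fun t _ => mul_comm _ _

/-- A segment from a point inside the ball to a point outside crosses the unit sphere, where g
vanishes; comparing the inner point with the crossing point loses nothing in the constant. -/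
theorem lipschitzWith_indicator_closedBall {E : Type*} [NormedAddCommGroup E]
    [NormedSpace ℝ E] {g : E → E} {K : NNReal}
    (hg : LipschitzOnWith K g (Metric.closedBall 0 1)) (h0 : ∀ x, ‖x‖ = 1 → g x = 0) :
    LipschitzWith K ((Metric.closedBall (0 : E) 1).indicator g) := by
  have key : ∀ x y : E, ‖x‖ ≤ 1 → ¬ ‖y‖ ≤ 1 → ‖g x‖ ≤ K * dist x y := by
    intro x y hx hy
    obtain ⟨s, hs, hsz⟩ := intermediate_value_Icc (zero_le_one (α := ℝ))
      (f := fun s : ℝ => ‖x + s • (y - x)‖) (by fun_prop)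
      (⟨by simpa using hx, by simpa using (not_le.1 hy).le⟩ : (1 : ℝ) ∈ Set.Icc _ _)
    have h1 := hg.dist_le_mul x (by simpa using hx) (x + s • (y - x)) (by
      simpa using le_of_eq hsz)
    rw [h0 _ hsz, dist_zero_right] at h1
    refine h1.trans (mul_le_mul_of_nonneg_left ?_ K.coe_nonneg)
    rw [dist_eq_norm, dist_eq_norm, sub_add_cancel_left, norm_neg, norm_smul,
      Real.norm_of_nonneg hs.1, norm_sub_rev y x]
    exact mul_le_of_le_one_left (norm_nonneg _) hs.2
  refine LipschitzWith.of_dist_le_mul fun x y => ?_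
  by_cases hx : ‖x‖ ≤ 1 <;> by_cases hy : ‖y‖ ≤ 1
  · simpa [Set.indicator, hx, hy] using
      hg.dist_le_mul x (by simpa using hx) y (by simpa using hy)
  · simpa [Set.indicator, hx, hy] using key x y hx hy
  · simpa [Set.indicator, hx, hy, dist_comm] using key y x hy hx
  · simp [Set.indicator, hx, hy]; positivity

/-! ### Brouwer's fixed point theorem, by the volume argument of Milnor and Rogers. -/

section Brouwer

variable {E : Type*} [NormedAddCommGroup E] [InnerProductSpace ℝ E] [FiniteDimensional ℝ E]

open Polynomial in
theorem exists_polynomial_det_one_add_smul (A : E →L[ℝ] E) :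
    ∃ p : ℝ[X], p.natDegree ≤ Module.finrank ℝ E ∧
      ∀ t : ℝ, p.eval t = (1 + t • A : E →L[ℝ] E).det := by
  let b := Module.finBasis ℝ E
  let M := LinearMap.toMatrix b b (A : E →ₗ[ℝ] E)
  refine ⟨Matrix.det ((X : ℝ[X]) • M.map C + (1 : Matrix _ _ ℝ).map C), ?_, fun t => ?_⟩
  · simpa using natDegree_det_X_add_C_le M (1 : Matrix _ _ ℝ)
  · rw [ContinuousLinearMap.det, ← LinearMap.det_toMatrix b, ← coe_evalRingHom, RingHom.map_det]
    congr 1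
    have : ((1 + t • A : E →L[ℝ] E) : E →ₗ[ℝ] E) = LinearMap.id + t • (A : E →ₗ[ℝ] E) := by
      ext; simp
    have hM : LinearMap.toMatrix b b ((1 + t • A : E →L[ℝ] E) : E →ₗ[ℝ] E) = 1 + t • M := by
      rw [this, map_add, LinearMap.toMatrix_id, map_smul]
    rw [hM]
    ext i j
    by_cases h : i = j <;>
      simpa [M, h, add_comm] using mul_comm _ _

/-- The determinant of 1 + sA equals 1 at s = 0 and cannot vanish for s ∈ [0, 1], since 1 + sA is
invertible by the Neumann series. -/
theorem det_one_add_pos {A : E →L[ℝ] E} (hA : ‖A‖ < 1) : 0 < (1 + A : E →L[ℝ] E).det := by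
  have hne : ∀ s ∈ Set.Icc (0 : ℝ) 1, (1 + s • A : E →L[ℝ] E).det ≠ 0 := by
    intro s hs
    have h1 : ‖-(s • A)‖ < 1 := by
      rw [norm_neg, norm_smul, Real.norm_of_nonneg hs.1]
      exact lt_of_le_of_lt (mul_le_of_le_one_left (norm_nonneg _) hs.2) hA
    have hu := isUnit_one_sub_of_norm_lt_one h1
    rw [sub_neg_eq_add] at hu
    have := (hu.map (ContinuousLinearMap.toLinearMapRingHom : (E →L[ℝ] E) →+* E →ₗ[ℝ] E)).map
      (LinearMap.det (M := E) (A := ℝ))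
    exact this.ne_zero
  have hc : Continuous fun s : ℝ => (1 + s • A : E →L[ℝ] E).det :=
    ContinuousLinearMap.continuous_det.comp (by fun_prop)
  by_contra hneg
  push Not at hneg
  have h0 : (1 + (0 : ℝ) • A : E →L[ℝ] E).det = 1 := by
    simp [ContinuousLinearMap.det]
  have h1 : (1 + (1 : ℝ) • A : E →L[ℝ] E).det ≤ 0 := by simpa using hneg
  obtain ⟨s, hs, hs0⟩ := intermediate_value_Icc' (zero_le_one (α := ℝ)) hc.continuousOn
    (⟨h1, by rw [h0]; exact zero_le_one⟩ : (0 : ℝ) ∈ Set.Icc _ _)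
  exact hne s hs hs0

/-- Solving x + t g(x) = y means finding a fixed point of the contraction x ↦ y - t g(x). -/
theorem bijective_add_smul {g : E → E} {K : NNReal} (hg : LipschitzWith K g) {t : ℝ}
    (ht : 0 ≤ t) (htK : t * K < 1) : Function.Bijective fun x => x + t • g x := by
  constructor
  · intro x y hxy
    have h1 : x - y = t • (g y - g x) := by
      rw [smul_sub, sub_eq_sub_iff_add_eq_add, add_comm (t • g y)]
      simpa [add_comm, add_left_comm] using hxy
    have h2 : ‖x - y‖ ≤ t * K * ‖x - y‖ := by
      conv_lhs => rw [h1, norm_smul, Real.norm_of_nonneg ht]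
      rw [mul_assoc]
      refine mul_le_mul_of_nonneg_left ?_ ht
      rw [norm_sub_rev x y]
      simpa [dist_eq_norm] using hg.dist_le_mul y x
    have h3 : ‖x - y‖ = 0 := by nlinarith [norm_nonneg (x - y)]
    exact sub_eq_zero.1 (norm_eq_zero.1 h3)
  · intro y
    have hcon : ContractingWith (Real.toNNReal (t * K)) fun x => y - t • g x := by
      refine ⟨?_, LipschitzWith.of_dist_le_mul fun a b => ?_⟩
      · rw [← NNReal.coe_lt_coe, Real.coe_toNNReal _ (by positivity)]; exact htK
      · rw [Real.coe_toNNReal _ (by positivity), dist_eq_norm, sub_sub_sub_cancel_left,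
          ← smul_sub, norm_smul, Real.norm_of_nonneg ht, mul_assoc]
        refine mul_le_mul_of_nonneg_left ?_ ht
        rw [dist_comm]
        simpa [dist_eq_norm] using hg.dist_le_mul b a
    refine ⟨hcon.fixedPoint, ?_⟩
    have h := hcon.fixedPoint_isFixedPt
    have h' : y - t • g hcon.fixedPoint = hcon.fixedPoint := h
    change hcon.fixedPoint + t • g hcon.fixedPoint = y
    rw [← eq_sub_iff_add_eq, h']

/-- The bijection x ↦ x + t g(x) fixes every point outside U, hence maps U onto U. The change of
variables formula applies, and the absolute value drops because the Jacobian is positive. -/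
theorem integral_det_eq_volume [MeasurableSpace E] [BorelSpace E] {g : E → E} {K : NNReal}
    (hg : LipschitzWith K g) {U : Set E} (hU : MeasurableSet U)
    (hfin : (Measure.addHaar : Measure E) U ≠ ⊤)
    (hd : ∀ x ∈ U, DifferentiableAt ℝ g x) (h0 : ∀ x ∉ U, g x = 0) {t : ℝ}
    (ht : 0 ≤ t) (htK : t * K < 1) :
    Integrable (fun x => (1 + t • fderiv ℝ g x : E →L[ℝ] E).det) (Measure.addHaar.restrict U) ∧
    ∫ x in U, (1 + t • fderiv ℝ g x : E →L[ℝ] E).det ∂Measure.addHaar =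
      ((Measure.addHaar : Measure E) U).toReal := by
  have hbij := bijective_add_smul hg ht htK
  have himg : (fun x => x + t • g x) '' U = U := by
    have hout : ∀ x, x ∉ U → x + t • g x = x := fun x hx => by simp [h0 x hx]
    ext y
    constructor
    · rintro ⟨x, hx, rfl⟩
      by_contra hy
      have := hbij.1 (hout _ hy)
      exact hy (this.symm ▸ hx)
    · intro hy
      obtain ⟨x, hx⟩ := hbij.2 y
      refine ⟨x, ?_, hx⟩
      by_contra hxU
      have : x = y := by rw [← hx]; exact (hout x hxU).symm
      exact hxU (this ▸ hy)
  have hder : ∀ x ∈ U, HasFDerivWithinAt (fun x => x + t • g x)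
      (1 + t • fderiv ℝ g x : E →L[ℝ] E) U x := fun x hx =>
    ((hasFDerivAt_id x).add ((hd x hx).hasFDerivAt.const_smul t)).hasFDerivWithinAt
  have hpos : ∀ x, 0 < (1 + t • fderiv ℝ g x : E →L[ℝ] E).det := fun x => by
    refine det_one_add_pos (lt_of_le_of_lt ?_ htK)
    rw [norm_smul, Real.norm_of_nonneg ht]
    exact mul_le_mul_of_nonneg_left (norm_fderiv_le_of_lipschitz ℝ hg) ht
  have hlin := lintegral_abs_det_fderiv_eq_addHaar_image (Measure.addHaar : Measure E) hU hder
    hbij.1.injOn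
  rw [himg] at hlin
  simp only [abs_of_pos (hpos _)] at hlin
  have hmeas : Measurable fun x => (1 + t • fderiv ℝ g x : E →L[ℝ] E).det :=
    ContinuousLinearMap.continuous_det.measurable.comp
      (((measurable_fderiv ℝ g).const_smul t).const_add _)
  have hnn : 0 ≤ᵐ[Measure.addHaar.restrict U]
      fun x => (1 + t • fderiv ℝ g x : E →L[ℝ] E).det :=
    Filter.Eventually.of_forall fun x => (hpos x).le
  refine ⟨⟨hmeas.aestronglyMeasurable, ?_⟩, ?_⟩
  · rw [hasFiniteIntegral_iff_ofReal hnn, hlin]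
    exact lt_top_iff_ne_top.2 hfin
  · rw [integral_eq_lintegral_of_nonneg_ae hnn hmeas.aestronglyMeasurable, hlin]

/-- The integral over the ball of det(1 + t Dg) is a fixed combination of values of a polynomial in
t; it equals the volume of the ball for small t, hence also at t = 1. The determinant at t = 1
therefore cannot vanish identically. -/
theorem exists_det_one_add_fderiv_ne_zero {g : E → E} {K : NNReal}
    (hg : LipschitzWith K g) (hd : ∀ x ∈ Metric.ball (0 : E) 1, DifferentiableAt ℝ g x)
    (h0 : ∀ x ∉ Metric.ball (0 : E) 1, g x = 0) :
    ∃ x ∈ Metric.ball (0 : E) 1, (1 + fderiv ℝ g x : E →L[ℝ] E).det ≠ 0 := by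
  borelize E
  by_contra! hcon
  set U := Metric.ball (0 : E) 1
  -- Every node t < 1 / (K + 1) satisfies t K < 1, as the volume identity requires.
  have hτ : (0 : ℝ) < 1 / (K + 1) := by positivity
  obtain ⟨s, c, hs, hc⟩ := exists_extrapolation_weights (Module.finrank ℝ E) hτ
  have hfin : (Measure.addHaar : Measure E) U ≠ ⊤ := measure_ball_lt_top.ne
  have hint : ∀ t ∈ s, _ := fun t ht => integral_det_eq_volume hg
    (measurableSet_ball (x := (0 : E)) (ε := 1)) hfin hd h0 (hs t ht).1.le (by
      have h1 := (hs t ht).2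
      have h2 : t * (K + 1) < 1 := by rwa [lt_div_iff₀ (by positivity)] at h1
      nlinarith [(hs t ht).1])
  have h1 : ∫ x in U, (∑ t ∈ s, c t * (1 + t • fderiv ℝ g x : E →L[ℝ] E).det) ∂Measure.addHaar =
      ((Measure.addHaar : Measure E) U).toReal := by
    rw [integral_finsetSum _ fun t ht => (hint t ht).1.const_mul _]
    simp_rw [integral_const_mul]
    rw [Finset.sum_congr rfl fun t ht => by rw [(hint t ht).2], ← Finset.sum_mul]
    -- The constant polynomial 1 shows that the weights sum to 1.
    have := hc 1 (by simp)
    simp only [Polynomial.eval_one, mul_one] at this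
    rw [← this, one_mul]
  have h2 : ∫ x in U, (∑ t ∈ s, c t * (1 + t • fderiv ℝ g x : E →L[ℝ] E).det) ∂Measure.addHaar =
      0 := by
    refine setIntegral_eq_zero_of_forall_eq_zero fun x hx => ?_
    obtain ⟨p, hp, hpt⟩ := exists_polynomial_det_one_add_smul (fderiv ℝ g x)
    have := hc p hp
    simp only [hpt, one_smul] at this
    rw [← this, hcon x hx]
  have h3 : 0 < ((Measure.addHaar : Measure E) U).toReal :=
    ENNReal.toReal_pos (Metric.measure_ball_pos _ _ one_pos).ne' hfin
  linarith

/-- With g = r - id extended by zero, 1 + Dg is Dr inside the ball, so Dr is invertible somewhere.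
But |r| = 1 forces the range of Dr to be orthogonal to r. -/
theorem not_exists_retraction {r : E → E}
    (hr : ∀ x ∈ Metric.closedBall (0 : E) 1, ContDiffAt ℝ 1 r x)
    (hn : ∀ x ∈ Metric.closedBall (0 : E) 1, ‖r x‖ = 1) (hid : ∀ x, ‖x‖ = 1 → r x = x) :
    False := by
  have hcd : ∀ x ∈ Metric.closedBall (0 : E) 1, ContDiffAt ℝ 1 (fun x => r x - x) x :=
    fun x hx => (hr x hx).sub contDiffAt_id
  have hfc : ContinuousOn (fderiv ℝ fun x => r x - x) (Metric.closedBall (0 : E) 1) := fun x hx =>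
    (ContDiffAt.continuousAt (n := 0)
      ((hcd x hx).fderiv_right (m := 0) (by norm_num))).continuousWithinAt
  obtain ⟨M, hM⟩ := (isCompact_closedBall (0 : E) 1).exists_bound_of_continuousOn hfc
  have hlip : LipschitzOnWith (Real.toNNReal M) (fun x => r x - x) (Metric.closedBall (0 : E) 1) :=
    (convex_closedBall (0 : E) 1).lipschitzOnWith_of_nnnorm_fderiv_le
      (fun x hx => (hcd x hx).differentiableAt (by norm_num)) (fun x hx => by
        rw [← NNReal.coe_le_coe, coe_nnnorm]
        exact (hM x hx).trans (Real.le_coe_toNNReal M))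
  have hlip' := lipschitzWith_indicator_closedBall hlip fun x hx => by simp [hid x hx]
  have heq : ∀ x ∈ Metric.ball (0 : E) 1,
      (Metric.closedBall (0 : E) 1).indicator (fun x => r x - x) =ᶠ[nhds x] fun x => r x - x := by
    intro x hx
    filter_upwards [Metric.isOpen_ball.mem_nhds hx] with y hy
    exact Set.indicator_of_mem (Metric.ball_subset_closedBall hy) _
  obtain ⟨x, hx, hdet⟩ := exists_det_one_add_fderiv_ne_zero hlip' (fun x hx =>
    ((hcd x (Metric.ball_subset_closedBall hx)).differentiableAt
      (by norm_num)).congr_of_eventuallyEq (heq x hx)) (fun x hx => by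
      by_cases h : ‖x‖ = 1
      · simp [Set.indicator, h, hid x h]
      · refine Set.indicator_of_notMem (fun h' => hx ?_) _
        simp only [Metric.mem_closedBall, dist_zero_right, Metric.mem_ball] at h' ⊢
        exact lt_of_le_of_ne h' h)
  have hxc := Metric.ball_subset_closedBall hx
  have hrd := (hr x hxc).differentiableAt (by norm_num)
  have hfd : (1 : E →L[ℝ] E) +
      fderiv ℝ ((Metric.closedBall (0 : E) 1).indicator (fun x => r x - x)) x = fderiv ℝ r x := by
    rw [(heq x hx).fderiv_eq]
    have h2 : fderiv ℝ (fun x => r x - x) x = fderiv ℝ r x - ContinuousLinearMap.id ℝ E :=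
      (hrd.hasFDerivAt.sub (hasFDerivAt_id x)).fderiv
    rw [h2]
    ext; simp
  rw [hfd] at hdet
  have horth : ∀ h, inner ℝ (r x) (fderiv ℝ r x h) = 0 := by
    intro h
    have h1 : HasFDerivAt (fun y => inner ℝ (r y) (r y)) (0 : E →L[ℝ] ℝ) x := by
      refine (hasFDerivAt_const (1 : ℝ) x).congr_of_eventuallyEq ?_
      filter_upwards [Metric.isOpen_ball.mem_nhds hx] with y hy
      rw [real_inner_self_eq_norm_sq, hn y (Metric.ball_subset_closedBall hy)]; norm_num
    have h2 := h1.unique (hrd.hasFDerivAt.inner ℝ hrd.hasFDerivAt)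
    have h3 := congrArg (fun A : E →L[ℝ] ℝ => A h) h2
    simp only [_root_.zero_apply, ContinuousLinearMap.comp_apply,
      ContinuousLinearMap.prod_apply, fderivInnerCLM_apply] at h3
    rw [real_inner_comm (r x) (fderiv ℝ r x h)] at h3
    linarith
  have hsurj : Function.Surjective (fderiv ℝ r x : E →ₗ[ℝ] E) :=
    ((fderiv ℝ r x : E →ₗ[ℝ] E).equivOfDetNeZero hdet).surjective
  obtain ⟨h, hh⟩ := hsurj (r x)
  have h4 := horth h
  rw [show fderiv ℝ r x h = r x from hh, real_inner_self_eq_norm_sq, hn x hxc] at h4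
  norm_num at h4

/-- The second parameter at which the line `x + λ u` meets the unit sphere. -/
noncomputable def sphereParam (x u : E) : ℝ :=
  (-inner ℝ x u + √((inner ℝ x u) ^ 2 + ‖u‖ ^ 2 * (1 - ‖x‖ ^ 2))) / ‖u‖ ^ 2

/-- Without a fixed point, following the ray from f(x) through x up to the unit sphere would define
a C¹ retraction of the ball onto its boundary. -/
theorem fixedPoint_of_contDiff {f : E → E} (hf : ContDiff ℝ 1 f)
    (hb : ∀ x, ‖x‖ ≤ 1 → ‖f x‖ ≤ 1) : ∃ x, ‖x‖ ≤ 1 ∧ f x = x := by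
  by_contra! hne
  have hu : ∀ x : E, ‖x‖ ≤ 1 → x - f x ≠ 0 := fun x hx h => hne x hx (sub_eq_zero.1 h).symm
  -- If the inner product were 0, then ⟨x, f(x)⟩ = 1 with |x| = 1 and |f(x)| ≤ 1, which forces x =
  -- f(x).
  have hin : ∀ x : E, ‖x‖ = 1 → 0 < inner ℝ x (x - f x) := by
    intro x hx
    rw [inner_sub_right, real_inner_self_eq_norm_sq, hx]
    have h1 : inner ℝ x (f x) ≤ ‖x‖ * ‖f x‖ := real_inner_le_norm _ _
    have h2 : inner ℝ x (f x) ≤ 1 := by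
      rw [hx, one_mul] at h1; exact h1.trans (hb x hx.le)
    refine lt_of_le_of_ne (by linarith) fun h => ?_
    have h3 : inner ℝ x (f x) = 1 := by linarith
    have h4 : ‖x - f x‖ ^ 2 ≤ 0 := by
      rw [norm_sub_sq_real, h3, hx]
      nlinarith [hb x hx.le, norm_nonneg (f x)]
    exact hu x hx.le (norm_eq_zero.1 (pow_eq_zero_iff (two_ne_zero) |>.1
      (le_antisymm h4 (sq_nonneg _))))
  -- Strict positivity of the discriminant, including on the sphere, is what makes the square root
  -- C¹.
  have hD : ∀ x : E, ‖x‖ ≤ 1 →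
      0 < (inner ℝ x (x - f x)) ^ 2 + ‖x - f x‖ ^ 2 * (1 - ‖x‖ ^ 2) := by
    intro x hx
    rcases hx.lt_or_eq with h | h
    · have h1 : 0 < 1 - ‖x‖ ^ 2 := by nlinarith [norm_nonneg x]
      have h2 : 0 < ‖x - f x‖ ^ 2 := pow_pos (norm_pos_iff.2 (hu x hx)) 2
      positivity
    · have := hin x h
      rw [h]; norm_num; positivity
  refine not_exists_retraction (r := fun x => x + sphereParam x (x - f x) • (x - f x))
    (fun x hx => ?_) (fun x hx => ?_) (fun x hx => ?_)
  · have hx' : ‖x‖ ≤ 1 := by simpa using hx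
    have hU : ContDiffAt ℝ 1 (fun x => x - f x) x := contDiffAt_id.sub hf.contDiffAt
    have hI : ContDiffAt ℝ 1 (fun x => (inner ℝ x (x - f x) : ℝ)) x := contDiffAt_id.inner ℝ hU
    have hS : ContDiffAt ℝ 1 (fun x => ‖x - f x‖ ^ 2) x := hU.norm_sq ℝ
    refine contDiffAt_id.add (ContDiffAt.smul ?_ hU)
    refine ContDiffAt.div (hI.neg.add (ContDiffAt.sqrt ?_ (hD x hx').ne')) hS
      (pow_pos (norm_pos_iff.2 (hu x hx')) 2).ne'
    exact (hI.pow 2).add (hS.mul (contDiffAt_const.sub (contDiffAt_id.norm_sq ℝ)))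
  · have hx' : ‖x‖ ≤ 1 := by simpa using hx
    have h2 : 0 < ‖x - f x‖ ^ 2 := pow_pos (norm_pos_iff.2 (hu x hx')) 2
    have hsq := Real.sq_sqrt (hD x hx').le
    have : ‖x + sphereParam x (x - f x) • (x - f x)‖ ^ 2 = 1 := by
      rw [norm_add_sq_real, norm_smul, inner_smul_right, mul_pow, Real.norm_eq_abs, sq_abs]
      unfold sphereParam
      set I : ℝ := inner ℝ x (x - f x)
      set q := √(I ^ 2 + ‖x - f x‖ ^ 2 * (1 - ‖x‖ ^ 2))
      set S := ‖x - f x‖ ^ 2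
      have : (‖x‖ ^ 2 + 2 * ((-I + q) / S * I) + ((-I + q) / S) ^ 2 * S) = 
        ‖x‖ ^ 2 + (q ^ 2 - I ^ 2) / S := by field_simp; ring
      rw [this, hsq]; field_simp; ring
    exact (pow_eq_one_iff_of_nonneg (norm_nonneg _) two_ne_zero).1 this
  · have h0 : sphereParam x (x - f x) = 0 := by
      unfold sphereParam
      rw [hx]; norm_num
      left
      rw [Real.sqrt_sq (hin x hx).le]; ring
    simp [h0]

/-- **Brouwer's fixed point theorem** for a map of the whole space into its unit ball. -/
theorem exists_fixedPoint_of_norm_le_one {f : E → E} (hf : Continuous f)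
    (hb : ∀ x, ‖f x‖ ≤ 1) : ∃ x, f x = x := by
  by_contra! hne
  have hpos : ∀ x, 0 < ‖f x - x‖ := fun x => norm_pos_iff.2 (sub_ne_zero.2 (hne x))
  obtain ⟨x₀, hx₀, hmin⟩ := (isCompact_closedBall (0 : E) 1).exists_isMinOn
    ⟨0, by simp⟩ (f := fun x => ‖f x - x‖) (by fun_prop)
  -- Here 2η is the least displacement of f on the unit ball. A smooth approximation within η / 2,
  -- shrunk by 1 + η / 2 to map into the ball, has a fixed point that f displaces by less than η.
  set η := ‖f x₀ - x₀‖ / 2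
  have hη : 0 < η := half_pos (hpos x₀)
  obtain ⟨g, hg, hgf, -⟩ := hf.exists_contDiff_approx (ε := fun _ => η / 2) 1 continuous_const
    (fun _ => half_pos hη)
  have hgb : ∀ x, ‖g x‖ ≤ 1 + η / 2 := fun x => by
    have h1 := (hgf x).le
    rw [dist_eq_norm] at h1
    have h2 := norm_le_norm_add_norm_sub' (g x) (f x)
    linarith [hb x]
  obtain ⟨x, hx, hfx⟩ := fixedPoint_of_contDiff (f := fun x => (1 + η / 2)⁻¹ • g x)
    (contDiff_const.smul hg) (fun x _ => by
      rw [norm_smul, norm_inv, Real.norm_of_nonneg (by positivity), inv_mul_le_iff₀ (by positivity)]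
      simpa using hgb x)
  have hgx : g x = (1 + η / 2) • x := by
    rw [← hfx, smul_smul, mul_inv_cancel₀ (by positivity), one_smul, hfx]
  have h1 := hgf x
  rw [dist_eq_norm, hgx] at h1
  have h2 : ‖f x - x‖ ≤ ‖(1 + η / 2) • x - f x‖ + ‖(η / 2) • x‖ := by
    rw [norm_sub_rev ((1 + η / 2) • x)]
    calc ‖f x - x‖ = ‖(f x - (1 + η / 2) • x) + (η / 2) • x‖ := by
          congr 1; rw [add_smul, one_smul]; abel
      _ ≤ _ := norm_add_le _ _
  have h3 : ‖(η / 2) • x‖ ≤ η / 2 := by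
    rw [norm_smul, Real.norm_of_nonneg (by positivity)]
    exact mul_le_of_le_one_right (by positivity) hx
  have h4 : ‖f x₀ - x₀‖ ≤ ‖f x - x‖ := hmin (by simpa using hx)
  have h5 : ‖f x₀ - x₀‖ = 2 * η := by simp only [η]; ring
  linarith

theorem exists_fixedPoint_of_norm_le {f : E → E} (hf : Continuous f) {b : ℝ}
    (hb : ∀ x, ‖f x‖ ≤ b) : ∃ x, f x = x := by
  have hb' : 0 < b + 1 := by linarith [(norm_nonneg _).trans (hb 0)]
  obtain ⟨x, hx⟩ := exists_fixedPoint_of_norm_le_one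
    (f := fun x => (b + 1)⁻¹ • f ((b + 1) • x)) (by fun_prop) (fun x => by
      rw [norm_smul, norm_inv, Real.norm_of_nonneg hb'.le, inv_mul_le_iff₀ hb']
      linarith [hb ((b + 1) • x)])
  refine ⟨(b + 1) • x, ?_⟩
  rw [inv_smul_eq_iff₀ hb'.ne'] at hx
  exact hx

end Brouwer

/-- A continuous retraction of `ι → ℝ` onto the simplex of the nonnegative vectors `x` with `∑ i, x i * w = 1`. -/
noncomputable def simplexRetraction {ι : Type*} [Fintype ι] (w : ℝ) (x : ι → ℝ) (i : ι) : ℝ :=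
  (max (x i) 0 + max (1 / w - ∑ j, max (x j) 0) 0 / Fintype.card ι) /
    max 1 (w * ∑ j, max (x j) 0)

theorem continuous_simplexRetraction {ι : Type*} [Fintype ι] (w : ℝ) :
    Continuous (simplexRetraction (ι := ι) w) := by
  refine continuous_pi fun i => ?_
  unfold simplexRetraction
  exact Continuous.div (by fun_prop) (by fun_prop)
    fun x => (lt_of_lt_of_le one_pos (le_max_left _ _)).ne'

theorem simplexRetraction_nonneg {ι : Type*} [Fintype ι] (w : ℝ) (x : ι → ℝ) (i : ι) :
    0 ≤ simplexRetraction w x i := by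
  unfold simplexRetraction
  positivity

/-- If the positive parts have too little mass, the deficit is shared equally and the denominator is
1; if they have too much, there is no deficit and the denominator normalizes. -/
theorem sum_simplexRetraction {ι : Type*} [Fintype ι] [Nonempty ι] {w : ℝ} (hw : 0 < w)
    (x : ι → ℝ) : ∑ i, simplexRetraction w x i * w = 1 := by
  unfold simplexRetraction
  rw [← Finset.sum_mul, ← Finset.sum_div, Finset.sum_add_distrib]
  set s := ∑ j, max (x j) 0
  have hcard : (Fintype.card ι : ℝ) ≠ 0 := by exact_mod_cast Fintype.card_ne_zero
  simp only [Finset.sum_const, Finset.card_univ, nsmul_eq_mul]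
  rw [mul_div_cancel₀ _ hcard]
  rcases le_total (w * s) 1 with h | h
  · have h' : s ≤ 1 / w := by rwa [le_div_iff₀ hw, mul_comm]
    rw [max_eq_left h, max_eq_left (by linarith)]
    field_simp
    ring
  · have h' : 1 / w ≤ s := by rwa [div_le_iff₀ hw, mul_comm]
    rw [max_eq_right h, max_eq_right (by linarith)]
    have hs : s ≠ 0 := right_ne_zero_of_mul (zero_lt_one.trans_le h).ne'
    rw [add_zero]
    field_simp

theorem simplexRetraction_eq_self {ι : Type*} [Fintype ι] {w : ℝ} (hw : 0 < w)
    {x : ι → ℝ} (h0 : ∀ i, 0 ≤ x i) (h1 : ∑ i, x i * w = 1) : simplexRetraction w x = x := by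
  have hs : ∑ j, max (x j) 0 = 1 / w := by
    rw [eq_div_iff hw.ne', ← h1, Finset.sum_mul]
    exact Finset.sum_congr rfl fun j _ => by rw [max_eq_left (h0 j)]
  ext i
  unfold simplexRetraction
  rw [hs, max_eq_left (h0 i)]
  field_simp
  simp

/-- **Brouwer's fixed point theorem** on a product of simplices. -/
theorem exists_fixedPoint_prod_simplex {κ ι : Type*} [Fintype κ] [Fintype ι] [Nonempty ι] {w : ℝ}
    (hw : 0 < w) {S : Set (κ → ι → ℝ)}
    (hS : S = {μ | ∀ k, (∀ i, 0 ≤ μ k i) ∧ ∑ j, μ k j * w = 1})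
    {Ψ : (κ → ι → ℝ) → κ → ι → ℝ} (hmaps : Set.MapsTo Ψ S S) (hc : ContinuousOn Ψ S) :
    ∃ μ ∈ S, Ψ μ = μ := by
  let R : (κ → ι → ℝ) → κ → ι → ℝ := fun μ k => simplexRetraction w (μ k)
  have hRc : Continuous R := continuous_pi fun k =>
    (continuous_simplexRetraction w).comp (continuous_apply k)
  have hRS : ∀ μ, R μ ∈ S := fun μ => by
    rw [hS]
    exact fun k => ⟨simplexRetraction_nonneg w _, sum_simplexRetraction hw _⟩
  have hΨR : Continuous fun μ => Ψ (R μ) := by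
    rw [← continuousOn_univ]
    exact hc.comp hRc.continuousOn fun μ _ => hRS μ
  let f : EuclideanSpace ℝ (κ × ι) → EuclideanSpace ℝ (κ × ι) := fun x =>
    WithLp.toLp 2 fun p => Ψ (R fun k i => x (k, i)) p.1 p.2
  have hf : Continuous f := by
    refine (PiLp.continuous_toLp 2 _).comp (continuous_pi fun p => ?_)
    have h1 : Continuous fun x : EuclideanSpace ℝ (κ × ι) => fun (k : κ) (i : ι) => x (k, i) := by
      fun_prop
    exact (continuous_apply p.2).comp ((continuous_apply p.1).comp (hΨR.comp h1))
  have hle : ∀ μ ∈ S, ∀ k i, |μ k i| ≤ 1 / w := by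
    intro μ hμ k i
    rw [hS] at hμ
    rw [abs_of_nonneg ((hμ k).1 i), le_div_iff₀ hw, ← (hμ k).2]
    exact Finset.single_le_sum (f := fun j => μ k j * w)
      (fun j _ => mul_nonneg ((hμ k).1 j) hw.le) (Finset.mem_univ i)
  have hb : ∀ x, ‖f x‖ ≤ √(∑ _p : κ × ι, (1 / w) ^ 2) := by
    intro x
    rw [EuclideanSpace.norm_eq]
    refine Real.sqrt_le_sqrt (Finset.sum_le_sum fun p _ => ?_)
    rw [Real.norm_eq_abs]
    exact pow_le_pow_left₀ (abs_nonneg _) (hle _ (hmaps (hRS _)) _ _) 2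
  obtain ⟨x, hx⟩ := exists_fixedPoint_of_norm_le hf hb
  let μ : κ → ι → ℝ := fun k i => x (k, i)
  have hμ : Ψ (R μ) = μ := by
    ext k i
    have := congrArg (fun y : EuclideanSpace ℝ (κ × ι) => y (k, i)) hx
    exact this
  have hμS : μ ∈ S := hμ ▸ hmaps (hRS μ)
  have hRμ : R μ = μ := by
    have h := hμS
    rw [hS] at h
    exact funext fun k => simplexRetraction_eq_self hw (h k).1 (h k).2
  exact ⟨μ, hμS, by rw [hRμ] at hμ; exact hμ⟩

end MFG

namespace MFG

/-! ### Strongly convex functions and their Legendre transform -/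

section StrongConvexity

variable {E : Type*} [NormedAddCommGroup E] [InnerProductSpace ℝ E] {ℓ : E → ℝ} {κ : ℝ}

/-- Mean value theorem for t ↦ Dℓ(b + t(a - b))(a - b), whose derivative is the Hessian in the
direction a - b. -/
theorem fderiv_strongly_monotone (hℓ : ContDiff ℝ 2 ℓ)
    (hκ : ∀ a b, κ * ‖b‖ ^ 2 ≤ fderiv ℝ (fderiv ℝ ℓ) a b b) (a b : E) :
    κ * ‖a - b‖ ^ 2 ≤ (fderiv ℝ ℓ a - fderiv ℝ ℓ b) (a - b) := by
  have hd : Differentiable ℝ (fderiv ℝ ℓ) :=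
    (hℓ.fderiv_right (m := 1) (by norm_num)).differentiable (by norm_num)
  have hder : ∀ t : ℝ, HasDerivAt (fun t : ℝ => fderiv ℝ ℓ (b + t • (a - b)) (a - b))
      (fderiv ℝ (fderiv ℝ ℓ) (b + t • (a - b)) (a - b) (a - b)) t := by
    intro t
    have h1 : HasDerivAt (fun t : ℝ => b + t • (a - b)) (a - b) t := by
      simpa using ((hasDerivAt_id t).smul_const (a - b)).const_add b
    have h2 := (hd (b + t • (a - b))).hasFDerivAt.comp_hasDerivAt t h1
    simpa using h2.clm_apply (hasDerivAt_const t (a - b))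
  obtain ⟨c, -, hc⟩ := exists_hasDerivAt_eq_slope _ _ zero_lt_one
    (fun t _ => (hder t).continuousAt.continuousWithinAt) fun t _ => hder t
  have := hκ (b + c • (a - b)) (a - b)
  rw [hc] at this
  simpa using this

theorem le_of_hessian_nonneg (hℓ : ContDiff ℝ 2 ℓ) (hκ0 : 0 ≤ κ)
    (hκ : ∀ a b, κ * ‖b‖ ^ 2 ≤ fderiv ℝ (fderiv ℝ ℓ) a b b) (a b : E) :
    ℓ b + fderiv ℝ ℓ b (a - b) ≤ ℓ a := by
  have hd : Differentiable ℝ ℓ := hℓ.differentiable (by norm_num)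
  have hder : ∀ t : ℝ, HasDerivAt (fun t : ℝ => ℓ (b + t • (a - b)))
      (fderiv ℝ ℓ (b + t • (a - b)) (a - b)) t := by
    intro t
    have h1 : HasDerivAt (fun t : ℝ => b + t • (a - b)) (a - b) t := by
      simpa using ((hasDerivAt_id t).smul_const (a - b)).const_add b
    exact (hd (b + t • (a - b))).hasFDerivAt.comp_hasDerivAt t h1
  obtain ⟨c, hc0, hc⟩ := exists_hasDerivAt_eq_slope _ _ zero_lt_one
    (fun t _ => (hder t).continuousAt.continuousWithinAt) fun t _ => hder t
  have hm := fderiv_strongly_monotone hℓ hκ (b + c • (a - b)) b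
  rw [add_sub_cancel_left, map_smul, smul_eq_mul, sub_apply] at hm
  have h0 : 0 ≤ κ * ‖c • (a - b)‖ ^ 2 := by positivity
  have h1 := nonneg_of_mul_nonneg_right (h0.trans hm) hc0.1
  simp only [one_smul, zero_smul, add_sub_cancel, add_zero, sub_zero, div_one] at hc
  linarith

/-- Two tangent inequalities, at 0 and at the midpoint a/2, plus strong monotonicity between these
points. The factor κ/4 is κ|a/2|²; it is not optimal, but coercivity is all that is needed. -/
theorem quadratic_growth (hℓ : ContDiff ℝ 2 ℓ) (hκ0 : 0 ≤ κ)
    (hκ : ∀ a b, κ * ‖b‖ ^ 2 ≤ fderiv ℝ (fderiv ℝ ℓ) a b b) (a : E) :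
    ℓ 0 - ‖fderiv ℝ ℓ 0‖ * ‖a‖ + κ / 4 * ‖a‖ ^ 2 ≤ ℓ a := by
  have h1 := le_of_hessian_nonneg hℓ hκ0 hκ a ((1 / 2 : ℝ) • a)
  have h2 := le_of_hessian_nonneg hℓ hκ0 hκ ((1 / 2 : ℝ) • a) 0
  have h3 := fderiv_strongly_monotone hℓ hκ ((1 / 2 : ℝ) • a) 0
  have h4 : a - (1 / 2 : ℝ) • a = (1 / 2 : ℝ) • a := by module
  rw [h4] at h1
  rw [sub_zero, norm_smul, mul_pow, sub_apply] at h3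
  rw [sub_zero] at h2
  have h5 : fderiv ℝ ℓ 0 ((1 / 2 : ℝ) • a) = 1 / 2 * fderiv ℝ ℓ 0 a := by simp
  have h6 : -(‖fderiv ℝ ℓ 0‖ * ‖a‖) ≤ fderiv ℝ ℓ 0 a :=
    (abs_le.1 ((fderiv ℝ ℓ 0).le_opNorm a)).1
  rw [h5, Real.norm_of_nonneg (by norm_num)] at h3
  linarith

variable [FiniteDimensional ℝ E]

theorem exists_maximizer (hℓ : ContDiff ℝ 2 ℓ) (hκ0 : 0 < κ)
    (hκ : ∀ a b, κ * ‖b‖ ^ 2 ≤ fderiv ℝ (fderiv ℝ ℓ) a b b) (p : E) :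
    ∃ a, (∀ b, inner ℝ b p - ℓ b ≤ inner ℝ a p - ℓ a) ∧ ∀ v, fderiv ℝ ℓ a v = inner ℝ v p := by
  have hd : Differentiable ℝ ℓ := hℓ.differentiable (by norm_num)
  obtain ⟨a, ha⟩ := Continuous.exists_forall_le' (f := fun a : E => ℓ a - inner ℝ a p)
    (by have := hℓ.continuous; fun_prop) 0 (by
      have h := tendsto_norm_cocompact_atTop (E := E)
      -- Beyond this radius the quadratic term κ|a|²/4 dominates both linear terms, so the value at
      -- 0 is not beaten.
      filter_upwards [h.eventually_ge_atTop (4 * (‖fderiv ℝ ℓ 0‖ + ‖p‖) / κ)] with a ha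
      have h1 := quadratic_growth hℓ hκ0.le hκ a
      have h2 : inner ℝ a p ≤ ‖a‖ * ‖p‖ := real_inner_le_norm _ _
      rw [div_le_iff₀ hκ0] at ha
      simp only [inner_zero_left, sub_zero]
      nlinarith [norm_nonneg a])
  refine ⟨a, fun b => by linarith [ha b], fun v => ?_⟩
  have hmin : IsLocalMin (fun a : E => ℓ a - inner ℝ a p) a := Filter.Eventually.of_forall ha
  have hder : HasFDerivAt (fun a : E => ℓ a - inner ℝ a p)
      (fderiv ℝ ℓ a - innerSL ℝ p) a := by
    refine (hd a).hasFDerivAt.sub ?_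
    have := (innerSL ℝ p).hasFDerivAt (x := a)
    refine this.congr_of_eventuallyEq (Filter.Eventually.of_forall fun b => ?_)
    simp [real_inner_comm]
  have h0 := congrArg (fun A : E →L[ℝ] ℝ => A v) (hmin.hasFDerivAt_eq_zero hder)
  simp only [sub_apply, innerSL_apply_apply, _root_.zero_apply] at h0
  rw [real_inner_comm v p] at h0
  linarith

end StrongConvexity

/-! ### The gradient of the Hamiltonian: formula, linear growth, local Lipschitz continuity -/

variable {d : ℕ}

/-- Envelope argument. If b is the maximizer at p + h, optimality of a and b gives 0 ≤ H(p + h) -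
H(p) - ⟨a, h⟩ ≤ ⟨b - a, h⟩, and strong monotonicity gives κ|b - a| ≤ |h|; the remainder is thus at
most |h|²/κ. -/
theorem gradient_hamiltonian_eq {L : Space d → Space d → ℝ} {x : Space d} {κ : ℝ} (hκ0 : 0 < κ)
    (hℓ : ContDiff ℝ 2 (L x))
    (hκ : ∀ a b, κ * ‖b‖ ^ 2 ≤ fderiv ℝ (fderiv ℝ (L x)) a b b) (p : Space d) {a : Space d}
    (ha : ∀ v, fderiv ℝ (L x) a v = inner ℝ v p) : gradient (hamiltonian L x) p = a := by
  have hmax : ∀ p a : Space d, (∀ v, fderiv ℝ (L x) a v = inner ℝ v p) →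
      ∀ b, inner ℝ b p - L x b ≤ inner ℝ a p - L x a := by
    intro p a ha b
    have := le_of_hessian_nonneg hℓ hκ0.le hκ b a
    rw [ha, inner_sub_left] at this
    linarith
  have hH : ∀ p a : Space d, (∀ v, fderiv ℝ (L x) a v = inner ℝ v p) →
      hamiltonian L x p = inner ℝ a p - L x a := fun p a ha =>
    le_antisymm (ciSup_le (hmax p a ha))
      (le_ciSup (f := fun a => inner ℝ a p - L x a) ⟨_, Set.forall_mem_range.2 (hmax p a ha)⟩ a)
  refine HasGradientAt.gradient ?_
  rw [hasGradientAt_iff_hasFDerivAt, hasFDerivAt_iff_isLittleO_nhds_zero]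
  refine Asymptotics.IsBigO.trans_isLittleO (g := fun h : Space d => ‖h‖ ^ 2) ?_ ?_
  · refine Asymptotics.IsBigO.of_bound (1 / κ) (Filter.Eventually.of_forall fun h => ?_)
    obtain ⟨b, -, hb⟩ := exists_maximizer hℓ hκ0 hκ (p + h)
    rw [hH p a ha, hH (p + h) b hb]
    have h1 := hmax p a ha b
    have h2 := hmax (p + h) b hb a
    have h3 := fderiv_strongly_monotone hℓ hκ b a
    rw [sub_apply, hb, ha, ← inner_sub_right, add_sub_cancel_left] at h3
    have h4 : inner ℝ (b - a) h ≤ ‖b - a‖ * ‖h‖ := real_inner_le_norm _ _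
    have h5 : κ * ‖b - a‖ ≤ ‖h‖ := by
      rcases (norm_nonneg (b - a)).eq_or_lt with h0 | h0
      · rw [← h0]; simp
      · have : ‖b - a‖ * (κ * ‖b - a‖) ≤ ‖b - a‖ * ‖h‖ := by nlinarith
        exact le_of_mul_le_mul_left this h0
    have h6 : InnerProductSpace.toDual ℝ (Space d) a h = inner ℝ a h := rfl
    rw [inner_sub_left] at h4
    rw [inner_add_right] at h2 ⊢
    rw [inner_add_right] at h2
    rw [h6, Real.norm_eq_abs, norm_pow, norm_norm, abs_le]
    have h7 : ‖b - a‖ * ‖h‖ ≤ 1 / κ * ‖h‖ ^ 2 := by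
      rw [div_mul_eq_mul_div, one_mul, le_div_iff₀ hκ0]
      nlinarith [norm_nonneg h]
    constructor <;> linarith [mul_nonneg (norm_nonneg (b - a)) (norm_nonneg h)]
  · have := Asymptotics.isLittleO_norm_pow_id (E' := Space d) (n := 2) (by norm_num)
    exact this

theorem HypH1.contDiff_right {L : Space d → Space d → ℝ} (hL : HypH1 L) (x : Space d) :
    ContDiff ℝ 2 (L x) :=
  hL.1.comp (contDiff_prodMk_right x)

/-- The maximizer a satisfies D_aL(x, a) = p, so strong monotonicity between a and 0 gives C₄|a| ≤
|p| + |D_aL(x, 0)|. -/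
theorem HypH1.exists_norm_gradient_hamiltonian_le {L : Space d → Space d → ℝ} (hL : HypH1 L) :
    ∃ κ M : ℝ, 0 < κ ∧ ∀ x p, ‖gradient (hamiltonian L x) p‖ ≤ (‖p‖ + M) / κ := by
  obtain ⟨-, ⟨B, hB⟩, C₁, C₂, C₃, C₄, C₅, hC₁, hC₂, -, hC₄, -, h⟩ := id hL
  refine ⟨C₄, C₁ + C₂ - B, hC₄, fun x p => ?_⟩
  have hκ : ∀ a b, C₄ * ‖b‖ ^ 2 ≤ fderiv ℝ (fderiv ℝ (L x)) a b b := fun a b => (h x a).2.2.1 b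
  obtain ⟨a, -, ha⟩ := exists_maximizer (hL.contDiff_right x) hC₄ hκ p
  rw [gradient_hamiltonian_eq hC₄ (hL.contDiff_right x) hκ p ha]
  -- Uniformly in x: convexity bounds the slope at 0 by L on the unit sphere minus L(x, 0), that is,
  -- by C₁ + C₂ - B.
  have h0 : ∀ v : Space d, |fderiv ℝ (L x) 0 v| ≤ (C₁ + C₂ - B) * ‖v‖ := by
    have key : ∀ v : Space d, fderiv ℝ (L x) 0 v ≤ (C₁ + C₂ - B) * ‖v‖ := by
      intro v
      rcases eq_or_ne v 0 with rfl | hv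
      · simp
      have hv' : 0 < ‖v‖ := norm_pos_iff.2 hv
      have h1 := le_of_hessian_nonneg (hL.contDiff_right x) hC₄.le hκ (‖v‖⁻¹ • v) 0
      have h2 := (h x (‖v‖⁻¹ • v)).1
      rw [norm_smul, norm_inv, norm_norm, inv_mul_cancel₀ hv'.ne'] at h2
      rw [sub_zero, map_smul, smul_eq_mul] at h1
      have h3 : ‖v‖⁻¹ * fderiv ℝ (L x) 0 v ≤ C₁ + C₂ - B := by linarith [hB x 0]
      rwa [inv_mul_le_iff₀ hv', mul_comm] at h3
    intro v
    rw [abs_le]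
    have := key (-v)
    rw [map_neg, norm_neg] at this
    constructor <;> linarith [key v]
  have h1 := fderiv_strongly_monotone (hL.contDiff_right x) hκ a 0
  rw [sub_zero, sub_apply, ha] at h1
  have h2 := (abs_le.1 (h0 a)).1
  have h3 : inner ℝ a p ≤ ‖a‖ * ‖p‖ := real_inner_le_norm _ _
  rw [le_div_iff₀ hC₄]
  have hM : 0 ≤ C₁ + C₂ - B := by
    have := hB x 0
    have := (h x 0).1
    norm_num at this
    linarith
  rcases (norm_nonneg a).eq_or_lt with h0 | h0
  · rw [← h0]; linarith [norm_nonneg p]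
  · have : ‖a‖ * (‖a‖ * C₄) ≤ ‖a‖ * (‖p‖ + (C₁ + C₂ - B)) := by nlinarith
    exact le_of_mul_le_mul_left this h0

theorem exists_lipschitzOnWith_of_contDiff {E F : Type*} [NormedAddCommGroup E] [NormedSpace ℝ E]
    [NormedAddCommGroup F] [NormedSpace ℝ F] {f : E → F} (hf : ContDiff ℝ 1 f) {s : Set E}
    (hs : IsCompact s) (hc : Convex ℝ s) : ∃ K, LipschitzOnWith K f s := by
  obtain ⟨M, hM⟩ := hs.exists_bound_of_continuousOn
    (hf.continuous_fderiv (by norm_num)).continuousOn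
  refine ⟨Real.toNNReal M, hc.lipschitzOnWith_of_nnnorm_fderiv_le
    (fun x _ => hf.differentiable (by norm_num) x) fun x hx => ?_⟩
  rw [← NNReal.coe_le_coe, coe_nnnorm]
  exact (hM x hx).trans (Real.le_coe_toNNReal M)

/-- For the maximizers a at (x, p) and b at (y, q), strong monotonicity of D_aL(x,·) bounds κ|a - b|
by |p - q| plus the variation of D_aL(·, b) between x and y. As L is C², the latter is Lipschitz on
compact sets, and b stays bounded by the linear growth. -/
theorem HypH1.exists_gradient_hamiltonian_lipschitz {L : Space d → Space d → ℝ} (hL : HypH1 L)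
    (R P : ℝ) : ∃ K : ℝ, 0 ≤ K ∧ ∀ x y p q : Space d, ‖x‖ ≤ R → ‖y‖ ≤ R → ‖p‖ ≤ P → ‖q‖ ≤ P →
      ‖gradient (hamiltonian L x) p - gradient (hamiltonian L y) q‖ ≤
        K * (‖x - y‖ + ‖p - q‖) := by
  obtain ⟨κ', M, hκ', hbd⟩ := hL.exists_norm_gradient_hamiltonian_le
  obtain ⟨-, -, C₁, C₂, C₃, κ, C₅, -, -, -, hκ0, -, h⟩ := id hL
  have hκ : ∀ x a b, κ * ‖b‖ ^ 2 ≤ fderiv ℝ (fderiv ℝ (L x)) a b b :=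
    fun x a b => (h x a).2.2.1 b
  have hC1 : ContDiff ℝ 1 (fderiv ℝ fun z : Space d × Space d => L z.1 z.2) :=
    hL.1.fderiv_right (by norm_num)
  obtain ⟨Λ, hΛ⟩ := exists_lipschitzOnWith_of_contDiff hC1
    ((isCompact_closedBall (0 : Space d) R).prod
      (isCompact_closedBall (0 : Space d) ((P + M) / κ')))
    ((convex_closedBall _ _).prod (convex_closedBall _ _))
  have hfd : ∀ x a v : Space d, fderiv ℝ (L x) a v =
      fderiv ℝ (fun z : Space d × Space d => L z.1 z.2) (x, a) (0, v) := by
    intro x a v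
    have h1 : HasFDerivAt (L x) _ a :=
      ((hL.1.differentiable (by norm_num)) (x, a)).hasFDerivAt.comp a (hasFDerivAt_prodMk_right x a)
    rw [h1.fderiv]
    simp
  refine ⟨(1 + Λ) / κ, by positivity, fun x y p q hx hy hp hq => ?_⟩
  obtain ⟨a, -, ha⟩ := exists_maximizer (hL.contDiff_right x) hκ0 (hκ x) p
  obtain ⟨b, -, hb⟩ := exists_maximizer (hL.contDiff_right y) hκ0 (hκ y) q
  have hbn := hbd y q
  rw [gradient_hamiltonian_eq hκ0 (hL.contDiff_right y) (hκ y) q hb] at hbn ⊢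
  rw [gradient_hamiltonian_eq hκ0 (hL.contDiff_right x) (hκ x) p ha]
  have hbR : ‖b‖ ≤ (P + M) / κ' := hbn.trans (by gcongr)
  have h1 := fderiv_strongly_monotone (hL.contDiff_right x) (hκ x) a b
  rw [sub_apply, ha] at h1
  have h2 : |fderiv ℝ (L x) b (a - b) - fderiv ℝ (L y) b (a - b)| ≤
      Λ * ‖x - y‖ * ‖a - b‖ := by
    rw [hfd, hfd, ← sub_apply]
    refine (ContinuousLinearMap.le_opNorm (fderiv ℝ (fun z : Space d × Space d => L z.1 z.2) (x, b) -
      fderiv ℝ (fun z : Space d × Space d => L z.1 z.2) (y, b)) (0, a - b)).trans ?_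
    have h3 := hΛ.dist_le_mul (x, b) ⟨by simpa using hx, by simpa using hbR⟩ (y, b)
      ⟨by simpa using hy, by simpa using hbR⟩
    rw [dist_eq_norm, Prod.dist_eq, dist_self, max_eq_left dist_nonneg, dist_eq_norm] at h3
    refine mul_le_mul h3 (by simp [Prod.norm_def]) (norm_nonneg _) (by positivity)
  rw [hb] at h2
  have h3 : inner ℝ (a - b) (p - q) ≤ ‖a - b‖ * ‖p - q‖ := real_inner_le_norm _ _
  rw [inner_sub_right] at h3
  have h4 := (abs_le.1 h2).1
  rw [div_mul_eq_mul_div, le_div_iff₀ hκ0]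
  rcases (norm_nonneg (a - b)).eq_or_lt with h0 | h0
  · rw [← h0]; simp; positivity
  · have h5 : ‖a - b‖ * (‖a - b‖ * κ) ≤ ‖a - b‖ * (‖p - q‖ + Λ * ‖x - y‖) := by nlinarith
    have h6 := le_of_mul_le_mul_left h5 h0
    nlinarith [norm_nonneg (x - y), norm_nonneg (p - q), mul_nonneg Λ.coe_nonneg (norm_nonneg (p - q))]

end MFG

namespace MFG

variable {d : ℕ}

/-! ### Interpolation on the grid -/

theorem abs_coord_le_norm (x : Space d) (l : Fin d) : |x l| ≤ ‖x‖ := by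
  simpa using PiLp.norm_apply_le x l

theorem norm_le_sum_abs (x : Space d) : ‖x‖ ≤ ∑ l, |x l| := by
  rw [EuclideanSpace.norm_eq]
  refine Real.sqrt_le_iff.2 ⟨Finset.sum_nonneg fun _ _ => abs_nonneg _, ?_⟩
  simp only [Real.norm_eq_abs]
  exact Finset.sum_sq_le_sq_sum_of_nonneg fun _ _ => abs_nonneg _

theorem norm_le_of_abs_coord_le {x : Space d} {r : ℝ} (h : ∀ l, |x l| ≤ r) : ‖x‖ ≤ d * r := by
  refine (norm_le_sum_abs x).trans ((Finset.sum_le_sum fun l _ => h l).trans ?_)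
  simp

theorem gridPt_add (Δx : ℝ) (i j : Fin d → ℤ) :
    gridPt Δx (i + j) = gridPt Δx i + gridPt Δx j := by
  ext l
  simp [gridPt, add_mul]

theorem hat_nonneg (ξ : ℝ) : 0 ≤ hat ξ := le_max_left _ _

theorem hat_le_one (ξ : ℝ) : hat ξ ≤ 1 :=
  max_le zero_le_one (by linarith [abs_nonneg ξ])

theorem hat_eq_zero {ξ : ℝ} (h : 1 ≤ |ξ|) : hat ξ = 0 := max_eq_left (by linarith)

theorem abs_hat_sub_hat_le (a b : ℝ) : |hat a - hat b| ≤ |a - b| := by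
  unfold hat
  refine (abs_max_sub_max_le_max 0 (1 - |a|) 0 (1 - |b|)).trans (max_le (by simp) ?_)
  rw [sub_sub_sub_cancel_left, abs_sub_comm a b]
  exact abs_abs_sub_abs_le _ _

theorem hat_sub_intCast_eq_zero {s : ℝ} {n : ℤ} (h : n ∉ Finset.Icc ⌊s⌋ (⌊s⌋ + 1)) :
    hat (s - n) = 0 := by
  refine hat_eq_zero ?_
  rw [Finset.mem_Icc, not_and_or, not_le, not_le] at h
  rcases h with h | h
  · have : (n : ℝ) + 1 ≤ ⌊s⌋ := by exact_mod_cast h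
    exact le_abs.2 (Or.inl (by linarith [Int.floor_le s]))
  · have : (⌊s⌋ : ℝ) + 1 + 1 ≤ n := by exact_mod_cast h
    exact le_abs.2 (Or.inr (by linarith [Int.lt_floor_add_one s]))

theorem sum_hat_sub_intCast (s : ℝ) : ∑ n ∈ Finset.Icc ⌊s⌋ (⌊s⌋ + 1), hat (s - n) = 1 := by
  have h : Finset.Icc ⌊s⌋ (⌊s⌋ + 1) = {⌊s⌋, ⌊s⌋ + 1} := by
    ext n; simp; omega
  have h1 := Int.floor_le s
  have h2 := Int.lt_floor_add_one s
  rw [h, Finset.sum_pair (by omega)]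
  unfold hat
  push_cast
  rw [abs_of_nonneg (by linarith), abs_of_nonpos (by linarith), max_eq_right (by linarith),
    max_eq_right (by linarith)]
  ring

/-- The indices of the vertices of the grid cube that contains `x`. -/
noncomputable def vertices (Δx : ℝ) (x : Space d) : Finset (Fin d → ℤ) :=
  Fintype.piFinset fun l => Finset.Icc ⌊x l / Δx⌋ (⌊x l / Δx⌋ + 1)

theorem beta1_nonneg (Δx : ℝ) (i : Fin d → ℤ) (x : Space d) : 0 ≤ beta1 Δx i x :=
  Finset.prod_nonneg fun _ _ => hat_nonneg _

theorem beta1_eq_zero {Δx : ℝ} {i : Fin d → ℤ} {x : Space d} (h : i ∉ vertices Δx x) :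
    beta1 Δx i x = 0 := by
  rw [vertices, Fintype.mem_piFinset, not_forall] at h
  obtain ⟨l, hl⟩ := h
  exact Finset.prod_eq_zero (Finset.mem_univ l) (hat_sub_intCast_eq_zero hl)

/-- Expanding the product over the coordinates of the one-dimensional partitions of unity. -/
theorem sum_beta1 (Δx : ℝ) (x : Space d) : ∑ i ∈ vertices Δx x, beta1 Δx i x = 1 := by
  unfold vertices beta1
  rw [← Finset.prod_univ_sum (fun l => Finset.Icc ⌊x l / Δx⌋ (⌊x l / Δx⌋ + 1))
    fun l n => hat (x l / Δx - n)]
  exact Finset.prod_eq_one fun l _ => sum_hat_sub_intCast _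

theorem sum_beta1_of_subset {Δx : ℝ} {x : Space d} {S : Finset (Fin d → ℤ)}
    (hS : vertices Δx x ⊆ S) : ∑ i ∈ S, beta1 Δx i x = 1 := by
  rw [← sum_beta1 Δx x]
  exact (Finset.sum_subset hS fun i _ hi => beta1_eq_zero hi).symm

theorem interp1_eq_sum {Δx : ℝ} {x : Space d} {S : Finset (Fin d → ℤ)}
    (hS : vertices Δx x ⊆ S) (φ : (Fin d → ℤ) → ℝ) :
    interp1 Δx φ x = ∑ i ∈ S, beta1 Δx i x * φ i :=
  tsum_eq_sum fun i hi => by rw [beta1_eq_zero fun h => hi (hS h), zero_mul]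

theorem abs_sub_gridPt_le {Δx : ℝ} (hΔx : 0 < Δx) {x : Space d} {i : Fin d → ℤ}
    (hi : i ∈ vertices Δx x) (l : Fin d) : |x l - gridPt Δx i l| ≤ Δx := by
  rw [vertices, Fintype.mem_piFinset] at hi
  have h := Finset.mem_Icc.1 (hi l)
  have h1 : ((⌊x l / Δx⌋ : ℤ) : ℝ) ≤ i l := by exact_mod_cast h.1
  have h2 : (i l : ℝ) ≤ ⌊x l / Δx⌋ + 1 := by exact_mod_cast h.2
  have h3 : |x l / Δx - i l| ≤ 1 := abs_le.2
    ⟨by linarith [Int.floor_le (x l / Δx)], by linarith [Int.lt_floor_add_one (x l / Δx)]⟩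
  have h4 : x l - gridPt Δx i l = (x l / Δx - i l) * Δx := by
    simp only [gridPt]; field_simp
  rw [h4, abs_mul, abs_of_pos hΔx]
  exact mul_le_of_le_one_left hΔx.le h3

/-- The weights β_i¹ are nonnegative and sum to 1: interpolation is monotone and commutes with
constants, hence is stable in the sup norm. -/
theorem interp1_le_interp1_add {Δx : ℝ} {x : Space d} {φ ψ : (Fin d → ℤ) → ℝ} {M : ℝ}
    (h : ∀ i ∈ vertices Δx x, φ i ≤ ψ i + M) : interp1 Δx φ x ≤ interp1 Δx ψ x + M := by
  rw [interp1_eq_sum subset_rfl, interp1_eq_sum subset_rfl]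
  have : M = ∑ i ∈ vertices Δx x, beta1 Δx i x * M := by
    rw [← Finset.sum_mul, sum_beta1, one_mul]
  conv_rhs => rw [this]
  rw [← Finset.sum_add_distrib]
  refine Finset.sum_le_sum fun i hi => ?_
  rw [← mul_add]
  exact mul_le_mul_of_nonneg_left (h i hi) (beta1_nonneg _ _ _)

theorem interp1_const (Δx c : ℝ) (x : Space d) : interp1 Δx (fun _ => c) x = c := by
  rw [interp1_eq_sum subset_rfl, ← Finset.sum_mul, sum_beta1, one_mul]

theorem abs_interp1_sub_le {Δx : ℝ} {x : Space d} {φ ψ : (Fin d → ℤ) → ℝ} {M : ℝ}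
    (h : ∀ i ∈ vertices Δx x, |φ i - ψ i| ≤ M) : |interp1 Δx φ x - interp1 Δx ψ x| ≤ M := by
  rw [abs_le]
  constructor
  · linarith [interp1_le_interp1_add (x := x) (φ := ψ) (ψ := φ) (M := M)
      fun i hi => by linarith [(abs_le.1 (h i hi)).1]]
  · linarith [interp1_le_interp1_add (x := x) (φ := φ) (ψ := ψ) (M := M)
      fun i hi => by linarith [(abs_le.1 (h i hi)).2]]

theorem abs_interp1_le {Δx : ℝ} {x : Space d} {φ : (Fin d → ℤ) → ℝ} {M : ℝ}
    (h : ∀ i, |φ i| ≤ M) : |interp1 Δx φ x| ≤ M := by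
  have := abs_interp1_sub_le (Δx := Δx) (x := x) (φ := φ) (ψ := fun _ => 0) (M := M)
    fun i _ => by simpa using h i
  rwa [interp1_const, sub_zero] at this

/-- Interpolation commutes with grid translations; this lets the scheme propagate a discrete
Lipschitz constant without paying an interpolation constant at each step. -/
theorem interp1_add_gridPt {Δx : ℝ} (hΔx : Δx ≠ 0) (φ : (Fin d → ℤ) → ℝ) (x : Space d)
    (h : Fin d → ℤ) : interp1 Δx φ (x + gridPt Δx h) = interp1 Δx (fun i => φ (i + h)) x := by
  unfold interp1
  rw [← (Equiv.addRight h).tsum_eq]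
  refine tsum_congr fun i => ?_
  simp only [Equiv.coe_addRight]
  congr 1
  refine Finset.prod_congr rfl fun l _ => ?_
  congr 1
  simp only [gridPt, PiLp.add_apply, Pi.add_apply]
  push_cast
  field_simp
  ring

theorem abs_prod_sub_prod_le {ι : Type*} (s : Finset ι) (a b : ι → ℝ) (ha : ∀ i, |a i| ≤ 1)
    (hb : ∀ i, |b i| ≤ 1) : |∏ i ∈ s, a i - ∏ i ∈ s, b i| ≤ ∑ i ∈ s, |a i - b i| := by
  classical
  induction s using Finset.induction_on with
  | empty => simp
  | insert i s hi ih =>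
    rw [Finset.prod_insert hi, Finset.prod_insert hi, Finset.sum_insert hi]
    have h1 : |∏ i ∈ s, a i| ≤ 1 := by
      rw [Finset.abs_prod]
      exact Finset.prod_le_one (fun _ _ => abs_nonneg _) fun i _ => ha i
    calc |a i * ∏ i ∈ s, a i - b i * ∏ i ∈ s, b i|
        = |(a i - b i) * ∏ i ∈ s, a i + b i * (∏ i ∈ s, a i - ∏ i ∈ s, b i)| := by
          congr 1; ring
      _ ≤ |a i - b i| * |∏ i ∈ s, a i| + |b i| * |∏ i ∈ s, a i - ∏ i ∈ s, b i| := by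
          rw [← abs_mul, ← abs_mul]; exact abs_add_le _ _
      _ ≤ |a i - b i| + ∑ i ∈ s, |a i - b i| :=
          add_le_add (mul_le_of_le_one_right (abs_nonneg _) h1)
            ((mul_le_of_le_one_left (abs_nonneg _) (hb i)).trans ih)

theorem abs_beta1_sub_le {Δx : ℝ} (hΔx : 0 < Δx) (i : Fin d → ℤ) (x y : Space d) :
    |beta1 Δx i x - beta1 Δx i y| ≤ d * (‖x - y‖ / Δx) := by
  have hhat : ∀ ξ, |hat ξ| ≤ 1 := fun ξ => by
    rw [abs_of_nonneg (hat_nonneg ξ)]; exact hat_le_one ξ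
  refine (abs_prod_sub_prod_le _ _ _ (fun l => hhat _) fun l => hhat _).trans ?_
  have : ∀ l ∈ Finset.univ, |hat (x l / Δx - i l) - hat (y l / Δx - i l)| ≤ ‖x - y‖ / Δx := by
    intro l _
    refine (abs_hat_sub_hat_le _ _).trans ?_
    rw [sub_sub_sub_cancel_right, ← sub_div, abs_div, abs_of_pos hΔx]
    exact div_le_div_of_nonneg_right (abs_coord_le_norm (x - y) l) hΔx.le
  exact (Finset.sum_le_sum this).trans (by simp)

/-- `φ` is Lipschitz continuous on the grid, with constant `Λ`. -/
def GridLipschitz (Δx Λ : ℝ) (φ : (Fin d → ℤ) → ℝ) : Prop :=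
  ∀ i j, |φ i - φ j| ≤ Λ * ‖gridPt Δx i - gridPt Δx j‖

/-- The index of the lower corner of the grid cube that contains `x`. -/
noncomputable def corner (Δx : ℝ) (x : Space d) : Fin d → ℤ := fun l => ⌊x l / Δx⌋

theorem corner_mem_vertices (Δx : ℝ) (x : Space d) : corner Δx x ∈ vertices Δx x := by
  simp [corner, vertices]

/-- A constant for the Lipschitz continuity of interpolates. -/
noncomputable def interpConst (d : ℕ) : ℝ := 4 ^ d * (d * (d * 2)) + (1 + 6 * d)

theorem interpConst_nonneg (d : ℕ) : 0 ≤ interpConst d := by unfold interpConst; positivity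

/-- Since the weights sum to 1, the value at one corner may be subtracted from φ. The weights are
d/Δx-Lipschitz and φ oscillates by O(Δx) over the vertices involved, so Δx cancels. -/
theorem GridLipschitz.abs_interp1_sub_le_of_near {Δx Λ : ℝ} (hΔx : 0 < Δx) (hΛ : 0 ≤ Λ)
    {φ : (Fin d → ℤ) → ℝ} (hφ : GridLipschitz Δx Λ φ) {x y : Space d} (hxy : ‖x - y‖ ≤ Δx) :
    |interp1 Δx φ x - interp1 Δx φ y| ≤ 4 ^ d * (d * (d * 2)) * Λ * ‖x - y‖ := by
  -- The coordinate floors for x and y differ by at most 1, so this box of 4^d indices contains the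
  -- vertices around both points.
  let S : Finset (Fin d → ℤ) :=
    Fintype.piFinset fun l => Finset.Icc (⌊x l / Δx⌋ - 1) (⌊x l / Δx⌋ + 2)
  have hSx : vertices Δx x ⊆ S := Fintype.piFinset_subset _ _ fun l =>
    Finset.Icc_subset_Icc (by omega) (by omega)
  have hfl : ∀ l, |x l / Δx - y l / Δx| ≤ 1 := fun l => by
    rw [← sub_div, abs_div, abs_of_pos hΔx, div_le_one hΔx]
    exact (abs_coord_le_norm (x - y) l).trans hxy
  have hSy : vertices Δx y ⊆ S := Fintype.piFinset_subset _ _ fun l => by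
    have h := abs_le.1 (hfl l)
    have h1 : ⌊y l / Δx⌋ ≤ ⌊x l / Δx⌋ + 1 := by
      rw [← Int.floor_add_one]; exact Int.floor_le_floor (by linarith)
    have h2 : ⌊x l / Δx⌋ ≤ ⌊y l / Δx⌋ + 1 := by
      rw [← Int.floor_add_one]; exact Int.floor_le_floor (by linarith)
    exact Finset.Icc_subset_Icc (by omega) (by omega)
  have hcard : (S.card : ℝ) = 4 ^ d := by
    have : S.card = 4 ^ d := by
      simp only [S, Fintype.card_piFinset, Int.card_Icc]
      rw [Finset.prod_congr rfl fun l _ =>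
        show (⌊x l / Δx⌋ + 2 + 1 - (⌊x l / Δx⌋ - 1)).toNat = 4 by omega]
      simp
    exact_mod_cast this
  have hsum : interp1 Δx φ x - interp1 Δx φ y =
      ∑ i ∈ S, (beta1 Δx i x - beta1 Δx i y) * (φ i - φ (corner Δx x)) := by
    simp only [mul_sub, sub_mul, Finset.sum_sub_distrib, ← Finset.sum_mul]
    rw [sum_beta1_of_subset hSx, sum_beta1_of_subset hSy, interp1_eq_sum hSx, interp1_eq_sum hSy]
    ring
  rw [hsum]
  refine (Finset.abs_sum_le_sum_abs _ _).trans ?_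
  have hterm : ∀ i ∈ S, |(beta1 Δx i x - beta1 Δx i y) * (φ i - φ (corner Δx x))| ≤
      d * (‖x - y‖ / Δx) * (Λ * (d * (2 * Δx))) := by
    intro i hi
    rw [abs_mul]
    refine mul_le_mul (abs_beta1_sub_le hΔx i x y) ((hφ _ _).trans ?_) (abs_nonneg _)
      (by positivity)
    refine mul_le_mul_of_nonneg_left (norm_le_of_abs_coord_le fun l => ?_) hΛ
    have h := Finset.mem_Icc.1 (Fintype.mem_piFinset.1 hi l)
    have h1 : ((⌊x l / Δx⌋ : ℤ) : ℝ) - 1 ≤ i l := by exact_mod_cast h.1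
    have h2 : (i l : ℝ) ≤ ⌊x l / Δx⌋ + 2 := by exact_mod_cast h.2
    have h3 : (gridPt Δx i - gridPt Δx (corner Δx x)) l = (i l - ⌊x l / Δx⌋) * Δx := by
      simp [gridPt, corner, sub_mul]
    rw [h3, abs_mul, abs_of_pos hΔx]
    exact mul_le_mul_of_nonneg_right (abs_le.2 ⟨by linarith, by linarith⟩) hΔx.le
  refine (Finset.sum_le_sum hterm).trans (le_of_eq ?_)
  rw [Finset.sum_const, nsmul_eq_mul, hcard]
  field_simp

/-- Passing to corner values costs O(Δx) at each point, and Δx ≤ |x - y| absorbs it. The 6d is 2d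
for each interpolate and 2d for the distance between the corners. -/
theorem GridLipschitz.abs_interp1_sub_le_of_far {Δx Λ : ℝ} (hΔx : 0 < Δx) (hΛ : 0 ≤ Λ)
    {φ : (Fin d → ℤ) → ℝ} (hφ : GridLipschitz Δx Λ φ) {x y : Space d} (hxy : Δx ≤ ‖x - y‖) :
    |interp1 Δx φ x - interp1 Δx φ y| ≤ (1 + 6 * d) * Λ * ‖x - y‖ := by
  have hc : ∀ z : Space d, ∀ i ∈ vertices Δx z, ‖z - gridPt Δx i‖ ≤ d * Δx := fun z i hi =>
    norm_le_of_abs_coord_le fun l => abs_sub_gridPt_le hΔx hi l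
  have key : ∀ z : Space d, |interp1 Δx φ z - φ (corner Δx z)| ≤ Λ * (2 * (d * Δx)) := by
    intro z
    have h := abs_interp1_sub_le (Δx := Δx) (x := z) (φ := φ) (ψ := fun _ => φ (corner Δx z))
      (M := Λ * (2 * (d * Δx))) fun i hi => (hφ _ _).trans (mul_le_mul_of_nonneg_left ?_ hΛ)
    · rwa [interp1_const] at h
    · have h1 := norm_sub_le_norm_sub_add_norm_sub (gridPt Δx i) z (gridPt Δx (corner Δx z))
      have h2 := hc z i hi
      rw [norm_sub_rev] at h2
      linarith [hc z _ (corner_mem_vertices Δx z)]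
  have hxy' : |φ (corner Δx x) - φ (corner Δx y)| ≤ Λ * (‖x - y‖ + 2 * (d * Δx)) := by
    refine (hφ _ _).trans (mul_le_mul_of_nonneg_left ?_ hΛ)
    have h1 := norm_sub_le_norm_sub_add_norm_sub (gridPt Δx (corner Δx x)) x
      (gridPt Δx (corner Δx y))
    have h2 := norm_sub_le_norm_sub_add_norm_sub x y (gridPt Δx (corner Δx y))
    have h3 := hc x _ (corner_mem_vertices Δx x)
    rw [norm_sub_rev] at h3
    linarith [hc y _ (corner_mem_vertices Δx y)]
  have h1 := abs_le.1 (key x)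
  have h2 := abs_le.1 (key y)
  have h3 := abs_le.1 hxy'
  have h4 : Λ * (d * Δx) ≤ Λ * (d * ‖x - y‖) := by gcongr
  rw [abs_le]
  constructor <;> linarith

theorem GridLipschitz.abs_interp1_sub_le {Δx Λ : ℝ} (hΔx : 0 < Δx) (hΛ : 0 ≤ Λ)
    {φ : (Fin d → ℤ) → ℝ} (hφ : GridLipschitz Δx Λ φ) (x y : Space d) :
    |interp1 Δx φ x - interp1 Δx φ y| ≤ interpConst d * Λ * ‖x - y‖ := by
  have h0 : 0 ≤ Λ * ‖x - y‖ := by positivity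
  have h1 : 0 ≤ 4 ^ d * ((d : ℝ) * (d * 2)) * (Λ * ‖x - y‖) := by positivity
  have h2 : 0 ≤ (1 + 6 * (d : ℝ)) * (Λ * ‖x - y‖) := by positivity
  unfold interpConst
  rcases le_total ‖x - y‖ Δx with h | h
  · linarith [hφ.abs_interp1_sub_le_of_near hΔx hΛ h]
  · linarith [hφ.abs_interp1_sub_le_of_far hΔx hΛ h]

end MFG

namespace MFG

variable {d : ℕ}

/-! ### The semi-Lagrangian scheme -/

theorem ciInf_le_ciInf_add {ι : Type*} [Nonempty ι] {f g : ι → ℝ} {c : ℝ}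
    (hf : BddBelow (Set.range f)) (h : ∀ a, f a ≤ g a + c) : ⨅ a, f a ≤ (⨅ a, g a) + c := by
  have : (⨅ a, f a) - c ≤ ⨅ a, g a := le_ciInf fun a => by linarith [ciInf_le hf a, h a]
  linarith

/-- Quantitative bounds extracted from (H1) and (H2), for controls bounded by `Cb`. -/
structure SchemeBounds (T : ℝ) (L : Space d → Space d → ℝ) (F G : Space d → Measure (Space d) → ℝ)
    (Cb A K₁ K₂ : ℝ) : Prop where
  T_pos : 0 < T
  Cb_pos : 0 < Cb
  K₁_nonneg : 0 ≤ K₁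
  K₂_nonneg : 0 ≤ K₂
  A_nonneg : 0 ≤ A
  L_abs_le : ∀ x a, ‖a‖ ≤ Cb → |L x a| ≤ A
  L_lip : ∀ x y a, ‖a‖ ≤ Cb → |L x a - L y a| ≤ K₁ * ‖x - y‖
  F_abs_le : ∀ x ν, IsP1 ν → |F x ν| ≤ A
  F_lip : ∀ x y ν, IsP1 ν → |F x ν - F y ν| ≤ K₂ * ‖x - y‖
  G_abs_le : ∀ x ν, IsP1 ν → |G x ν| ≤ A
  G_lip : ∀ x y ν, IsP1 ν → |G x ν - G y ν| ≤ K₂ * ‖x - y‖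

/-- On |a| ≤ Cb the quadratic bounds on L and D_xL become constants; every later estimate depends on
the data through these, independently of the grid. -/
theorem exists_schemeBounds {T : ℝ} (hT : 0 < T) {L : Space d → Space d → ℝ}
    {F G : Space d → Measure (Space d) → ℝ} (hL : HypH1 L) (hFG : HypH2 F G) {Cb : ℝ}
    (hCb : 0 < Cb) : ∃ A K₁ K₂, SchemeBounds T L F G Cb A K₁ K₂ := by
  obtain ⟨⟨-, F₁, F₂, F₃, hF₁, hF₂, -, hF⟩, ⟨-, G₁, G₂, G₃, hG₁, hG₂, -, hG⟩⟩ := hFG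
  obtain ⟨hLc, ⟨B, hB⟩, C₁, C₂, C₃, C₄, C₅, hC₁, hC₂, hC₃, hC₄, -, h⟩ := hL
  refine ⟨max (max |B| (C₁ * Cb ^ 2 + C₂)) (max F₁ G₁), C₃ * (1 + Cb ^ 2), max F₂ G₂,
    hT, hCb, by positivity, by positivity, by positivity, fun x a ha => ?_, fun x y a ha => ?_,
    fun x ν hν => ?_, fun x y ν hν => ?_, fun x ν hν => ?_, fun x y ν hν => ?_⟩
  · have h1 := (h x a).1
    have h2 : C₁ * ‖a‖ ^ 2 ≤ C₁ * Cb ^ 2 := by gcongr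
    refine le_trans ?_ (le_max_left _ _)
    refine abs_le.2 ⟨?_, (h1.trans (by linarith)).trans (le_max_right _ _)⟩
    linarith [hB x a, neg_abs_le B, le_max_left |B| (C₁ * Cb ^ 2 + C₂)]
  · have hd : Differentiable ℝ fun y => L y a := by
      have : ContDiff ℝ 2 fun y => L y a := hLc.comp (contDiff_prodMk_left a)
      exact this.differentiable (by norm_num)
    have hb : ∀ z ∈ (Set.univ : Set (Space d)), ‖fderiv ℝ (fun y => L y a) z‖ ≤
        C₃ * (1 + Cb ^ 2) := fun z _ => by
      have h1 := (h z a).2.1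
      rw [gradient, LinearIsometryEquiv.norm_map] at h1
      exact h1.trans (by gcongr)
    exact convex_univ.norm_image_sub_le_of_norm_fderiv_le (fun z _ => hd z) hb
      (Set.mem_univ y) (Set.mem_univ x)
  · exact (hF x x ν hν).1.trans ((le_max_left _ _).trans (le_max_right _ _))
  · exact (hF x y ν hν).2.1.trans (by gcongr; exact le_max_left _ _)
  · exact (hG x x ν hν).1.trans ((le_max_right _ _).trans (le_max_right _ _))
  · exact (hG x y ν hν).2.1.trans (by gcongr; exact le_max_right _ _)

theorem timePt_mem_Icc {T : ℝ} (hT : 0 ≤ T) {N k : ℕ} (hk : k ≤ N) :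
    timePt T N k ∈ Set.Icc 0 T := by
  unfold timePt
  refine ⟨by positivity, ?_⟩
  rcases Nat.eq_zero_or_pos N with rfl | hN
  · simpa using hT
  have hN' : (0 : ℝ) < N := by exact_mod_cast hN
  rw [mul_div_left_comm]
  refine mul_le_of_le_one_right hT ((div_le_one hN').2 (by exact_mod_cast hk))

variable {T : ℝ} {L : Space d → Space d → ℝ} {F G : Space d → Measure (Space d) → ℝ}
  {Cb A K₁ K₂ : ℝ}

/-- The function minimized in the semi-Lagrangian scheme. -/
noncomputable def slCost (T : ℝ) (L : Space d → Space d → ℝ) (Cb : ℝ) (N : ℕ) (Δx : ℝ)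
    (φ : (Fin d → ℤ) → ℝ) (i : Fin d → ℤ) (a : Metric.closedBall (0 : Space d) Cb) : ℝ :=
  T / N * L (gridPt Δx i) a + interp1 Δx φ (gridPt Δx i - (T / N) • (a : Space d))

theorem SchemeBounds.abs_slCost_le (h : SchemeBounds T L F G Cb A K₁ K₂) {N : ℕ} {Δx : ℝ}
    {φ : (Fin d → ℤ) → ℝ} {M : ℝ} (hφ : ∀ i, |φ i| ≤ M) (i : Fin d → ℤ)
    (a : Metric.closedBall (0 : Space d) Cb) : |slCost T L Cb N Δx φ i a| ≤ T / N * A + M := by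
  have hT := h.T_pos
  refine (abs_add_le _ _).trans (add_le_add ?_ (abs_interp1_le hφ))
  rw [abs_mul, abs_of_nonneg (by positivity)]
  exact mul_le_mul_of_nonneg_left (h.L_abs_le _ _ (mem_closedBall_zero_iff.1 a.2)) (by positivity)

theorem SchemeBounds.bddBelow_slCost (h : SchemeBounds T L F G Cb A K₁ K₂) {N : ℕ} {Δx : ℝ}
    {φ : (Fin d → ℤ) → ℝ} {M : ℝ} (hφ : ∀ i, |φ i| ≤ M) (i : Fin d → ℤ) :
    BddBelow (Set.range (slCost T L Cb N Δx φ i)) :=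
  ⟨-(T / N * A + M), Set.forall_mem_range.2 fun a => (abs_le.1 (h.abs_slCost_le hφ i a)).1⟩

theorem SchemeBounds.nonempty_closedBall (h : SchemeBounds T L F G Cb A K₁ K₂) :
    Nonempty (Metric.closedBall (0 : Space d) Cb) :=
  ⟨⟨0, by simpa using h.Cb_pos.le⟩⟩

theorem SchemeBounds.abs_slBackward_le (h : SchemeBounds T L F G Cb A K₁ K₂) {N : ℕ} {Δx : ℝ}
    {μ : ℝ → Measure (Space d)} (hμ : ∀ t ∈ Set.Icc 0 T, IsP1 (μ t)) (n : ℕ) (i : Fin d → ℤ) :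
    |slBackward T L F G Cb N Δx μ n i| ≤ A + n * (T / N * (2 * A)) := by
  have hT := h.T_pos
  have hne := h.nonempty_closedBall
  induction n generalizing i with
  | zero => simpa [slBackward] using h.G_abs_le _ _ (hμ T ⟨h.T_pos.le, le_rfl⟩)
  | succ n ih =>
    have hF := h.F_abs_le (gridPt Δx i) _ (hμ _ (timePt_mem_Icc h.T_pos.le (Nat.sub_le N (n + 1))))
    have hF' : |T / N * F (gridPt Δx i) (μ (timePt T N (N - (n + 1))))| ≤ T / N * A := by
      rw [abs_mul, abs_of_nonneg (by positivity)]
      exact mul_le_mul_of_nonneg_left hF (by positivity)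
    have hI : |⨅ a, slCost T L Cb N Δx (slBackward T L F G Cb N Δx μ n) i a| ≤
        T / N * A + (A + n * (T / N * (2 * A))) := by
      refine abs_le.2 ⟨le_ciInf fun a => (abs_le.1 (h.abs_slCost_le ih i a)).1, ?_⟩
      exact (ciInf_le (h.bddBelow_slCost ih i) hne.some).trans
        (abs_le.1 (h.abs_slCost_le ih i _)).2
    refine (abs_add_le _ _).trans ((add_le_add hI hF').trans (le_of_eq ?_))
    push_cast
    ring

/-- With the same control at both grid points, the two feet differ by a grid vector, so translation
invariance transfers the constant unchanged; only Δt(K₁ + K₂), from L and F, is added per step. The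
constants thus stay bounded over the N steps. -/
theorem SchemeBounds.gridLipschitz_slBackward (h : SchemeBounds T L F G Cb A K₁ K₂) {N : ℕ}
    {Δx : ℝ} (hΔx : 0 < Δx) {μ : ℝ → Measure (Space d)} (hμ : ∀ t ∈ Set.Icc 0 T, IsP1 (μ t))
    (n : ℕ) :
    GridLipschitz Δx (K₂ + n * (T / N * (K₁ + K₂))) (slBackward T L F G Cb N Δx μ n) := by
  have hT := h.T_pos
  have hne := h.nonempty_closedBall
  induction n with
  | zero => 
    intro i j
    simpa [slBackward] using h.G_lip _ _ _ (hμ T ⟨h.T_pos.le, le_rfl⟩)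
  | succ n ih =>
    set Λ := K₂ + n * (T / N * (K₁ + K₂))
    set φ := slBackward T L F G Cb N Δx μ n
    have hφ := h.abs_slBackward_le (N := N) (Δx := Δx) hμ n
    have key : ∀ i j, slBackward T L F G Cb N Δx μ (n + 1) i ≤
        slBackward T L F G Cb N Δx μ (n + 1) j +
          (K₂ + (n + 1 : ℕ) * (T / N * (K₁ + K₂))) * ‖gridPt Δx i - gridPt Δx j‖ := by
      intro i j
      have hF := (abs_le.1 (h.F_lip (gridPt Δx i) (gridPt Δx j) _
        (hμ _ (timePt_mem_Icc h.T_pos.le (Nat.sub_le N (n + 1)))))).2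
      have hF' := mul_le_mul_of_nonneg_left hF (show 0 ≤ T / N by positivity)
      have hI : ⨅ a, slCost T L Cb N Δx φ i a ≤ (⨅ a, slCost T L Cb N Δx φ j a) +
          (T / N * K₁ + Λ) * ‖gridPt Δx i - gridPt Δx j‖ := by
        refine ciInf_le_ciInf_add (h.bddBelow_slCost hφ i) fun a => ?_
        have hLl := (abs_le.1 (h.L_lip (gridPt Δx i) (gridPt Δx j) a (mem_closedBall_zero_iff.1 a.2))).2
        have hL' := mul_le_mul_of_nonneg_left hLl (show 0 ≤ T / N by positivity)
        have hgrid : gridPt Δx i = gridPt Δx j + gridPt Δx (i - j) := by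
          rw [← gridPt_add, add_sub_cancel]
        have hpt : gridPt Δx i - (T / N) • (a : Space d) =
            gridPt Δx j - (T / N) • (a : Space d) + gridPt Δx (i - j) := by
          rw [hgrid]; abel
        have hint : interp1 Δx φ (gridPt Δx i - (T / N) • (a : Space d)) ≤
            interp1 Δx φ (gridPt Δx j - (T / N) • (a : Space d)) +
              Λ * ‖gridPt Δx i - gridPt Δx j‖ := by
          rw [hpt, interp1_add_gridPt hΔx.ne']
          refine interp1_le_interp1_add fun m _ => ?_
          have := (abs_le.1 (ih (m + (i - j)) m)).2
          rw [gridPt_add, add_sub_cancel_left] at this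
          rw [hgrid, add_sub_cancel_left]
          linarith
        unfold slCost
        linarith
      change (⨅ a, slCost T L Cb N Δx φ i a) + _ ≤ (⨅ a, slCost T L Cb N Δx φ j a) + _ + _
      simp only [Λ] at hI
      push_cast
      linarith
    intro i j
    rw [abs_le]
    have h2 := key j i
    rw [norm_sub_rev] at h2
    constructor <;> linarith [key i j]

/-- The infimum runs over infinitely many controls, but all the feet lie in a bounded set, so only
finitely many grid values enter and pointwise convergence is uniform in the control. -/
theorem SchemeBounds.tendsto_slBackward (h : SchemeBounds T L F G Cb A K₁ K₂) {N : ℕ} {Δx : ℝ}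
    (hΔx : 0 < Δx) {ι : Type*} {l : Filter ι} {u : ι → ℝ → Measure (Space d)}
    {μ : ℝ → Measure (Space d)} (hu : ∀ a, ∀ t ∈ Set.Icc 0 T, IsP1 (u a t))
    (hμ : ∀ t ∈ Set.Icc 0 T, IsP1 (μ t))
    (hF : ∀ x, ∀ t ∈ Set.Icc 0 T, Filter.Tendsto (fun a => F x (u a t)) l (nhds (F x (μ t))))
    (hG : ∀ x, ∀ t ∈ Set.Icc 0 T, Filter.Tendsto (fun a => G x (u a t)) l (nhds (G x (μ t))))
    (n : ℕ) (i : Fin d → ℤ) :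
    Filter.Tendsto (fun a => slBackward T L F G Cb N Δx (u a) n i) l
      (nhds (slBackward T L F G Cb N Δx μ n i)) := by
  have hne := h.nonempty_closedBall
  have hT := h.T_pos
  induction n generalizing i with
  | zero => exact hG _ T ⟨h.T_pos.le, le_rfl⟩
  | succ n ih =>
    refine Filter.Tendsto.add ?_ ((hF _ _
      (timePt_mem_Icc h.T_pos.le (Nat.sub_le N (n + 1)))).const_mul _)
    change Filter.Tendsto (fun b => ⨅ a, slCost T L Cb N Δx (slBackward T L F G Cb N Δx (u b) n) i a)
      l (nhds (⨅ a, slCost T L Cb N Δx (slBackward T L F G Cb N Δx μ n) i a))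
    -- A foot is within Δt Cb of x_i, and a vertex is within Δx of the foot in each coordinate.
    let S := indexSet d Δx (‖gridPt Δx i‖ + T / N * Cb + Δx)
    have hS : ∀ a : Metric.closedBall (0 : Space d) Cb,
        vertices Δx (gridPt Δx i - (T / N) • (a : Space d)) ⊆ S := by
      intro a j hj
      rw [mem_indexSet hΔx]
      intro l
      have h1 := abs_sub_gridPt_le hΔx hj l
      have h2 := abs_coord_le_norm (gridPt Δx i - (T / N) • (a : Space d)) l
      have h3 := norm_sub_le (gridPt Δx i) ((T / N) • (a : Space d))
      rw [norm_smul, Real.norm_of_nonneg (show 0 ≤ T / N by positivity)] at h3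
      have h4 : T / N * ‖(a : Space d)‖ ≤ T / N * Cb :=
        mul_le_mul_of_nonneg_left (mem_closedBall_zero_iff.1 a.2) (by positivity)
      have h5 := abs_sub_abs_le_abs_sub (gridPt Δx j l)
        ((gridPt Δx i - (T / N) • (a : Space d)) l)
      rw [abs_sub_comm] at h5
      linarith
    rw [Metric.tendsto_nhds]
    intro e he
    have hev : ∀ᶠ b in l, ∀ j ∈ S, |slBackward T L F G Cb N Δx (u b) n j -
        slBackward T L F G Cb N Δx μ n j| ≤ e / 2 := by
      rw [Filter.eventually_all_finset]
      intro j _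
      filter_upwards [Metric.tendsto_nhds.1 (ih j) (e / 2) (half_pos he)] with b hb
      exact (le_of_lt hb)
    filter_upwards [hev] with b hb
    have hint : ∀ a : Metric.closedBall (0 : Space d) Cb, _ := fun a =>
      abs_le.1 (abs_interp1_sub_le fun j hj => hb j (hS a hj))
    have h1 : ⨅ a, slCost T L Cb N Δx (slBackward T L F G Cb N Δx (u b) n) i a ≤
        (⨅ a, slCost T L Cb N Δx (slBackward T L F G Cb N Δx μ n) i a) + e / 2 :=
      ciInf_le_ciInf_add (h.bddBelow_slCost (h.abs_slBackward_le (hu b) n) i) fun a => by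
        unfold slCost; linarith [(hint a).2]
    have h2 : ⨅ a, slCost T L Cb N Δx (slBackward T L F G Cb N Δx μ n) i a ≤
        (⨅ a, slCost T L Cb N Δx (slBackward T L F G Cb N Δx (u b) n) i a) + e / 2 :=
      ciInf_le_ciInf_add (h.bddBelow_slCost (h.abs_slBackward_le hμ n) i) fun a => by
        unfold slCost; linarith [(hint a).1]
    rw [Real.dist_eq, abs_lt]
    constructor <;> linarith

/-- A uniform bound for the Lipschitz constants of the interpolates of the `v_k`. -/
noncomputable def valueLip (d : ℕ) (T K₁ K₂ : ℝ) : ℝ := interpConst d * (K₂ + T * (K₁ + K₂))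

theorem SchemeBounds.valueLip_nonneg (h : SchemeBounds T L F G Cb A K₁ K₂) :
    0 ≤ valueLip d T K₁ K₂ :=
  mul_nonneg (interpConst_nonneg d) (add_nonneg h.K₂_nonneg
    (mul_nonneg h.T_pos.le (add_nonneg h.K₁_nonneg h.K₂_nonneg)))

theorem SchemeBounds.lipschitzWith_interp1_slValue (h : SchemeBounds T L F G Cb A K₁ K₂) {N : ℕ}
    {Δx : ℝ} (hΔx : 0 < Δx) {μ : ℝ → Measure (Space d)} (hμ : ∀ t ∈ Set.Icc 0 T, IsP1 (μ t))
    (k : ℕ) : LipschitzWith (Real.toNNReal (valueLip d T K₁ K₂))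
      (interp1 Δx (slValue T L F G Cb N Δx μ k)) := by
  have hT := h.T_pos
  have hK : 0 ≤ K₁ + K₂ := add_nonneg h.K₁_nonneg h.K₂_nonneg
  have hΛ : K₂ + (N - k : ℕ) * (T / N * (K₁ + K₂)) ≤ K₂ + T * (K₁ + K₂) := by
    rw [← mul_assoc]
    gcongr
    exact (timePt_mem_Icc hT.le (Nat.sub_le N k)).2
  have hφ := h.gridLipschitz_slBackward (N := N) hΔx hμ (N - k)
  refine LipschitzWith.of_dist_le' fun x y => ?_
  rw [Real.dist_eq, dist_eq_norm]
  refine (GridLipschitz.abs_interp1_sub_le hΔx ?_ (fun i j => (hφ i j).trans ?_) x y)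
  · exact add_nonneg h.K₂_nonneg (mul_nonneg hT.le hK)
  · gcongr

theorem SchemeBounds.abs_interp1_slValue_le (h : SchemeBounds T L F G Cb A K₁ K₂) {N : ℕ}
    {Δx : ℝ} {μ : ℝ → Measure (Space d)} (hμ : ∀ t ∈ Set.Icc 0 T, IsP1 (μ t)) (k : ℕ)
    (x : Space d) : |interp1 Δx (slValue T L F G Cb N Δx μ k) x| ≤
      A + (N - k : ℕ) * (T / N * (2 * A)) :=
  abs_interp1_le fun i => h.abs_slBackward_le hμ (N - k) i

theorem tendsto_interp1 {ι : Type*} {l : Filter ι} {Δx : ℝ} {φ : ι → (Fin d → ℤ) → ℝ}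
    {ψ : (Fin d → ℤ) → ℝ} (h : ∀ i, Filter.Tendsto (fun a => φ a i) l (nhds (ψ i)))
    (x : Space d) : Filter.Tendsto (fun a => interp1 Δx (φ a) x) l (nhds (interp1 Δx ψ x)) := by
  simp_rw [interp1_eq_sum (Finset.Subset.refl (vertices Δx x))]
  exact tendsto_finsetSum _ fun i _ => (h i).const_mul _

end MFG

namespace MFG

/-! ### Convolution of a kernel and a bounded Lipschitz function -/

theorem integrable_mul_translate {E : Type*} [NormedAddCommGroup E] [MeasurableSpace E]
    [BorelSpace E] [SecondCountableTopology E] {μ : Measure E} {f w : E → ℝ} {M : ℝ}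
    (hf : Integrable f μ) (hw : Continuous w)
    (hM : ∀ x, |w x| ≤ M) (x : E) : Integrable (fun t => f t * w (x - t)) μ :=
  hf.mul_bdd (c := M) (by fun_prop : Continuous fun t => w (x - t)).aestronglyMeasurable
    (Filter.Eventually.of_forall fun t => hM _)

section Kernel

variable {E : Type*} [NormedAddCommGroup E] [NormedSpace ℝ E] [FiniteDimensional ℝ E]
  [MeasurableSpace E] [BorelSpace E] {μ : Measure E}

variable {f w : E → ℝ} {K : NNReal} {M C : ℝ}

theorem lipschitzWith_integral_mul_translate (hf : Integrable f μ) (hf0 : ∀ x, 0 ≤ f x)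
    (hf1 : ∫ x, f x ∂μ = 1) (hw : LipschitzWith K w) (hM : ∀ x, |w x| ≤ M) :
    LipschitzWith K fun x => ∫ t, f t * w (x - t) ∂μ := by
  refine LipschitzWith.of_dist_le_mul fun x y => ?_
  rw [Real.dist_eq, ← integral_sub (integrable_mul_translate hf hw.continuous hM x)
    (integrable_mul_translate hf hw.continuous hM y), ← Real.norm_eq_abs]
  have : ∀ t, ‖f t * w (x - t) - f t * w (y - t)‖ ≤ f t * (K * dist x y) := by
    intro t
    rw [← mul_sub, norm_mul, Real.norm_of_nonneg (hf0 t)]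
    refine mul_le_mul_of_nonneg_left ?_ (hf0 t)
    have := hw.dist_le_mul (x - t) (y - t)
    rwa [dist_sub_right, dist_eq_norm (w _)] at this
  refine (norm_integral_le_of_norm_le (hf.mul_const _) (Filter.Eventually.of_forall this)).trans ?_
  rw [integral_mul_const, hf1, one_mul]

theorem tendsto_integral_mul_translate {ι : Type*} {l : Filter ι} [l.IsCountablyGenerated]
    {W : ι → E → ℝ} (hf : Integrable f μ) (hW : ∀ a, Continuous (W a))
    (hM : ∀ a x, |W a x| ≤ M) (hlim : ∀ x, Filter.Tendsto (fun a => W a x) l (nhds (w x)))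
    (x : E) : Filter.Tendsto (fun a => ∫ t, f t * W a (x - t) ∂μ) l
      (nhds (∫ t, f t * w (x - t) ∂μ)) := by
  refine tendsto_integral_filter_of_dominated_convergence (fun t => ‖f t‖ * M)
    (Filter.Eventually.of_forall fun a =>
      (integrable_mul_translate hf (hW a) (hM a) x).aestronglyMeasurable)
    (Filter.Eventually.of_forall fun a => Filter.Eventually.of_forall fun t => ?_)
    (hf.norm.mul_const _) (Filter.Eventually.of_forall fun t => (hlim (x - t)).const_mul _)
  rw [norm_mul]
  exact mul_le_mul_of_nonneg_left (hM a _) (norm_nonneg _)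

variable [μ.IsAddHaarMeasure]

/-- Integrate the derivative along the segment from x to x + h, then use Tonelli and translation
invariance. -/
theorem integral_abs_translate_sub_le (hf : ContDiff ℝ 1 f)
    (hi : Integrable (fderiv ℝ f) μ) (h : E) :
    ∫ x, |f (x + h) - f x| ∂μ ≤ (∫ x, ‖fderiv ℝ f x‖ ∂μ) * ‖h‖ := by
  have hfc : Continuous (fderiv ℝ f) := hf.continuous_fderiv (by norm_num)
  have hpt : ∀ x, ‖f (x + h) - f x‖ₑ ≤
      ∫⁻ t in Set.Ioc (0 : ℝ) 1, ‖fderiv ℝ f (x + t • h)‖ₑ * ‖h‖ₑ := by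
    intro x
    have hder : ∀ t : ℝ, HasDerivAt (fun t : ℝ => f (x + t • h)) (fderiv ℝ f (x + t • h) h) t := by
      intro t
      have h1 : HasDerivAt (fun t : ℝ => x + t • h) h t := by
        simpa using ((hasDerivAt_id t).smul_const h).const_add x
      exact (hf.differentiable (by norm_num) (x + t • h)).hasFDerivAt.comp_hasDerivAt t h1
    have hcont : Continuous fun t : ℝ => fderiv ℝ f (x + t • h) h := by fun_prop
    have hftc := intervalIntegral.integral_eq_sub_of_hasDerivAt (a := 0) (b := 1)
      (fun t _ => hder t) (hcont.intervalIntegrable 0 1)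
    rw [one_smul, zero_smul, add_zero] at hftc
    rw [← hftc, intervalIntegral.integral_of_le zero_le_one]
    refine (enorm_integral_le_lintegral_enorm _).trans (lintegral_mono fun t => ?_)
    exact ContinuousLinearMap.le_opENorm _ _
  have hmeas : Measurable fun p : E × ℝ => ‖fderiv ℝ f (p.1 + p.2 • h)‖ₑ * ‖h‖ₑ := by
    have : Continuous fun p : E × ℝ => fderiv ℝ f (p.1 + p.2 • h) := by fun_prop
    exact this.measurable.enorm.mul_const _
  have hlin : ∫⁻ x, ‖f (x + h) - f x‖ₑ ∂μ ≤ (∫⁻ x, ‖fderiv ℝ f x‖ₑ ∂μ) * ‖h‖ₑ := by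
    refine (lintegral_mono hpt).trans ?_
    rw [lintegral_lintegral_swap hmeas.aemeasurable]
    have : ∀ t : ℝ, ∫⁻ x, ‖fderiv ℝ f (x + t • h)‖ₑ * ‖h‖ₑ ∂μ =
        (∫⁻ x, ‖fderiv ℝ f x‖ₑ ∂μ) * ‖h‖ₑ := by
      intro t
      rw [lintegral_mul_const _ (by fun_prop),
        lintegral_add_right_eq_self (μ := μ) (fun x => ‖fderiv ℝ f x‖ₑ) (t • h)]
    simp only [this]
    simp
  have hfin : (∫⁻ x, ‖fderiv ℝ f x‖ₑ ∂μ) * ‖h‖ₑ ≠ ⊤ :=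
    ENNReal.mul_ne_top hi.2.ne (by simp)
  have hc : Continuous f := hf.continuous
  have hae : AEStronglyMeasurable (fun x => f (x + h) - f x) μ :=
    (by fun_prop : Continuous fun x => f (x + h) - f x).aestronglyMeasurable
  simp only [← Real.norm_eq_abs]
  rw [integral_norm_eq_lintegral_enorm hae, integral_norm_eq_lintegral_enorm hi.1]
  calc _ ≤ ((∫⁻ x, ‖fderiv ℝ f x‖ₑ ∂μ) * ‖h‖ₑ).toReal := ENNReal.toReal_mono hfin hlin
    _ = _ := by rw [ENNReal.toReal_mul, toReal_enorm]

/-- Differentiation falls on w, which is differentiable almost everywhere by Rademacher's theorem; t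
↦ x - t preserves null sets, and the Lipschitz constant supplies the dominating function. -/
theorem hasFDerivAt_integral_mul_translate (hf : Integrable f μ) (hf0 : ∀ x, 0 ≤ f x)
    (hw : LipschitzWith K w) (hM : ∀ x, |w x| ≤ M) (x : E) :
    HasFDerivAt (fun x => ∫ t, f t * w (x - t) ∂μ) (∫ t, f t • fderiv ℝ w (x - t) ∂μ) x := by
  have hdw : ∀ᵐ t ∂μ, DifferentiableAt ℝ w (x - t) :=
    (Measure.measurePreserving_sub_left μ x).quasiMeasurePreserving.ae hw.ae_differentiableAt
  refine (hasFDerivAt_integral_of_dominated_loc_of_lip (bound := fun t => f t * K)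
    (F := fun x t => f t * w (x - t)) Filter.univ_mem
    (Filter.Eventually.of_forall fun y =>
      (integrable_mul_translate hf hw.continuous hM y).aestronglyMeasurable)
    (integrable_mul_translate hf hw.continuous hM x) ?_ ?_ (hf.mul_const _) ?_).2
  · refine hf.aestronglyMeasurable.smul ?_
    exact ((measurable_fderiv ℝ w).comp (measurable_const.sub measurable_id)).aestronglyMeasurable
  · refine Filter.Eventually.of_forall fun t => LipschitzOnWith.of_dist_le_mul fun y _ z _ => ?_
    rw [Real.coe_nnabs, abs_of_nonneg (mul_nonneg (hf0 t) K.coe_nonneg), Real.dist_eq, ← mul_sub,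
      abs_mul, abs_of_nonneg (hf0 t), mul_assoc]
    refine mul_le_mul_of_nonneg_left ?_ (hf0 t)
    have := hw.dist_le_mul (y - t) (z - t)
    rwa [dist_sub_right, Real.dist_eq] at this
  · filter_upwards [hdw] with t ht
    have h1 : HasFDerivAt (fun y => w (y - t)) (fderiv ℝ w (x - t)) x := by
      have := ht.hasFDerivAt.comp x ((hasFDerivAt_id x).sub_const t)
      rwa [ContinuousLinearMap.comp_id] at this
    exact h1.const_mul (f t)

/-- Substituting s = x - t moves the dependence on x into the kernel: the derivative is the integral
of f(x - s) Dw(s). As |Dw| ≤ K, the L¹ modulus of translation of f controls its variation. -/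
theorem norm_fderiv_integral_mul_translate_sub_le (hf : Integrable f μ)
    (hf0 : ∀ x, 0 ≤ f x) (hC : ∀ h, ∫ x, |f (x + h) - f x| ∂μ ≤ C * ‖h‖)
    (hw : LipschitzWith K w) (hM : ∀ x, |w x| ≤ M) (x y : E) :
    ‖fderiv ℝ (fun x => ∫ t, f t * w (x - t) ∂μ) x -
      fderiv ℝ (fun x => ∫ t, f t * w (x - t) ∂μ) y‖ ≤ K * C * ‖x - y‖ := by
  rw [(hasFDerivAt_integral_mul_translate hf hf0 hw hM x).fderiv,
    (hasFDerivAt_integral_mul_translate hf hf0 hw hM y).fderiv]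
  have hint : ∀ z, Integrable (fun s => f (z - s) • fderiv ℝ w s) μ := by
    intro z
    refine Integrable.smul_bdd (C := (K : ℝ)) (hf.comp_sub_left z)
      (measurable_fderiv ℝ w).aestronglyMeasurable ?_
    exact Filter.Eventually.of_forall fun s => norm_fderiv_le_of_lipschitz ℝ hw
  have hsub : ∀ z, ∫ t, f t • fderiv ℝ w (z - t) ∂μ = ∫ s, f (z - s) • fderiv ℝ w s ∂μ := by
    intro z
    rw [← integral_sub_left_eq_self (fun t => f t • fderiv ℝ w (z - t)) μ z]
    simp
  rw [hsub, hsub, ← integral_sub (hint x) (hint y)]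
  have hb : ∀ s, ‖f (x - s) • fderiv ℝ w s - f (y - s) • fderiv ℝ w s‖ ≤
      |f (y - s + (x - y)) - f (y - s)| * K := by
    intro s
    rw [← sub_smul, norm_smul, Real.norm_eq_abs]
    have : y - s + (x - y) = x - s := by abel
    rw [this]
    exact mul_le_mul_of_nonneg_left (norm_fderiv_le_of_lipschitz ℝ hw) (abs_nonneg _)
  have hi : Integrable (fun s => |f (s + (x - y)) - f s|) μ :=
    ((hf.comp_add_right (x - y)).sub hf).abs
  refine (norm_integral_le_of_norm_le ((hi.comp_sub_left y).mul_const (K : ℝ))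
    (Filter.Eventually.of_forall hb)).trans ?_
  rw [integral_mul_const,
    integral_sub_left_eq_self (fun s => |f (s + (x - y)) - f s|) μ y]
  have := mul_le_mul_of_nonneg_right (hC (x - y)) K.coe_nonneg
  linarith

end Kernel

/-! ### Convergence of derivatives under a uniform Lipschitz bound on them -/

section GradientConvergence

variable {E : Type*} [NormedAddCommGroup E] [NormedSpace ℝ E]

theorem abs_sub_sub_fderiv_le {f : E → ℝ} {Λ : ℝ} (hΛ : 0 ≤ Λ) (hf : Differentiable ℝ f)
    (hl : ∀ x y, ‖fderiv ℝ f x - fderiv ℝ f y‖ ≤ Λ * ‖x - y‖) (x v : E) :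
    |f (x + v) - f x - fderiv ℝ f x v| ≤ Λ * ‖v‖ * ‖v‖ := by
  have := (convex_closedBall x ‖v‖).norm_image_sub_le_of_norm_fderiv_le' (𝕜 := ℝ) (f := f)
    (φ := fderiv ℝ f x) (C := Λ * ‖v‖) (x := x) (y := x + v) (fun z _ => hf z)
    (fun z hz => (hl z x).trans (mul_le_mul_of_nonneg_left
      (by simpa [dist_eq_norm] using hz) hΛ)) (by simp) (by simp)
  simpa using this

/-- A difference quotient with a fixed small step approximates all the derivatives uniformly, and
for a fixed step pointwise convergence of the functions suffices. -/
theorem tendsto_fderiv_apply_of_tendsto {ι : Type*} {l : Filter ι} {g : ι → E → ℝ} {f : E → ℝ}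
    {Λ : ℝ} (hΛ : 0 ≤ Λ) (hg : ∀ a, Differentiable ℝ (g a)) (hf : Differentiable ℝ f)
    (hgl : ∀ a x y, ‖fderiv ℝ (g a) x - fderiv ℝ (g a) y‖ ≤ Λ * ‖x - y‖)
    (hfl : ∀ x y, ‖fderiv ℝ f x - fderiv ℝ f y‖ ≤ Λ * ‖x - y‖)
    (hlim : ∀ x, Filter.Tendsto (fun a => g a x) l (nhds (f x))) (x v : E) :
    Filter.Tendsto (fun a => fderiv ℝ (g a) x v) l (nhds (fderiv ℝ f x v)) := by
  rw [Metric.tendsto_nhds]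
  intro e he
  set q := Λ * ‖v‖ * ‖v‖ with hq
  have hq0 : 0 ≤ q := by positivity
  -- Two Taylor remainders and two errors in the function values cost at most t e / 4 each; q + 1
  -- avoids dividing by 0.
  set t := e / (4 * (q + 1)) with ht
  have ht0 : 0 < t := by positivity
  have hte : t * (4 * (q + 1)) = e := by rw [ht]; field_simp
  filter_upwards [Metric.tendsto_nhds.1 (hlim x) (t * e / 4) (by positivity),
    Metric.tendsto_nhds.1 (hlim (x + t • v)) (t * e / 4) (by positivity)] with a h1 h2
  have h3 := abs_sub_sub_fderiv_le hΛ (hg a) (hgl a) x (t • v)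
  have h4 := abs_sub_sub_fderiv_le hΛ hf hfl x (t • v)
  have hqt : Λ * ‖t • v‖ * ‖t • v‖ = t * (t * q) := by
    rw [norm_smul, Real.norm_of_nonneg ht0.le]; ring
  rw [hqt, map_smul, smul_eq_mul] at h3 h4
  rw [Real.dist_eq] at h1 h2 ⊢
  have h1 := abs_lt.1 h1
  have h2 := abs_lt.1 h2
  have h3 := abs_le.1 h3
  have h4 := abs_le.1 h4
  have h5 : t * (t * q) ≤ t * (e / 4) := mul_le_mul_of_nonneg_left (by nlinarith) ht0.le
  have h6 : |t * (fderiv ℝ (g a) x v - fderiv ℝ f x v)| < t * (e + 0) := by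
    rw [abs_lt]
    constructor <;> nlinarith
  rw [abs_mul, abs_of_pos ht0, add_zero] at h6
  exact lt_of_mul_lt_mul_left h6 ht0.le

end GradientConvergence

variable {d : ℕ}

theorem gradient_apply_coord (f : Space d → ℝ) (x : Space d) (l : Fin d) :
    gradient f x l = fderiv ℝ f x (EuclideanSpace.single l 1) := by
  have h := InnerProductSpace.toDual_symm_apply (𝕜 := ℝ) (x := EuclideanSpace.single l (1 : ℝ))
    (y := fderiv ℝ f x)
  rw [EuclideanSpace.inner_single_right] at h
  simpa [gradient] using h

theorem tendsto_of_coord {ι : Type*} {l : Filter ι} {u : ι → Space d} {x : Space d}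
    (h : ∀ j, Filter.Tendsto (fun a => u a j) l (nhds (x j))) : Filter.Tendsto u l (nhds x) := by
  have h1 : Filter.Tendsto (fun a => WithLp.ofLp (u a)) l (nhds (WithLp.ofLp x)) :=
    tendsto_pi_nhds.2 h
  exact ((PiLp.continuous_toLp 2 (fun _ : Fin d => ℝ)).tendsto _).comp h1

/-! ### The mollified value function -/

section Mollifier

variable {ρ : Space d → ℝ} {ε : ℝ}

/-- The `L¹` norm of the gradient of `ρ`. -/
noncomputable def gradMass (ρ : Space d → ℝ) : ℝ := ∫ x, ‖fderiv ℝ ρ x‖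

theorem gradMass_nonneg (ρ : Space d → ℝ) : 0 ≤ gradMass ρ := integral_nonneg fun _ => norm_nonneg _

theorem mollifier_nonneg (hρ : IsMollifierProfile ρ) (hε : 0 < ε) (x : Space d) :
    0 ≤ mollifier ρ ε x := div_nonneg (hρ.2.2.1 _) (by positivity)

theorem integrable_mollifier (hρ : IsMollifierProfile ρ) (hε : 0 < ε) :
    Integrable (mollifier ρ ε) :=
  (hρ.2.2.2.1.comp_smul (inv_ne_zero hε.ne')).div_const _

theorem integral_comp_inv_smul_div (hε : 0 < ε) (f : Space d → ℝ) :
    ∫ x, f (ε⁻¹ • x) / ε ^ d = ∫ x, f x := by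
  rw [integral_div, Measure.integral_comp_inv_smul_of_nonneg _ _ hε.le, finrank_euclideanSpace_fin,
    smul_eq_mul]
  field_simp

theorem integral_mollifier (hρ : IsMollifierProfile ρ) (hε : 0 < ε) :
    ∫ x, mollifier ρ ε x = 1 := by
  rw [← hρ.2.2.2.2.1, ← integral_comp_inv_smul_div hε ρ]
  rfl

theorem integrable_fderiv (hρ : IsMollifierProfile ρ) : Integrable (fderiv ℝ ρ) := by
  have h := hρ.2.2.2.2.2
  refine h.congr' (hρ.1.continuous_fderiv (by simp)).aestronglyMeasurable
    (Filter.Eventually.of_forall fun x => ?_)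
  rw [gradient, LinearIsometryEquiv.norm_map]

/-- Rescaling turns the shift h into h/ε. This is the source of the factor 1/ε, and so of the
condition on Δt/ε. -/
theorem integral_abs_mollifier_translate_sub_le (hρ : IsMollifierProfile ρ) (hε : 0 < ε)
    (h : Space d) :
    ∫ x, |mollifier ρ ε (x + h) - mollifier ρ ε x| ≤ gradMass ρ / ε * ‖h‖ := by
  have h1 := integral_abs_translate_sub_le (μ := volume) (hρ.1.of_le (by simp))
    (integrable_fderiv hρ) (ε⁻¹ • h)
  rw [← integral_comp_inv_smul_div hε, norm_smul, norm_inv, Real.norm_of_nonneg hε.le] at h1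
  refine le_trans (le_of_eq (integral_congr_ae (Filter.Eventually.of_forall fun x => ?_)))
    (h1.trans (le_of_eq (by unfold gradMass; field_simp)))
  simp only [mollifier]
  rw [← sub_div, abs_div, abs_of_pos (pow_pos hε d), smul_add]

end Mollifier

variable {T : ℝ} {L : Space d → Space d → ℝ} {F G : Space d → Measure (Space d) → ℝ}
  {ρ : Space d → ℝ} {Cb A K₁ K₂ : ℝ} {N : ℕ} {Δx ε : ℝ}

theorem vDelta_eq (μ : ℝ → Measure (Space d)) (k : ℕ) :
    vDelta T L F G ρ Cb N Δx ε μ k = fun x => ∫ t, mollifier ρ ε t *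
      interp1 Δx (slValue T L F G Cb N Δx μ k) (x - t) := rfl

theorem SchemeBounds.differentiable_vDelta (h : SchemeBounds T L F G Cb A K₁ K₂)
    (hρ : IsMollifierProfile ρ) (hΔx : 0 < Δx) (hε : 0 < ε) {μ : ℝ → Measure (Space d)}
    (hμ : ∀ t ∈ Set.Icc 0 T, IsP1 (μ t)) (k : ℕ) :
    Differentiable ℝ (vDelta T L F G ρ Cb N Δx ε μ k) := fun x =>
  (hasFDerivAt_integral_mul_translate (integrable_mollifier hρ hε) (mollifier_nonneg hρ hε)
    (h.lipschitzWith_interp1_slValue hΔx hμ k) (h.abs_interp1_slValue_le hμ k) x).differentiableAt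

/-- Averaging against a probability density does not increase the Lipschitz constant, so the bound
is independent of ε. -/
theorem SchemeBounds.norm_gradient_vDelta_le (h : SchemeBounds T L F G Cb A K₁ K₂)
    (hρ : IsMollifierProfile ρ) (hΔx : 0 < Δx) (hε : 0 < ε) {μ : ℝ → Measure (Space d)}
    (hμ : ∀ t ∈ Set.Icc 0 T, IsP1 (μ t)) (k : ℕ) (x : Space d) :
    ‖gradient (vDelta T L F G ρ Cb N Δx ε μ k) x‖ ≤ valueLip d T K₁ K₂ := by
  rw [gradient, LinearIsometryEquiv.norm_map]
  have := norm_fderiv_le_of_lipschitz (x₀ := x) ℝ (lipschitzWith_integral_mul_translate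
    (integrable_mollifier hρ hε) (mollifier_nonneg hρ hε) (integral_mollifier hρ hε)
    (h.lipschitzWith_interp1_slValue (N := N) hΔx hμ k) (h.abs_interp1_slValue_le hμ k))
  rwa [Real.coe_toNNReal _ h.valueLip_nonneg] at this

theorem SchemeBounds.norm_fderiv_vDelta_sub_le (h : SchemeBounds T L F G Cb A K₁ K₂)
    (hρ : IsMollifierProfile ρ) (hΔx : 0 < Δx) (hε : 0 < ε) {μ : ℝ → Measure (Space d)}
    (hμ : ∀ t ∈ Set.Icc 0 T, IsP1 (μ t)) (k : ℕ) (x y : Space d) :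
    ‖fderiv ℝ (vDelta T L F G ρ Cb N Δx ε μ k) x - fderiv ℝ (vDelta T L F G ρ Cb N Δx ε μ k) y‖ ≤
      valueLip d T K₁ K₂ * (gradMass ρ / ε) * ‖x - y‖ := by
  have := norm_fderiv_integral_mul_translate_sub_le
    (integrable_mollifier hρ hε) (mollifier_nonneg hρ hε)
    (integral_abs_mollifier_translate_sub_le hρ hε)
    (h.lipschitzWith_interp1_slValue (N := N) hΔx hμ k) (h.abs_interp1_slValue_le hμ k) x y
  rwa [Real.coe_toNNReal _ h.valueLip_nonneg] at this

theorem SchemeBounds.norm_gradient_vDelta_sub_le (h : SchemeBounds T L F G Cb A K₁ K₂)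
    (hρ : IsMollifierProfile ρ) (hΔx : 0 < Δx) (hε : 0 < ε) {μ : ℝ → Measure (Space d)}
    (hμ : ∀ t ∈ Set.Icc 0 T, IsP1 (μ t)) (k : ℕ) (x y : Space d) :
    ‖gradient (vDelta T L F G ρ Cb N Δx ε μ k) x - gradient (vDelta T L F G ρ Cb N Δx ε μ k) y‖ ≤
      valueLip d T K₁ K₂ * (gradMass ρ / ε) * ‖x - y‖ := by
  rw [gradient, gradient, ← map_sub, LinearIsometryEquiv.norm_map]
  exact h.norm_fderiv_vDelta_sub_le hρ hΔx hε hμ k x y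

theorem SchemeBounds.tendsto_gradient_vDelta (h : SchemeBounds T L F G Cb A K₁ K₂)
    (hρ : IsMollifierProfile ρ) (hΔx : 0 < Δx) (hε : 0 < ε) {ι : Type*} {l : Filter ι}
    [l.IsCountablyGenerated] {u : ι → ℝ → Measure (Space d)}
    {μ : ℝ → Measure (Space d)} (hu : ∀ a, ∀ t ∈ Set.Icc 0 T, IsP1 (u a t))
    (hμ : ∀ t ∈ Set.Icc 0 T, IsP1 (μ t))
    (hF : ∀ x, ∀ t ∈ Set.Icc 0 T, Filter.Tendsto (fun a => F x (u a t)) l (nhds (F x (μ t))))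
    (hG : ∀ x, ∀ t ∈ Set.Icc 0 T, Filter.Tendsto (fun a => G x (u a t)) l (nhds (G x (μ t))))
    (k : ℕ) (x : Space d) :
    Filter.Tendsto (fun a => gradient (vDelta T L F G ρ Cb N Δx ε (u a) k) x) l
      (nhds (gradient (vDelta T L F G ρ Cb N Δx ε μ k) x)) := by
  refine tendsto_of_coord fun j => ?_
  simp only [gradient_apply_coord]
  refine tendsto_fderiv_apply_of_tendsto
    (mul_nonneg h.valueLip_nonneg (div_nonneg (gradMass_nonneg ρ) hε.le))
    (fun a => h.differentiable_vDelta hρ hΔx hε (hu a) k) (h.differentiable_vDelta hρ hΔx hε hμ k)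
    (fun a => h.norm_fderiv_vDelta_sub_le hρ hΔx hε (hu a) k)
    (h.norm_fderiv_vDelta_sub_le hρ hΔx hε hμ k) (fun y => ?_) x _
  simp only [vDelta_eq]
  exact tendsto_integral_mul_translate (integrable_mollifier hρ hε)
    (fun a => (h.lipschitzWith_interp1_slValue hΔx (hu a) k).continuous)
    (fun a => h.abs_interp1_slValue_le (hu a) k)
    (tendsto_interp1 (h.tendsto_slBackward hΔx hu hμ hF hG (N - k))) y

end MFG

namespace MFG

variable {d : ℕ}

/-! ### Cells -/

theorem cell_eq_preimage (Δx : ℝ) (i : Fin d → ℤ) :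
    cell Δx i = WithLp.ofLp ⁻¹' Set.Icc (fun l => gridPt Δx i l - Δx / 2)
      (fun l => gridPt Δx i l + Δx / 2) := by
  ext x
  simp only [cell, Set.mem_ofPred_eq, Set.mem_preimage, Set.mem_Icc, Pi.le_def, ← forall_and]
  refine forall_congr' fun l => ?_
  rw [abs_le]
  constructor <;> rintro ⟨h1, h2⟩ <;> constructor <;> linarith

theorem isClosed_cell (Δx : ℝ) (i : Fin d → ℤ) : IsClosed (cell Δx i) := by
  rw [cell_eq_preimage]
  exact isClosed_Icc.preimage (PiLp.continuous_ofLp 2 _)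

theorem measurableSet_cell (Δx : ℝ) (i : Fin d → ℤ) : MeasurableSet (cell Δx i) :=
  (isClosed_cell Δx i).measurableSet

theorem convex_cell (Δx : ℝ) (i : Fin d → ℤ) : Convex ℝ (cell Δx i) := by
  rw [cell_eq_preimage]
  exact (convex_Icc _ _).linear_preimage (WithLp.linearEquiv 2 ℝ (Fin d → ℝ)).toLinearMap

theorem volume_cell {Δx : ℝ} (hΔx : 0 < Δx) (i : Fin d → ℤ) :
    volume (cell Δx i) = ENNReal.ofReal (Δx ^ d) := by
  rw [cell_eq_preimage, (PiLp.volume_preserving_ofLp (Fin d)).measure_preimage measurableSet_Icc.nullMeasurableSet, Real.volume_Icc_pi]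
  have : ∀ l, gridPt Δx i l + Δx / 2 - (gridPt Δx i l - Δx / 2) = Δx := fun l => by ring
  simp only [this, Finset.prod_const, Finset.card_univ, Fintype.card_fin]
  rw [ENNReal.ofReal_pow hΔx.le]

theorem volume_real_cell {Δx : ℝ} (hΔx : 0 < Δx) (i : Fin d → ℤ) :
    volume.real (cell Δx i) = Δx ^ d := by
  rw [Measure.real, volume_cell hΔx, ENNReal.toReal_ofReal (by positivity)]

/-- If i and j differ in coordinate l, a common point must lie on the hyperplane halfway between the
two centers in that coordinate. -/
theorem volume_cell_inter {Δx : ℝ} {i j : Fin d → ℤ} (hij : i ≠ j) :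
    volume (cell Δx i ∩ cell Δx j) = 0 := by
  obtain ⟨l, hl⟩ := Function.ne_iff.1 hij
  have hsub : cell Δx i ∩ cell Δx j ⊆
      WithLp.ofLp ⁻¹' {y : Fin d → ℝ | y l = (i l + j l) * Δx / 2} := by
    rintro x ⟨hi, hj⟩
    have h1 := abs_le.1 (hi l)
    have h2 := abs_le.1 (hj l)
    have hΔ : 0 ≤ Δx := by linarith
    simp only [gridPt] at h1 h2
    simp only [Set.mem_preimage, Set.mem_ofPred_eq]
    rcases lt_or_gt_of_ne hl with h | h
    · have h3 : (i l : ℝ) + 1 ≤ j l := by exact_mod_cast h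
      have := mul_le_mul_of_nonneg_right h3 hΔ
      linarith
    · have h3 : (j l : ℝ) + 1 ≤ i l := by exact_mod_cast h
      have := mul_le_mul_of_nonneg_right h3 hΔ
      linarith
  refine measure_mono_null hsub ?_
  have hz : volume {y : Fin d → ℝ | y l = (i l + j l) * Δx / 2} = 0 :=
    Measure.pi_hyperplane (fun _ : Fin d => (volume : Measure ℝ)) l _
  have hmp := PiLp.volume_preserving_ofLp (Fin d)
  exact hmp.quasiMeasurePreserving.preimage_null hz

theorem iUnion_cell {Δx : ℝ} (hΔx : 0 < Δx) : ⋃ i : Fin d → ℤ, cell Δx i = Set.univ := by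
  refine Set.eq_univ_of_forall fun x => Set.mem_iUnion.2 ⟨fun l => round (x l / Δx), fun l => ?_⟩
  have h1 := abs_sub_round (x l / Δx)
  have h2 : x l - gridPt Δx (fun l => round (x l / Δx)) l = (x l / Δx - round (x l / Δx)) * Δx := by
    simp only [gridPt]; field_simp
  rw [h2, abs_mul, abs_of_pos hΔx]
  nlinarith

theorem gridPt_mem_cell_iff {Δx : ℝ} (hΔx : 0 < Δx) {i j : Fin d → ℤ} :
    gridPt Δx i ∈ cell Δx j ↔ i = j := by
  constructor
  · intro h
    ext l
    have h1 := h l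
    simp only [gridPt] at h1
    rw [← sub_mul, abs_mul, abs_of_pos hΔx] at h1
    have h2 : |((i l - j l : ℤ) : ℝ)| < 1 := by push_cast; nlinarith
    have h3 : |i l - j l| < 1 := by exact_mod_cast h2
    rw [Int.abs_lt_one_iff] at h3
    omega
  · rintro rfl l
    simp only [sub_self, abs_zero]
    positivity

theorem norm_le_of_mem_cell {Δx C : ℝ} {j : Fin d → ℤ} (hj : ∀ l, |gridPt Δx j l| ≤ C)
    {x : Space d} (hx : x ∈ cell Δx j) : ‖x‖ ≤ d * (C + Δx / 2) :=
  norm_le_of_abs_coord_le fun l => by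
    have := abs_sub_abs_le_abs_sub (x l) (gridPt Δx j l)
    linarith [hx l, hj l]

/-- For an absolutely continuous measure the overlaps of the closed cells are null, so the cells
behave as a partition. This is where mass conservation comes from. -/
theorem sum_measureReal_cell {Δx : ℝ} (hΔx : 0 < Δx) {ν : Measure (Space d)} [IsFiniteMeasure ν]
    (hν : ν ≪ volume) {I : Finset (Fin d → ℤ)} (hI : ∀ i ∉ I, ν (cell Δx i) = 0) :
    ∑ i ∈ I, ν.real (cell Δx i) = ν.real Set.univ := by
  have h1 : ν (⋃ i ∈ I, cell Δx i) = ∑ i ∈ I, ν (cell Δx i) :=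
    measure_biUnion_finset₀ (fun i _ j _ hij => hν (volume_cell_inter hij))
      fun i _ => (measurableSet_cell Δx i).nullMeasurableSet
  have h2 : ν (⋃ i ∈ I, cell Δx i) = ν Set.univ := by
    refine le_antisymm (measure_mono (Set.subset_univ _)) ?_
    have hsub : (Set.univ : Set (Space d)) ⊆
        (⋃ i ∈ I, cell Δx i) ∪ ⋃ i ∈ (I : Set (Fin d → ℤ))ᶜ, cell Δx i := by
      intro x _
      obtain ⟨i, hi⟩ := Set.mem_iUnion.1 ((iUnion_cell hΔx).symm ▸ Set.mem_univ x)
      by_cases h : i ∈ I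
      · exact Or.inl (Set.mem_biUnion (s := (I : Set (Fin d → ℤ))) h hi)
      · exact Or.inr (Set.mem_biUnion (s := (I : Set (Fin d → ℤ))ᶜ) h hi)
    refine (measure_mono hsub).trans ((measure_union_le _ _).trans ?_)
    have h0 : ν (⋃ i ∈ (I : Set (Fin d → ℤ))ᶜ, cell Δx i) = 0 := by
      refine (measure_biUnion_null_iff (Set.to_countable _)).2 fun i hi => hI i ?_
      simpa using hi
    rw [h0, add_zero]
  simp only [Measure.real]
  rw [← ENNReal.toReal_sum fun i _ => measure_ne_top _ _, ← h1, h2]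

/-! ### Null sets and the Euler step -/

/-- On B the map is injective with a K-Lipschitz inverse. Lipschitz maps send sets of zero
d-dimensional Hausdorff measure to such sets, and in dimension d these are the Lebesgue null sets.
-/
theorem volume_inter_preimage_eq_zero {Φ : Space d → Space d} {S B : Set (Space d)} {K : ℝ}
    (hK : 0 ≤ K) (hΦ : ∀ x ∈ B, ∀ y ∈ B, ‖x - y‖ ≤ K * ‖Φ x - Φ y‖) (hS : volume S = 0) :
    volume (B ∩ Φ ⁻¹' S) = 0 := by
  rcases (B ∩ Φ ⁻¹' S).eq_empty_or_nonempty with he | hne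
  · rw [he, measure_empty]
  have hinj : Set.InjOn Φ (B ∩ Φ ⁻¹' S) := fun x hx y hy hxy => by
    have := hΦ x hx.1 y hy.1
    rw [hxy, sub_self, norm_zero, mul_zero] at this
    exact sub_eq_zero.1 (norm_le_zero_iff.1 this)
  set g := Function.invFunOn Φ (B ∩ Φ ⁻¹' S)
  have hg : ∀ x ∈ B ∩ Φ ⁻¹' S, g (Φ x) = x := fun x hx => hinj.leftInvOn_invFunOn hx
  have hlip : LipschitzOnWith (Real.toNNReal K) g (Φ '' (B ∩ Φ ⁻¹' S)) := by
    refine LipschitzOnWith.of_dist_le_mul ?_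
    rintro _ ⟨x, hx, rfl⟩ _ ⟨y, hy, rfl⟩
    rw [hg x hx, hg y hy, Real.coe_toNNReal _ hK, dist_eq_norm, dist_eq_norm]
    exact hΦ x hx.1 y hy.1
  have himg : g '' (Φ '' (B ∩ Φ ⁻¹' S)) = B ∩ Φ ⁻¹' S := by
    rw [Set.image_image]
    exact (Set.image_congr hg).trans (Set.image_id' _)
  have hd : (0 : ℝ) ≤ Module.finrank ℝ (Space d) := Nat.cast_nonneg _
  have hle := hlip.hausdorffMeasure_image_le hd
  rw [himg] at hle
  have hS' : Measure.hausdorffMeasure (Module.finrank ℝ (Space d) : ℝ) S = 0 :=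
    (Measure.absolutelyContinuous_isAddHaarMeasure _ volume) hS
  have h0 : Measure.hausdorffMeasure (Module.finrank ℝ (Space d) : ℝ)
      (Φ '' (B ∩ Φ ⁻¹' S)) = 0 :=
    measure_mono_null (by rintro _ ⟨x, hx, rfl⟩; exact hx.2) hS'
  rw [h0, mul_zero] at hle
  exact (Measure.absolutelyContinuous_isAddHaarMeasure volume
    (Measure.hausdorffMeasure (Module.finrank ℝ (Space d) : ℝ))) (le_antisymm hle bot_le)

variable {T : ℝ} {L : Space d → Space d → ℝ} {F G : Space d → Measure (Space d) → ℝ}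
  {ρ : Space d → ℝ} {Cb A K₁ K₂ : ℝ} {N : ℕ} {Δx ε : ℝ}

theorem SchemeBounds.exists_norm_eulerFlow_sub_le (h : SchemeBounds T L F G Cb A K₁ K₂)
    (hL : HypH1 L) (hρ : IsMollifierProfile ρ) : ∃ K : ℝ, 0 ≤ K ∧
      ∀ (N : ℕ) (Δx ε : ℝ) (μ : ℝ → Measure (Space d)), 0 < Δx → 0 < ε →
        (∀ t ∈ Set.Icc 0 T, IsP1 (μ t)) → ∀ k x,
          ‖eulerFlow T L F G ρ Cb N Δx ε μ k x - x‖ ≤ T / N * K := by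
  obtain ⟨κ, M, hκ, hb⟩ := hL.exists_norm_gradient_hamiltonian_le
  have hT := h.T_pos
  refine ⟨|(valueLip d T K₁ K₂ + M) / κ|, abs_nonneg _, fun N Δx ε μ hΔx hε hμ k x => ?_⟩
  rw [eulerFlow, sub_sub_cancel_left, norm_neg, norm_smul, Real.norm_of_nonneg (by positivity)]
  refine mul_le_mul_of_nonneg_left ((hb x _).trans (le_trans ?_ (le_abs_self _))) (by positivity)
  gcongr
  exact h.norm_gradient_vDelta_le hρ hΔx hε hμ k x

/-- `K` is a Lipschitz constant of `(x, p) ↦ D_pH(x, p)` for `|x| ≤ R` and `|p| ≤ P`. -/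
def HamiltonianLipschitz (L : Space d → Space d → ℝ) (R P K : ℝ) : Prop :=
  ∀ x y p q : Space d, ‖x‖ ≤ R → ‖y‖ ≤ R → ‖p‖ ≤ P → ‖q‖ ≤ P →
    ‖gradient (hamiltonian L x) p - gradient (hamiltonian L y) q‖ ≤ K * (‖x - y‖ + ‖p - q‖)

theorem SchemeBounds.norm_velocity_sub_le (h : SchemeBounds T L F G Cb A K₁ K₂)
    (hρ : IsMollifierProfile ρ) (hΔx : 0 < Δx) (hε : 0 < ε) {μ : ℝ → Measure (Space d)}
    (hμ : ∀ t ∈ Set.Icc 0 T, IsP1 (μ t)) {R K : ℝ} (hK0 : 0 ≤ K)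
    (hK : HamiltonianLipschitz L R (valueLip d T K₁ K₂) K) (k : ℕ) {x y : Space d}
    (hx : ‖x‖ ≤ R) (hy : ‖y‖ ≤ R) :
    ‖gradient (hamiltonian L x) (gradient (vDelta T L F G ρ Cb N Δx ε μ k) x) -
      gradient (hamiltonian L y) (gradient (vDelta T L F G ρ Cb N Δx ε μ k) y)‖ ≤
      K * (1 + valueLip d T K₁ K₂ * (gradMass ρ / ε)) * ‖x - y‖ := by
  refine (hK x y _ _ hx hy (h.norm_gradient_vDelta_le hρ hΔx hε hμ k x)
    (h.norm_gradient_vDelta_le hρ hΔx hε hμ k y)).trans ?_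
  rw [mul_assoc]
  refine mul_le_mul_of_nonneg_left ?_ hK0
  linarith [h.norm_gradient_vDelta_sub_le (N := N) (Cb := Cb) hρ hΔx hε hμ k x y]

theorem SchemeBounds.continuousOn_eulerFlow (h : SchemeBounds T L F G Cb A K₁ K₂)
    (hρ : IsMollifierProfile ρ) (hΔx : 0 < Δx) (hε : 0 < ε) {μ : ℝ → Measure (Space d)}
    (hμ : ∀ t ∈ Set.Icc 0 T, IsP1 (μ t)) {R K : ℝ} (hK0 : 0 ≤ K)
    (hK : HamiltonianLipschitz L R (valueLip d T K₁ K₂) K) (k : ℕ) :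
    ContinuousOn (eulerFlow T L F G ρ Cb N Δx ε μ k) (Metric.closedBall 0 R) := by
  have hlip := LipschitzOnWith.of_dist_le' (f := fun x =>
    gradient (hamiltonian L x) (gradient (vDelta T L F G ρ Cb N Δx ε μ k) x))
    (s := Metric.closedBall 0 R) fun x hx y hy => by
      rw [dist_eq_norm, dist_eq_norm]
      exact h.norm_velocity_sub_le hρ hΔx hε hμ hK0 hK k (by simpa using hx) (by simpa using hy)
  exact continuousOn_id.sub (hlip.continuousOn.fun_const_smul _)

/-- The Euler step is the identity minus a map that is 1/2-Lipschitz on the ball of radius R. -/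
theorem SchemeBounds.norm_sub_le_eulerFlow (h : SchemeBounds T L F G Cb A K₁ K₂)
    (hρ : IsMollifierProfile ρ) (hΔx : 0 < Δx) (hε : 0 < ε) {μ : ℝ → Measure (Space d)}
    (hμ : ∀ t ∈ Set.Icc 0 T, IsP1 (μ t)) {R K : ℝ} (hK0 : 0 ≤ K)
    (hK : HamiltonianLipschitz L R (valueLip d T K₁ K₂) K) (k : ℕ)
    (hsmall : T / N * (K * (1 + valueLip d T K₁ K₂ * (gradMass ρ / ε))) ≤ 1 / 2)
    {x y : Space d} (hx : ‖x‖ ≤ R) (hy : ‖y‖ ≤ R) :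
    ‖x - y‖ ≤ 2 * ‖eulerFlow T L F G ρ Cb N Δx ε μ k x - eulerFlow T L F G ρ Cb N Δx ε μ k y‖ := by
  have hT := h.T_pos
  have h1 := h.norm_velocity_sub_le (N := N) (Cb := Cb) hρ hΔx hε hμ hK0 hK k hx hy
  set b : Space d → Space d := fun x =>
    gradient (hamiltonian L x) (gradient (vDelta T L F G ρ Cb N Δx ε μ k) x)
  have h2 : eulerFlow T L F G ρ Cb N Δx ε μ k x - eulerFlow T L F G ρ Cb N Δx ε μ k y =
      (x - y) - (T / N) • (b x - b y) := by
    simp only [eulerFlow, b]; module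
  have h3 : ‖(T / N : ℝ) • (b x - b y)‖ ≤ 1 / 2 * ‖x - y‖ := by
    rw [norm_smul, Real.norm_of_nonneg (by positivity)]
    refine (mul_le_mul_of_nonneg_left h1 (by positivity)).trans ?_
    rw [← mul_assoc]
    exact mul_le_mul_of_nonneg_right hsmall (norm_nonneg _)
  rw [h2]
  linarith [norm_sub_norm_le (x - y) ((T / N : ℝ) • (b x - b y))]

theorem SchemeBounds.tendsto_eulerFlow (h : SchemeBounds T L F G Cb A K₁ K₂)
    (hL : HypH1 L) (hρ : IsMollifierProfile ρ) (hΔx : 0 < Δx) (hε : 0 < ε) {ι : Type*}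
    {l : Filter ι} [l.IsCountablyGenerated] {u : ι → ℝ → Measure (Space d)}
    {μ : ℝ → Measure (Space d)} (hu : ∀ a, ∀ t ∈ Set.Icc 0 T, IsP1 (u a t))
    (hμ : ∀ t ∈ Set.Icc 0 T, IsP1 (μ t))
    (hF : ∀ x, ∀ t ∈ Set.Icc 0 T, Filter.Tendsto (fun a => F x (u a t)) l (nhds (F x (μ t))))
    (hG : ∀ x, ∀ t ∈ Set.Icc 0 T, Filter.Tendsto (fun a => G x (u a t)) l (nhds (G x (μ t))))
    (k : ℕ) (x : Space d) :
    Filter.Tendsto (fun a => eulerFlow T L F G ρ Cb N Δx ε (u a) k x) l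
      (nhds (eulerFlow T L F G ρ Cb N Δx ε μ k x)) := by
  obtain ⟨K, -, hK⟩ := hL.exists_gradient_hamiltonian_lipschitz ‖x‖ (valueLip d T K₁ K₂)
  refine Filter.Tendsto.const_sub x (Filter.Tendsto.const_smul ?_ (T / N : ℝ))
  rw [tendsto_iff_norm_sub_tendsto_zero]
  have hv := h.tendsto_gradient_vDelta (N := N) hρ hΔx hε hu hμ hF hG k x
  rw [tendsto_iff_norm_sub_tendsto_zero] at hv
  refine squeeze_zero (fun _ => norm_nonneg _) (fun a => hK x x _ _ le_rfl le_rfl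
    (h.norm_gradient_vDelta_le hρ hΔx hε (hu a) k x)
    (h.norm_gradient_vDelta_le hρ hΔx hε hμ k x)) ?_
  simpa using hv.const_mul K

end MFG

namespace MFG

variable {d : ℕ} {T : ℝ} {L : Space d → Space d → ℝ} {F G : Space d → Measure (Space d) → ℝ}
  {m₀ : Measure (Space d)} {ρ : Space d → ℝ} {Cb A K₁ K₂ : ℝ} {N : ℕ} {Δx ε : ℝ}
  {μ : ℝ → Measure (Space d)}

/-! ### The Lagrange-Galerkin scheme -/

theorem beta0_nonneg (Δx : ℝ) (i : Fin d → ℤ) (x : Space d) : 0 ≤ beta0 Δx i x :=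
  Set.indicator_nonneg (fun _ _ => zero_le_one) x

theorem beta0_le_one (Δx : ℝ) (i : Fin d → ℤ) (x : Space d) : beta0 Δx i x ≤ 1 :=
  Set.indicator_le_self' (fun _ _ => zero_le_one) x

theorem measurable_beta0 (Δx : ℝ) (i : Fin d → ℤ) : Measurable (beta0 (d := d) Δx i) :=
  measurable_one.indicator (measurableSet_cell Δx i)

theorem lgCoeff_zero (hm₀ : HypH3 m₀) (i : Fin d → ℤ) :
    lgCoeff T L F G m₀ ρ Cb N Δx ε μ 0 i = 1 / Δx ^ d * m₀.real (cell Δx i) := by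
  have := hm₀.1
  unfold lgCoeff density
  rw [Measure.setIntegral_toReal_rnDeriv hm₀.2.1]

theorem lgCoeff_nonneg (hΔx : 0 < Δx) (k : ℕ) (i : Fin d → ℤ) :
    0 ≤ lgCoeff T L F G m₀ ρ Cb N Δx ε μ k i := by
  induction k generalizing i with
  | zero => exact mul_nonneg (by positivity) (integral_nonneg fun _ => ENNReal.toReal_nonneg)
  | succ k ih => exact mul_nonneg (by positivity) (tsum_nonneg fun j =>
      mul_nonneg (ih j) (integral_nonneg fun _ => beta0_nonneg _ _ _))

/-- A nonzero coefficient at step k + 1 traces back to a nonzero coefficient j at step k and a point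
x ∈ E_j with Φ_k(x) ∈ E_i. The two half-cells and the displacement of x give the increment Δx + Δt
K. -/
theorem abs_gridPt_le_of_lgCoeff_ne_zero (hm₀ : HypH3 m₀) {C K : ℝ}
    (hC : m₀.support ⊆ {x : Space d | ∀ l, |x l| ≤ C})
    (hK : ∀ k x, ‖eulerFlow T L F G ρ Cb N Δx ε μ k x - x‖ ≤ T / N * K) (k : ℕ) (i : Fin d → ℤ)
    (hi : lgCoeff T L F G m₀ ρ Cb N Δx ε μ k i ≠ 0) (l : Fin d) :
    |gridPt Δx i l| ≤ C + Δx / 2 + k * (Δx + T / N * K) := by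
  induction k generalizing i with
  | zero =>
    have := hm₀.1
    rw [lgCoeff_zero hm₀] at hi
    have hpos : 0 < m₀ (cell Δx i) := by
      refine pos_iff_ne_zero.2 fun h => right_ne_zero_of_mul hi ?_
      rw [Measure.real, h, ENNReal.toReal_zero]
    obtain ⟨x, hx, hxs⟩ := Measure.nonempty_inter_support_of_pos hpos
    have h1 := abs_le.1 (hx l)
    have h2 := abs_le.1 (hC hxs l)
    rw [Nat.cast_zero, zero_mul, add_zero, abs_le]
    constructor <;> linarith
  | succ k ih =>
    have hj : ∃ j, lgCoeff T L F G m₀ ρ Cb N Δx ε μ k j *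
        ∫ x in cell Δx j, beta0 Δx i (eulerFlow T L F G ρ Cb N Δx ε μ k x) ≠ 0 := by
      by_contra! hall
      refine hi ?_
      rw [lgCoeff]
      simp only [hall, tsum_zero, mul_zero]
    obtain ⟨j, hj⟩ := hj
    have hx : ∃ x ∈ cell Δx j, beta0 Δx i (eulerFlow T L F G ρ Cb N Δx ε μ k x) ≠ 0 := by
      by_contra! hall
      exact right_ne_zero_of_mul hj (setIntegral_eq_zero_of_forall_eq_zero hall)
    obtain ⟨x, hx, hxi⟩ := hx
    have h1 := abs_le.1 (ih j (left_ne_zero_of_mul hj))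
    have h2 := abs_le.1 (hx l)
    have h3 := abs_le.1 ((Set.mem_of_indicator_ne_zero hxi : _ ∈ cell Δx i) l)
    have h4 := abs_le.1 ((abs_coord_le_norm _ l).trans (hK k x))
    simp only [PiLp.sub_apply] at h4
    push_cast
    rw [abs_le]
    constructor <;> linarith

theorem SchemeBounds.exists_isSupportBound (h : SchemeBounds T L F G Cb A K₁ K₂)
    (hL : HypH1 L) (hm₀ : HypH3 m₀) (hρ : IsMollifierProfile ρ) {c : ℝ} (hc : 0 < c) :
    ∃ C : ℝ, 0 < C ∧ IsSupportBound T L F G m₀ ρ Cb c C := by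
  have hT := h.T_pos
  obtain ⟨C, hC0, hC⟩ := hm₀.2.2.1
  obtain ⟨K, hK0, hK⟩ := h.exists_norm_eulerFlow_sub_le hL hρ
  -- Here c T / 2 bounds Δx / 2, and T(c + K) bounds the total growth over at most N steps of length
  -- Δt(c + K).
  refine ⟨C + c * T / 2 + T * (c + K), by positivity, fun N Δx ε μ hN hΔx hε hcΔ hμ k hk i hi => ?_⟩
  by_contra hne
  refine hi fun l => (abs_gridPt_le_of_lgCoeff_ne_zero hm₀ hC
    (hK N Δx ε μ hΔx hε hμ.1) k i hne l).trans ?_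
  have hN' : (1 : ℝ) ≤ N := by exact_mod_cast hN
  have h1 : T / N ≤ T := div_le_self hT.le hN'
  have h2 : Δx ≤ c * T := hcΔ.trans (by gcongr)
  have h3 : k * (Δx + T / N * K) ≤ T * (c + K) := by
    calc k * (Δx + T / N * K) ≤ N * (c * (T / N) + T / N * K) := by gcongr
      _ = T * (c + K) := by field_simp
  linarith

theorem setIntegral_beta0_comp {Φ : Space d → Space d} {S : Set (Space d)}
    (hΦ : AEMeasurable Φ (volume.restrict S)) (i : Fin d → ℤ) :
    ∫ x in S, beta0 Δx i (Φ x) = ((volume.restrict S).map Φ).real (cell Δx i) := by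
  rw [← integral_map hΦ (measurable_beta0 Δx i).aestronglyMeasurable]
  exact integral_indicator_one (measurableSet_cell Δx i)

/-- The Euler step `Φ` transports Lebesgue measure on the cells of index in `I` to absolutely
continuous measures. -/
structure TransportsCells (Δx : ℝ) (I : Finset (Fin d → ℤ)) (Φ : Space d → Space d) : Prop where
  aemeasurable : ∀ j ∈ I, AEMeasurable Φ (volume.restrict (cell Δx j))
  absolutelyContinuous : ∀ j ∈ I, (volume.restrict (cell Δx j)).map Φ ≪ volume

theorem lgCoeff_succ {I : Finset (Fin d → ℤ)} {k : ℕ}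
    (hI : ∀ i ∉ I, lgCoeff T L F G m₀ ρ Cb N Δx ε μ k i = 0) (i : Fin d → ℤ) :
    lgCoeff T L F G m₀ ρ Cb N Δx ε μ (k + 1) i =
      1 / Δx ^ d * ∑ j ∈ I, lgCoeff T L F G m₀ ρ Cb N Δx ε μ k j *
        ∫ x in cell Δx j, beta0 Δx i (eulerFlow T L F G ρ Cb N Δx ε μ k x) := by
  simp only [lgCoeff]
  rw [tsum_eq_sum fun j hj => by rw [hI j hj, zero_mul]]

theorem isFiniteMeasure_restrict_cell (hΔx : 0 < Δx) (j : Fin d → ℤ) :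
    IsFiniteMeasure (volume.restrict (cell Δx j)) :=
  ⟨by rw [Measure.restrict_apply_univ, volume_cell hΔx]; exact ENNReal.ofReal_lt_top⟩

/-- The mass of cell j is redistributed according to the image of Lebesgue measure on E_j; that
image is absolutely continuous, so the shares of the cells add up to Δx^d. -/
theorem sum_lgCoeff (hm₀ : HypH3 m₀) (hΔx : 0 < Δx) {I : Finset (Fin d → ℤ)}
    (hI : ∀ k ≤ N, ∀ i ∉ I, lgCoeff T L F G m₀ ρ Cb N Δx ε μ k i = 0)
    (hΦ : ∀ k, TransportsCells Δx I (eulerFlow T L F G ρ Cb N Δx ε μ k)) (k : ℕ) (hk : k ≤ N) :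
    ∑ i ∈ I, lgCoeff T L F G m₀ ρ Cb N Δx ε μ k i * Δx ^ d = 1 := by
  have hd : Δx ^ d ≠ 0 := (pow_pos hΔx d).ne'
  induction k with
  | zero =>
    have := hm₀.1
    have h1 : ∀ i ∉ I, m₀ (cell Δx i) = 0 := by
      intro i hi
      have := hI 0 hk i hi
      rw [lgCoeff_zero hm₀] at this
      exact (measureReal_eq_zero_iff).1 ((mul_eq_zero.1 this).resolve_left (by positivity))
    rw [← probReal_univ (μ := m₀), ← sum_measureReal_cell hΔx hm₀.2.1 h1]
    refine Finset.sum_congr rfl fun i _ => ?_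
    rw [lgCoeff_zero hm₀]
    field_simp
  | succ k ih =>
    have hkN : k ≤ N := Nat.le_of_succ_le hk
    have hfin := isFiniteMeasure_restrict_cell (d := d) hΔx
    set Φ := eulerFlow T L F G ρ Cb N Δx ε μ k
    set m := lgCoeff T L F G m₀ ρ Cb N Δx ε μ k
    set ν : (Fin d → ℤ) → Measure (Space d) := fun j => (volume.restrict (cell Δx j)).map Φ
    have hstep : ∀ i, lgCoeff T L F G m₀ ρ Cb N Δx ε μ (k + 1) i * Δx ^ d =
        ∑ j ∈ I, m j * (ν j).real (cell Δx i) := by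
      intro i
      rw [lgCoeff_succ (hI k hkN), one_div_mul_eq_div, div_mul_cancel₀ _ hd]
      exact Finset.sum_congr rfl fun j hj => by
        rw [setIntegral_beta0_comp ((hΦ k).aemeasurable j hj)]
    simp only [hstep]
    rw [Finset.sum_comm, ← ih hkN]
    refine Finset.sum_congr rfl fun j hj => ?_
    rw [← Finset.mul_sum]
    -- If m_j ≠ 0, the vanishing of the coefficients outside I at step k + 1, a sum of nonnegative
    -- terms, shows that nothing from E_j is sent to those cells.
    rcases eq_or_ne (m j) 0 with h0 | h0
    · rw [h0, zero_mul, zero_mul]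
    congr 1
    have hν : ∀ i ∉ I, ν j (cell Δx i) = 0 := by
      intro i hi
      have h1 := hstep i
      rw [hI (k + 1) hk i hi, zero_mul, eq_comm, Finset.sum_eq_zero_iff_of_nonneg
        fun j _ => mul_nonneg (lgCoeff_nonneg hΔx k j) measureReal_nonneg] at h1
      exact (measureReal_eq_zero_iff).1 ((mul_eq_zero.1 (h1 j hj)).resolve_left h0)
    rw [sum_measureReal_cell hΔx ((hΦ k).absolutelyContinuous j hj) hν, Measure.real,
      Measure.map_apply_of_aemeasurable ((hΦ k).aemeasurable j hj) MeasurableSet.univ,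
      Set.preimage_univ, Measure.restrict_apply_univ, ← Measure.real, volume_real_cell hΔx]

theorem tendsto_beta0 {ι : Type*} {l : Filter ι} {i : Fin d → ℤ} {u : ι → Space d} {x : Space d}
    (hu : Filter.Tendsto u l (nhds x)) (hx : x ∉ frontier (cell Δx i)) :
    Filter.Tendsto (fun a => beta0 Δx i (u a)) l (nhds (beta0 Δx i x)) := by
  have hc : ContinuousAt (beta0 Δx i) x :=
    (continuous_one.continuousOn.continuousAt_indicator hx : _)
  exact hc.tendsto.comp hu

/-- The indicator β_i⁰ is discontinuous only on the frontier of a convex cell, a null set. The limit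
flow reaches it from almost no point, so dominated convergence applies to each integral. -/
theorem tendsto_lgCoeff {ι : Type*} {l : Filter ι} [l.IsCountablyGenerated] (hΔx : 0 < Δx)
    {I : Finset (Fin d → ℤ)} {u : ι → ℝ → Measure (Space d)}
    (hIu : ∀ a, ∀ k ≤ N, ∀ i ∉ I, lgCoeff T L F G m₀ ρ Cb N Δx ε (u a) k i = 0)
    (hI : ∀ k ≤ N, ∀ i ∉ I, lgCoeff T L F G m₀ ρ Cb N Δx ε μ k i = 0)
    (hΦu : ∀ a k, TransportsCells Δx I (eulerFlow T L F G ρ Cb N Δx ε (u a) k))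
    (hΦ : ∀ k, TransportsCells Δx I (eulerFlow T L F G ρ Cb N Δx ε μ k))
    (hlim : ∀ k x, Filter.Tendsto (fun a => eulerFlow T L F G ρ Cb N Δx ε (u a) k x) l
      (nhds (eulerFlow T L F G ρ Cb N Δx ε μ k x))) (k : ℕ) (hk : k ≤ N) (i : Fin d → ℤ) :
    Filter.Tendsto (fun a => lgCoeff T L F G m₀ ρ Cb N Δx ε (u a) k i) l
      (nhds (lgCoeff T L F G m₀ ρ Cb N Δx ε μ k i)) := by
  have hfin := isFiniteMeasure_restrict_cell (d := d) hΔx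
  induction k generalizing i with
  | zero => exact tendsto_const_nhds
  | succ k ih =>
    have hkN : k ≤ N := Nat.le_of_succ_le hk
    simp only [lgCoeff_succ (hIu _ k hkN), lgCoeff_succ (hI k hkN)]
    refine (tendsto_finsetSum _ fun j hj => (ih hkN j).mul ?_).const_mul _
    refine tendsto_integral_filter_of_dominated_convergence (fun _ => 1)
      (Filter.Eventually.of_forall fun a => ((measurable_beta0 Δx i).comp_aemeasurable
        ((hΦu a k).aemeasurable j hj)).aestronglyMeasurable)
      (Filter.Eventually.of_forall fun a => Filter.Eventually.of_forall fun x => ?_)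
      (integrable_const _) ?_
    · rw [Real.norm_of_nonneg (beta0_nonneg _ _ _)]
      exact beta0_le_one _ _ _
    · have hnull : (volume.restrict (cell Δx j)).map (eulerFlow T L F G ρ Cb N Δx ε μ k)
          (frontier (cell Δx i)) = 0 :=
        (hΦ k).absolutelyContinuous j hj ((convex_cell Δx i).addHaar_frontier volume)
      have hae := ae_of_ae_map ((hΦ k).aemeasurable j hj) (measure_eq_zero_iff_ae_notMem.1 hnull)
      filter_upwards [hae] with x hx
      exact tendsto_beta0 (hlim k x) hx

theorem SchemeBounds.transportsCells (h : SchemeBounds T L F G Cb A K₁ K₂)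
    (hρ : IsMollifierProfile ρ) (hΔx : 0 < Δx) (hε : 0 < ε)
    (hμ : ∀ t ∈ Set.Icc 0 T, IsP1 (μ t)) {R K : ℝ} (hK0 : 0 ≤ K)
    (hK : HamiltonianLipschitz L R (valueLip d T K₁ K₂) K)
    (hsmall : T / N * (K * (1 + valueLip d T K₁ K₂ * (gradMass ρ / ε))) ≤ 1 / 2)
    {I : Finset (Fin d → ℤ)} (hI : ∀ j ∈ I, ∀ x ∈ cell Δx j, ‖x‖ ≤ R) (k : ℕ) :
    TransportsCells Δx I (eulerFlow T L F G ρ Cb N Δx ε μ k) := by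
  have hm : ∀ j ∈ I, AEMeasurable (eulerFlow T L F G ρ Cb N Δx ε μ k)
      (volume.restrict (cell Δx j)) := fun j hj =>
    ((h.continuousOn_eulerFlow hρ hΔx hε hμ hK0 hK k).mono fun x hx => by
      simpa using hI j hj x hx).aemeasurable (measurableSet_cell Δx j)
  refine ⟨hm, fun j hj => Measure.AbsolutelyContinuous.mk fun S hS hS0 => ?_⟩
  rw [Measure.map_apply_of_aemeasurable (hm j hj) hS,
    Measure.restrict_apply' (measurableSet_cell Δx j), Set.inter_comm]
  exact volume_inter_preimage_eq_zero zero_le_two (fun x hx y hy =>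
    h.norm_sub_le_eulerFlow hρ hΔx hε hμ hK0 hK k hsmall (hI j hj x hx) (hI j hj y hy)) hS0

/-- Although the cells overlap, a grid point lies in its own cell only. -/
theorem lgDensity_gridPt (hΔx : 0 < Δx) (k : ℕ) (i : Fin d → ℤ) :
    lgDensity T L F G m₀ ρ Cb N Δx ε μ k (gridPt Δx i) =
      lgCoeff T L F G m₀ ρ Cb N Δx ε μ k i := by
  rw [lgDensity, tsum_eq_single i fun j hj => ?_]
  · rw [beta0, Set.indicator_of_mem ((gridPt_mem_cell_iff hΔx).2 rfl), Pi.one_apply, mul_one]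
  · rw [beta0, Set.indicator_of_notMem fun h => hj ((gridPt_mem_cell_iff hΔx).1 h).symm, mul_zero]

end MFG

namespace MFG

variable {d : ℕ}

/-! ### Bounds for the distance `d₁` -/

theorem d1_le_of_coupling {ν₁ ν₂ : Measure (Space d)} {γ : Measure (Space d × Space d)}
    (hγ : IsProbabilityMeasure γ) (h₁ : γ.map Prod.fst = ν₁) (h₂ : γ.map Prod.snd = ν₂) :
    d1 ν₁ ν₂ ≤ ∫ z, ‖z.1 - z.2‖ ∂γ :=
  csInf_le ⟨0, by rintro r ⟨γ, -, -, -, rfl⟩; exact integral_nonneg fun _ => norm_nonneg _⟩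
    ⟨γ, hγ, h₁, h₂, rfl⟩

/-- Leave the common part κ in place on the diagonal and couple the remainders by their normalized
product, which moves mass over a distance of at most 2R. -/
theorem d1_add_le {κ α β : Measure (Space d)} [IsFiniteMeasure α]
    [IsFiniteMeasure β] (hprob : IsProbabilityMeasure (κ + α)) (hαβ : α Set.univ = β Set.univ)
    {R : ℝ} (hα : ∀ᵐ x ∂α, ‖x‖ ≤ R) (hβ : ∀ᵐ x ∂β, ‖x‖ ≤ R) :
    d1 (κ + α) (κ + β) ≤ 2 * R * α.real Set.univ := by
  have hdiag : Measurable fun x : Space d => (x, x) := by fun_prop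
  have hnorm : Measurable fun z : Space d × Space d => ‖z.1 - z.2‖ := by fun_prop
  set s := α Set.univ with hs
  set γ₁ := κ.map fun x => (x, x)
  set γ₂ := s⁻¹ • α.prod β
  -- When s = 0 the factor s⁻¹ is ∞, but the measures involved vanish and the identity persists.
  have hs1 : ∀ ν : Measure (Space d), ν Set.univ = s → s⁻¹ • s • ν = ν := by
    intro ν hν
    rcases eq_or_ne s 0 with h0 | h0
    · rw [Measure.measure_univ_eq_zero.1 (hν.trans h0), smul_zero, smul_zero]
    · rw [smul_smul, ENNReal.inv_mul_cancel h0 (measure_ne_top _ _), one_smul]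
  have hfst : (γ₁ + γ₂).map Prod.fst = κ + α := by
    rw [Measure.map_add _ _ measurable_fst, Measure.map_map measurable_fst hdiag,
      Measure.map_smul, Measure.map_fst_prod, ← hαβ, hs1 α rfl]
    exact congrArg (· + α) Measure.map_id
  have hsnd : (γ₁ + γ₂).map Prod.snd = κ + β := by
    rw [Measure.map_add _ _ measurable_snd, Measure.map_map measurable_snd hdiag,
      Measure.map_smul, Measure.map_snd_prod, ← hs, hs1 β hαβ.symm]
    exact congrArg (· + β) Measure.map_id
  have hγ : IsProbabilityMeasure (γ₁ + γ₂) := by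
    refine ⟨?_⟩
    rw [← hprob.measure_univ, ← hfst, Measure.map_apply measurable_fst MeasurableSet.univ,
      Set.preimage_univ]
  refine (d1_le_of_coupling hγ hfst hsnd).trans ?_
  have h1 : (fun z : Space d × Space d => ‖z.1 - z.2‖) =ᵐ[γ₁] 0 := by
    refine (ae_map_iff hdiag.aemeasurable (hnorm (measurableSet_singleton 0))).2 ?_
    exact Filter.Eventually.of_forall fun x => by simp
  have hb : ∀ᵐ z ∂γ₂, ‖‖z.1 - z.2‖‖ ≤ 2 * R := by
    refine Measure.ae_smul_measure ?_ _
    filter_upwards [Measure.quasiMeasurePreserving_fst.ae hα,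
      Measure.quasiMeasurePreserving_snd.ae hβ] with z h1 h2
    rw [norm_norm]
    linarith [norm_sub_le z.1 z.2]
  have hfin : IsFiniteMeasure γ₂ := by
    refine ⟨lt_of_le_of_lt ?_ (measure_lt_top (γ₁ + γ₂) Set.univ)⟩
    rw [Measure.add_apply]
    exact le_add_self
  have hint : Integrable (fun z : Space d × Space d => ‖z.1 - z.2‖) γ₂ :=
    Integrable.of_bound hnorm.aestronglyMeasurable _ hb
  rw [integral_add_measure ((integrable_congr h1).2 (integrable_zero _ _ _)) hint,
    integral_congr_ae h1]
  simp only [Pi.zero_apply, integral_zero, zero_add]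
  have hmass : γ₂.real Set.univ = α.real Set.univ := by
    have : γ₂ Set.univ = α Set.univ := by
      have h3 : γ₂.map Prod.fst = α := by
        rw [Measure.map_smul, Measure.map_fst_prod, ← hαβ, hs1 α rfl]
      rw [← h3, Measure.map_apply measurable_fst MeasurableSet.univ, Set.preimage_univ]
    rw [Measure.real, this, Measure.real]
  rw [← hmass]
  exact (le_abs_self _).trans (norm_integral_le_of_norm_le_const hb)

/-! ### Piecewise constant densities -/

/-- The density `∑_i w_i β_i⁰`. -/
noncomputable def stepDensity (Δx : ℝ) {I : Finset (Fin d → ℤ)} (w : I → ℝ) (x : Space d) : ℝ :=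
  ∑ i, w i * beta0 Δx i x

/-- The measure with density `∑_i w_i β_i⁰`. -/
noncomputable def stepMeasure (Δx : ℝ) {I : Finset (Fin d → ℤ)} (w : I → ℝ) :
    Measure (Space d) :=
  volume.withDensity fun x => ENNReal.ofReal (stepDensity Δx w x)

variable {Δx : ℝ} {I : Finset (Fin d → ℤ)}

theorem measurable_stepDensity (w : I → ℝ) : Measurable (stepDensity Δx w) :=
  Finset.measurable_sum _ fun i _ => (measurable_beta0 Δx i.1).const_mul _

theorem lintegral_stepDensity (hΔx : 0 < Δx) {w : I → ℝ} (hw : ∀ i, 0 ≤ w i) :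
    ∫⁻ x, ENNReal.ofReal (stepDensity Δx w x) = ENNReal.ofReal (∑ i, w i * Δx ^ d) := by
  have h1 : ∀ x, ENNReal.ofReal (stepDensity Δx w x) =
      ∑ i, ENNReal.ofReal (w i) * (cell Δx i.1).indicator 1 x := by
    intro x
    rw [stepDensity, ENNReal.ofReal_sum_of_nonneg fun i _ => mul_nonneg (hw i) (beta0_nonneg _ _ _)]
    refine Finset.sum_congr rfl fun i _ => ?_
    rw [ENNReal.ofReal_mul (hw i)]
    congr 1
    by_cases hx : x ∈ cell Δx i.1 <;> simp [beta0, hx]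
  simp only [h1]
  rw [lintegral_finsetSum _ fun i _ => Measurable.const_mul
    (measurable_one.indicator (measurableSet_cell Δx i.1)) _, ENNReal.ofReal_sum_of_nonneg
      fun i _ => mul_nonneg (hw i) (by positivity)]
  refine Finset.sum_congr rfl fun i _ => ?_
  rw [lintegral_const_mul _ (measurable_one.indicator (measurableSet_cell Δx i.1)),
    lintegral_indicator_one (measurableSet_cell Δx i.1), volume_cell hΔx, ENNReal.ofReal_mul (hw i)]

theorem norm_le_of_stepDensity_ne_zero {R : ℝ} (hR : ∀ i ∈ I, ∀ x ∈ cell Δx i, ‖x‖ ≤ R)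
    {w : I → ℝ} {x : Space d} (hx : stepDensity Δx w x ≠ 0) : ‖x‖ ≤ R := by
  obtain ⟨i, -, hi⟩ := Finset.exists_ne_zero_of_sum_ne_zero hx
  exact hR i i.2 x (Set.mem_of_indicator_ne_zero (right_ne_zero_of_mul hi))

theorem isProbabilityMeasure_stepMeasure (hΔx : 0 < Δx) {w : I → ℝ} (hw : ∀ i, 0 ≤ w i)
    (hw1 : ∑ i, w i * Δx ^ d = 1) : IsProbabilityMeasure (stepMeasure Δx w) :=
  ⟨by rw [stepMeasure, withDensity_apply _ MeasurableSet.univ, Measure.restrict_univ,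
    lintegral_stepDensity hΔx hw, hw1, ENNReal.ofReal_one]⟩

theorem isP1_stepMeasure (hΔx : 0 < Δx) {R : ℝ} (hR : ∀ i ∈ I, ∀ x ∈ cell Δx i, ‖x‖ ≤ R)
    {w : I → ℝ} (hw : ∀ i, 0 ≤ w i) (hw1 : ∑ i, w i * Δx ^ d = 1) : IsP1 (stepMeasure Δx w) := by
  have hp := isProbabilityMeasure_stepMeasure hΔx hw hw1
  refine ⟨hp, Integrable.of_bound (C := R) measurable_norm.aestronglyMeasurable ?_⟩
  refine (ae_withDensity_iff (measurable_stepDensity w).ennreal_ofReal).2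
    (Filter.Eventually.of_forall fun x hx => ?_)
  rw [norm_norm]
  exact norm_le_of_stepDensity_ne_zero hR fun h => hx (by rw [h, ENNReal.ofReal_zero])

/-- Split the densities f and g into the common part min(f, g) and the excesses (f - g)⁺ and (g -
f)⁺, which have equal mass. `ENNReal.ofReal` performs the positive part. -/
theorem d1_stepMeasure_le (hΔx : 0 < Δx) {R : ℝ} (hR0 : 0 ≤ R)
    (hR : ∀ i ∈ I, ∀ x ∈ cell Δx i, ‖x‖ ≤ R) {w w' : I → ℝ} (hw : ∀ i, 0 ≤ w i)
    (hw1 : ∑ i, w i * Δx ^ d = 1) (hw' : ∀ i, 0 ≤ w' i) (hw1' : ∑ i, w' i * Δx ^ d = 1) :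
    d1 (stepMeasure Δx w) (stepMeasure Δx w') ≤ 2 * R * ∑ i, |w i - w' i| * Δx ^ d := by
  have hp := isProbabilityMeasure_stepMeasure hΔx hw hw1
  have hp' := isProbabilityMeasure_stepMeasure hΔx hw' hw1'
  have hm := measurable_stepDensity (Δx := Δx) w
  have hm' := measurable_stepDensity (Δx := Δx) w'
  have h0 : ∀ v : I → ℝ, (∀ i, 0 ≤ v i) → ∀ x, 0 ≤ stepDensity Δx v x := fun v hv x =>
    Finset.sum_nonneg fun i _ => mul_nonneg (hv i) (beta0_nonneg _ _ _)
  set f := stepDensity Δx w with hf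
  set g := stepDensity Δx w' with hg
  let κ : Measure (Space d) := volume.withDensity fun x => ENNReal.ofReal (min (f x) (g x))
  let α : Measure (Space d) := volume.withDensity fun x => ENNReal.ofReal (f x - g x)
  let β : Measure (Space d) := volume.withDensity fun x => ENNReal.ofReal (g x - f x)
  have key : ∀ a b : ℝ, 0 ≤ a → 0 ≤ b →
      ENNReal.ofReal a = ENNReal.ofReal (min a b) + ENNReal.ofReal (a - b) := by
    intro a b ha hb
    rcases le_total a b with h | h
    · rw [min_eq_left h, ENNReal.ofReal_of_nonpos (sub_nonpos.2 h), add_zero]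
    · rw [min_eq_right h, ← ENNReal.ofReal_add hb (sub_nonneg.2 h), add_sub_cancel]
  have hκα : κ + α = stepMeasure Δx w := by
    rw [← withDensity_add_left (by fun_prop), stepMeasure]
    congr 1
    ext x
    exact (key _ _ (h0 w hw x) (h0 w' hw' x)).symm
  have hκβ : κ + β = stepMeasure Δx w' := by
    rw [← withDensity_add_left (by fun_prop), stepMeasure]
    congr 1
    ext x
    have := key _ _ (h0 w' hw' x) (h0 w hw x)
    rw [min_comm] at this
    exact this.symm
  have hmass : κ Set.univ + α Set.univ = κ Set.univ + β Set.univ := by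
    rw [← Measure.add_apply, ← Measure.add_apply, hκα, hκβ, hp.measure_univ, hp'.measure_univ]
  have hle : ∀ ν : Measure (Space d), κ + ν = κ + α ∨ κ + ν = κ + β → κ Set.univ < ⊤ ∧
      ν Set.univ < ⊤ := by
    intro ν hν
    have h1 : (κ + ν) Set.univ = 1 := by
      rcases hν with h | h
      · rw [h, hκα, hp.measure_univ]
      · rw [h, hκβ, hp'.measure_univ]
    rw [Measure.add_apply] at h1
    exact ENNReal.add_lt_top.1 (h1 ▸ ENNReal.one_lt_top)
  have hκ := (hle α (Or.inl rfl)).1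
  have : IsFiniteMeasure α := ⟨(hle α (Or.inl rfl)).2⟩
  have : IsFiniteMeasure β := ⟨(hle β (Or.inr rfl)).2⟩
  have hαβ : α Set.univ = β Set.univ := (ENNReal.add_right_inj hκ.ne).1 hmass
  have hne : ∀ x, f x - g x ≠ 0 → ‖x‖ ≤ R := by
    intro x hx
    by_cases h : f x = 0
    · exact norm_le_of_stepDensity_ne_zero hR (w := w') (x := x)
        fun h' => hx (by rw [h, hg, h', sub_zero])
    · exact norm_le_of_stepDensity_ne_zero hR h
  have hα : ∀ᵐ x ∂α, ‖x‖ ≤ R := by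
    refine (ae_withDensity_iff (by fun_prop)).2 (Filter.Eventually.of_forall fun x hx => hne x ?_)
    exact fun h => hx (by rw [h, ENNReal.ofReal_zero])
  have hβ : ∀ᵐ x ∂β, ‖x‖ ≤ R := by
    refine (ae_withDensity_iff (by fun_prop)).2 (Filter.Eventually.of_forall fun x hx => hne x ?_)
    exact fun h => hx (by rw [← neg_sub, h, neg_zero, ENNReal.ofReal_zero])
  have h1 := d1_add_le (hκα ▸ hp) hαβ hα hβ
  rw [hκα, hκβ] at h1
  refine h1.trans (mul_le_mul_of_nonneg_left ?_ (by positivity))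
  have h2 : α Set.univ ≤ ENNReal.ofReal (∑ i, |w i - w' i| * Δx ^ d) := by
    rw [withDensity_apply _ MeasurableSet.univ, Measure.restrict_univ,
      ← lintegral_stepDensity hΔx fun i => abs_nonneg (w i - w' i)]
    refine lintegral_mono fun x => ENNReal.ofReal_le_ofReal ?_
    simp only [hf, hg, stepDensity]
    rw [← Finset.sum_sub_distrib]
    refine Finset.sum_le_sum fun i _ => ?_
    rw [← sub_mul]
    exact mul_le_mul_of_nonneg_right (le_abs_self _) (beta0_nonneg _ _ _)
  exact ENNReal.toReal_le_of_le_ofReal (Finset.sum_nonneg fun i _ => by positivity) h2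

/-! ### The curve associated with a discrete density -/

/-- The piecewise linear interpolation in time of an array. -/
noncomputable def timeInterp {ι : Type*} (T : ℝ) (N : ℕ) (μ : Fin (N + 1) → ι → ℝ) (t : ℝ)
    (i : ι) : ℝ :=
  ∑ j : Fin (N + 1), hat (t / (T / N) - j) * μ j i

/-- On [k, k + 1] only the hats at k and k + 1 are nonzero; k < N ensures that `Fin.ofNat` does not
wrap around. -/
theorem sum_hat_mul {N : ℕ} (a : Fin (N + 1) → ℝ) {s : ℝ} {k : ℕ} (hk : k < N)
    (hks : (k : ℝ) ≤ s) (hsk : s ≤ k + 1) :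
    ∑ j : Fin (N + 1), hat (s - j) * a j =
      (s - k) * a (Fin.ofNat (N + 1) (k + 1)) + (k + 1 - s) * a (Fin.ofNat (N + 1) k) := by
  have hv1 : (Fin.ofNat (N + 1) (k + 1)).val = k + 1 := by
    rw [Fin.val_ofNat]; exact Nat.mod_eq_of_lt (by omega)
  have hv0 : (Fin.ofNat (N + 1) k).val = k := by
    rw [Fin.val_ofNat]; exact Nat.mod_eq_of_lt (by omega)
  rw [Fintype.sum_eq_add (Fin.ofNat (N + 1) (k + 1)) (Fin.ofNat (N + 1) k)
    (fun h => by have := congrArg Fin.val h; omega) fun j hj => ?_]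
  · rw [hv1, hv0]
    unfold hat
    push_cast
    rw [abs_of_nonpos (by linarith : s - (k + 1) ≤ 0), abs_of_nonneg (by linarith : 0 ≤ s - k),
      max_eq_right (by linarith), max_eq_right (by linarith)]
    ring
  · have h1 : j.val ≠ k + 1 := fun h => hj.1 (Fin.ext (h.trans hv1.symm))
    have h0 : j.val ≠ k := fun h => hj.2 (Fin.ext (h.trans hv0.symm))
    rw [hat_eq_zero, zero_mul]
    rcases lt_or_gt_of_ne h0 with h | h
    · have : (j.val : ℝ) + 1 ≤ k := by exact_mod_cast h
      exact le_abs.2 (Or.inl (by linarith))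
    · have : (k : ℝ) + 1 + 1 ≤ j.val := by
        have : k + 1 + 1 ≤ j.val := by omega
        exact_mod_cast this
      exact le_abs.2 (Or.inr (by linarith))

/-- Capping at N - 1 matters only at the final time, s = N, which is assigned to the last interval.
-/
theorem floor_bounds {N : ℕ} (hN : 0 < N) {s : ℝ} (h0 : 0 ≤ s) (hs : s ≤ N) :
    min ⌊s⌋₊ (N - 1) < N ∧ ((min ⌊s⌋₊ (N - 1) : ℕ) : ℝ) ≤ s ∧
      s ≤ (min ⌊s⌋₊ (N - 1) : ℕ) + 1 := by
  refine ⟨by omega, ?_, ?_⟩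
  · exact (Nat.cast_le.2 (min_le_left _ _)).trans (Nat.floor_le h0)
  · rcases le_total ⌊s⌋₊ (N - 1) with h | h
    · rw [min_eq_left h]; exact (Nat.lt_floor_add_one s).le
    · rw [min_eq_right h]
      have : ((N - 1 : ℕ) : ℝ) + 1 = N := by exact_mod_cast Nat.sub_add_cancel hN
      rwa [this]

theorem div_step_mem {T : ℝ} (hT : 0 < T) {N : ℕ} (hN : 0 < N) {t : ℝ} (ht : t ∈ Set.Icc 0 T) :
    0 ≤ t / (T / N) ∧ t / (T / N) ≤ N := by
  have hN' : (0 : ℝ) < N := by exact_mod_cast hN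
  refine ⟨div_nonneg ht.1 (by positivity), ?_⟩
  rw [div_le_iff₀ (by positivity), mul_div_cancel₀ _ hN'.ne']
  exact ht.2

/-- Hat functions in time replace the choice of an interval by a single formula, from which joint
continuity in the array and in time is immediate. -/
theorem extension_eq_stepMeasure {T : ℝ} (hT : 0 < T) {N : ℕ} (hN : 0 < N) {C : ℝ}
    (μ : Fin (N + 1) → indexSet d Δx C → ℝ) {t : ℝ} (ht : t ∈ Set.Icc 0 T) :
    extension T N Δx C μ t = stepMeasure Δx (timeInterp T N μ t) := by
  have hN' : (0 : ℝ) < N := by exact_mod_cast hN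
  obtain ⟨h0, h1⟩ := div_step_mem hT hN ht
  obtain ⟨hk, hks, hsk⟩ := floor_bounds hN h0 h1
  unfold extension stepMeasure
  simp only
  set k := min ⌊t / (T / N)⌋₊ (N - 1)
  congr 1
  ext x
  congr 1
  unfold stepDensity
  have hw : ∀ i, timeInterp T N μ t i = _ := fun i => sum_hat_mul (fun j => μ j i) hk hks hsk
  simp only [hw, add_mul, Finset.sum_add_distrib, mul_assoc, ← Finset.mul_sum]
  have e1 : (t - timePt T N k) / (T / N) = t / (T / N) - k := by
    unfold timePt; field_simp
  have e2 : (timePt T N (k + 1) - t) / (T / N) = k + 1 - t / (T / N) := by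
    unfold timePt; push_cast; field_simp
  rw [e1, e2]

theorem continuous_timeInterp {ι : Type*} (T : ℝ) (N : ℕ) (i : ι) :
    Continuous fun p : (Fin (N + 1) → ι → ℝ) × ℝ => timeInterp T N p.1 p.2 i := by
  have hhat : Continuous hat := by unfold hat; fun_prop
  unfold timeInterp
  refine continuous_finsetSum _ fun j _ => (hhat.comp (by fun_prop)).mul ?_
  exact (continuous_apply i).comp ((continuous_apply j).comp continuous_fst)

theorem timeInterp_mem_simplex {T : ℝ} (hT : 0 < T) {N : ℕ} (hN : 0 < N) {C : ℝ}
    {μ : Fin (N + 1) → indexSet d Δx C → ℝ} (hμ : μ ∈ discreteDensities d N Δx C) {t : ℝ}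
    (ht : t ∈ Set.Icc 0 T) :
    (∀ i, 0 ≤ timeInterp T N μ t i) ∧ ∑ i, timeInterp T N μ t i * Δx ^ d = 1 := by
  obtain ⟨h0, h1⟩ := div_step_mem hT hN ht
  obtain ⟨hk, hks, hsk⟩ := floor_bounds hN h0 h1
  refine ⟨fun i => Finset.sum_nonneg fun j _ => mul_nonneg (hat_nonneg _) ((hμ j).1 i), ?_⟩
  unfold timeInterp
  simp only [Finset.sum_mul]
  rw [Finset.sum_comm]
  have h2 : ∀ j : Fin (N + 1), ∑ i, hat (t / (T / N) - j) * μ j i * Δx ^ d =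
      hat (t / (T / N) - j) * 1 := by
    intro j
    rw [← (hμ j).2, Finset.mul_sum]
    exact Finset.sum_congr rfl fun i _ => mul_assoc _ _ _
  rw [Finset.sum_congr rfl fun j _ => h2 j, sum_hat_mul (fun _ => (1 : ℝ)) hk hks hsk]
  ring

theorem d1_extension_le {T : ℝ} (hT : 0 < T) {N : ℕ} (hN : 0 < N) (hΔx : 0 < Δx) {C R : ℝ}
    (hR0 : 0 ≤ R) (hR : ∀ i ∈ indexSet d Δx C, ∀ x ∈ cell Δx i, ‖x‖ ≤ R)
    {μ μ' : Fin (N + 1) → indexSet d Δx C → ℝ} (hμ : μ ∈ discreteDensities d N Δx C)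
    (hμ' : μ' ∈ discreteDensities d N Δx C) {s t : ℝ} (hs : s ∈ Set.Icc 0 T)
    (ht : t ∈ Set.Icc 0 T) :
    d1 (extension T N Δx C μ s) (extension T N Δx C μ' t) ≤
      2 * R * ∑ i, |timeInterp T N μ s i - timeInterp T N μ' t i| * Δx ^ d := by
  rw [extension_eq_stepMeasure hT hN μ hs, extension_eq_stepMeasure hT hN μ' ht]
  exact d1_stepMeasure_le hΔx hR0 hR (timeInterp_mem_simplex hT hN hμ hs).1
    (timeInterp_mem_simplex hT hN hμ hs).2 (timeInterp_mem_simplex hT hN hμ' ht).1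
    (timeInterp_mem_simplex hT hN hμ' ht).2

theorem isP1Curve_extension {T : ℝ} (hT : 0 < T) {N : ℕ} (hN : 0 < N) (hΔx : 0 < Δx) {C R : ℝ}
    (hR0 : 0 ≤ R) (hR : ∀ i ∈ indexSet d Δx C, ∀ x ∈ cell Δx i, ‖x‖ ≤ R)
    {μ : Fin (N + 1) → indexSet d Δx C → ℝ} (hμ : μ ∈ discreteDensities d N Δx C) :
    IsP1Curve T (extension T N Δx C μ) := by
  refine ⟨fun t ht => ?_, fun t ht e he => ?_⟩
  · rw [extension_eq_stepMeasure hT hN μ ht]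
    exact isP1_stepMeasure hΔx hR (timeInterp_mem_simplex hT hN hμ ht).1
      (timeInterp_mem_simplex hT hN hμ ht).2
  · have hc : Continuous fun s =>
        2 * R * ∑ i, |timeInterp T N μ s i - timeInterp T N μ t i| * Δx ^ d := by
      refine continuous_const.mul (continuous_finsetSum _ fun i _ => ?_)
      have h1 : Continuous fun s => timeInterp T N μ s i :=
        (continuous_timeInterp T N i).comp (continuous_const.prodMk continuous_id)
      fun_prop
    obtain ⟨r, hr, hlt⟩ := Metric.continuousAt_iff.1 (hc.continuousAt (x := t)) e he
    refine ⟨r, hr, fun s hs hst => ?_⟩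
    have h2 := hlt (x := s) (by rwa [Real.dist_eq])
    simp only [sub_self, abs_zero, zero_mul, Finset.sum_const_zero, mul_zero,
      dist_zero_right] at h2
    exact (d1_extension_le hT hN hΔx hR0 hR hμ hμ hs ht).trans_lt
      ((le_abs_self _).trans_lt h2)

theorem tendsto_coupling_extension {f : Space d → Measure (Space d) → ℝ} (hf : ContinuousOnP1 f)
    {T : ℝ} (hT : 0 < T) {N : ℕ} (hN : 0 < N) (hΔx : 0 < Δx) {C R : ℝ}
    (hR0 : 0 ≤ R) (hR : ∀ i ∈ indexSet d Δx C, ∀ x ∈ cell Δx i, ‖x‖ ≤ R)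
    (μ : discreteDensities d N Δx C) (x : Space d) {t : ℝ} (ht : t ∈ Set.Icc 0 T) :
    Filter.Tendsto (fun ν : discreteDensities d N Δx C => f x (extension T N Δx C ν.1 t))
      (nhds μ) (nhds (f x (extension T N Δx C μ.1 t))) := by
  rw [Metric.tendsto_nhds]
  intro e he
  obtain ⟨r, hr, hlt⟩ := hf x _ ((isP1Curve_extension hT hN hΔx hR0 hR μ.2).1 t ht) e he
  have hc : Continuous fun ν : discreteDensities d N Δx C =>
      2 * R * ∑ i, |timeInterp T N ν.1 t i - timeInterp T N μ.1 t i| * Δx ^ d := by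
    refine continuous_const.mul (continuous_finsetSum _ fun i _ => ?_)
    have h1 : Continuous fun ν : discreteDensities d N Δx C => timeInterp T N ν.1 t i :=
      (continuous_timeInterp T N i).comp (continuous_subtype_val.prodMk continuous_const)
    fun_prop
  have h2 := Metric.tendsto_nhds.1 (hc.tendsto μ) r hr
  simp only [sub_self, abs_zero, zero_mul, Finset.sum_const_zero, mul_zero,
    dist_zero_right] at h2
  filter_upwards [h2] with ν hν
  rw [Real.dist_eq]
  exact hlt x _ ((isP1Curve_extension hT hN hΔx hR0 hR ν.2).1 t ht) (by simpa using hr)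
    ((d1_extension_le hT hN hΔx hR0 hR ν.2 μ.2 ht ht).trans_lt ((le_abs_self _).trans_lt hν))

end MFG

namespace MFG

variable {d : ℕ} {T : ℝ} {L : Space d → Space d → ℝ} {F G : Space d → Measure (Space d) → ℝ}
  {m₀ : Measure (Space d)} {ρ : Space d → ℝ} {Cb A K₁ K₂ : ℝ} {N : ℕ} {Δx ε : ℝ}

/-! ### Existence of solutions -/

theorem SchemeBounds.exists_isDiscreteMFGSolution (h : SchemeBounds T L F G Cb A K₁ K₂)
    (hL : HypH1 L) (hFG : HypH2 F G) (hm₀ : HypH3 m₀) (hρ : IsMollifierProfile ρ) (hN : 0 < N)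
    (hΔx : 0 < Δx) (hε : 0 < ε) {C : ℝ} (hC : 0 < C) {R K : ℝ}
    (hcell : ∀ i ∈ indexSet d Δx C, ∀ x ∈ cell Δx i, ‖x‖ ≤ R) (hR0 : 0 ≤ R) (hK0 : 0 ≤ K)
    (hK : HamiltonianLipschitz L R (valueLip d T K₁ K₂) K)
    (hsmall : T / N * (K * (1 + valueLip d T K₁ K₂ * (gradMass ρ / ε))) ≤ 1 / 2)
    (hsupp : ∀ μ : ℝ → Measure (Space d), IsP1Curve T μ → ∀ k ≤ N, ∀ i : Fin d → ℤ,
      ¬ (∀ l, |gridPt Δx i l| ≤ C) → lgCoeff T L F G m₀ ρ Cb N Δx ε μ k i = 0) :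
    ∃ μ : Fin (N + 1) → indexSet d Δx C → ℝ,
      IsDiscreteMFGSolution T L F G m₀ ρ Cb C N Δx ε μ := by
  have hT := h.T_pos
  set D := discreteDensities d N Δx C
  have hcurve : ∀ μ ∈ D, IsP1Curve T (extension T N Δx C μ) := fun μ hμ =>
    isP1Curve_extension hT hN hΔx hR0 hcell hμ
  have hI : ∀ μ ∈ D, ∀ k ≤ N, ∀ i ∉ indexSet d Δx C,
      lgCoeff T L F G m₀ ρ Cb N Δx ε (extension T N Δx C μ) k i = 0 := fun μ hμ k hk i hi =>
    hsupp _ (hcurve μ hμ) k hk i fun hl => hi ((mem_indexSet hΔx i).2 hl)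
  have hΦ : ∀ μ ∈ D, ∀ k, TransportsCells Δx (indexSet d Δx C)
      (eulerFlow T L F G ρ Cb N Δx ε (extension T N Δx C μ) k) := fun μ hμ k =>
    h.transportsCells hρ hΔx hε (hcurve μ hμ).1 hK0 hK hsmall hcell k
  -- The fixed points of Ψ in 𝔇 are the solutions, since at x_i the discrete density equals the
  -- coefficient m_{k,i}.
  let Ψ : (Fin (N + 1) → indexSet d Δx C → ℝ) → Fin (N + 1) → indexSet d Δx C → ℝ :=
    fun μ k i => lgCoeff T L F G m₀ ρ Cb N Δx ε (extension T N Δx C μ) k i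
  have hmaps : Set.MapsTo Ψ D D := by
    intro μ hμ k
    refine ⟨fun i => lgCoeff_nonneg hΔx _ _, ?_⟩
    rw [← sum_lgCoeff hm₀ hΔx (hI μ hμ) (hΦ μ hμ) k (Nat.le_of_lt_succ k.2)]
    exact Finset.sum_coe_sort (indexSet d Δx C) fun i =>
      lgCoeff T L F G m₀ ρ Cb N Δx ε (extension T N Δx C μ) k i * Δx ^ d
  have hcont : ContinuousOn Ψ D := by
    rw [continuousOn_iff_continuous_domRestrict]
    refine continuous_iff_continuousAt.2 fun μ => tendsto_pi_nhds.2 fun k =>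
      tendsto_pi_nhds.2 fun i => ?_
    have hflow : ∀ k x, Filter.Tendsto (fun ν : D =>
        eulerFlow T L F G ρ Cb N Δx ε (extension T N Δx C ν.1) k x) (nhds μ)
        (nhds (eulerFlow T L F G ρ Cb N Δx ε (extension T N Δx C μ.1) k x)) := fun k x =>
      h.tendsto_eulerFlow (u := fun ν : D => extension T N Δx C ν.1) hL hρ hΔx hε
        (fun ν => (hcurve ν.1 ν.2).1) (hcurve μ.1 μ.2).1
        (fun x t ht => tendsto_coupling_extension hFG.1.1 hT hN hΔx hR0 hcell μ x ht)
        (fun x t ht => tendsto_coupling_extension hFG.2.1 hT hN hΔx hR0 hcell μ x ht) k x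
    have hlim : Filter.Tendsto (fun ν : D =>
        lgCoeff T L F G m₀ ρ Cb N Δx ε (extension T N Δx C ν.1) k i) (nhds μ)
        (nhds (lgCoeff T L F G m₀ ρ Cb N Δx ε (extension T N Δx C μ.1) k i)) :=
      tendsto_lgCoeff (u := fun ν : D => extension T N Δx C ν.1) hΔx (fun ν => hI ν.1 ν.2)
        (hI μ.1 μ.2) (fun ν => hΦ ν.1 ν.2) (hΦ μ.1 μ.2) hflow k (Nat.le_of_lt_succ k.2) i
    simpa only [Set.domRestrict_apply, Ψ] using hlim
  -- The simplices are nonempty because the origin is a grid point within the bound C > 0.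
  have : Nonempty (indexSet d Δx C) :=
    ⟨⟨0, (mem_indexSet hΔx 0).2 fun l => by simpa [gridPt] using hC.le⟩⟩
  obtain ⟨μ, hμ, hfix⟩ := exists_fixedPoint_prod_simplex (pow_pos hΔx d) rfl hmaps hcont
  refine ⟨μ, hμ, fun k i => ?_⟩
  rw [lgDensity_gridPt hΔx]
  exact (congrFun (congrFun hfix k) i).symm

end MFG

/-! ### The theorem: choice of the radius and of δ -/

open MFG
theorem mainTheorem2 (d : ℕ) (T : ℝ) (hT : 0 < T)
    (L : Space d → Space d → ℝ) (F G : Space d → Measure (Space d) → ℝ)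
    (m₀ : Measure (Space d)) (ρ : Space d → ℝ)
    (hL : HypH1 L) (hFG : HypH2 F G) (hm₀ : HypH3 m₀) (hρ : IsMollifierProfile ρ)
    (Cb : ℝ) (hCb : 0 < Cb) (c : ℝ) (hc : 0 < c) :
    (∃ C : ℝ, 0 < C ∧ IsSupportBound T L F G m₀ ρ Cb c C) ∧
    ∀ C : ℝ, 0 < C → IsSupportBound T L F G m₀ ρ Cb c C →
      ∀ εmax : ℝ, 0 < εmax → ∃ δ : ℝ, 0 < δ ∧
        ∀ (N : ℕ) (Δx ε : ℝ), 0 < N → 0 < Δx → 0 < ε → ε ≤ εmax →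
          Δx ≤ c * (T / N) → (T / N) / ε ≤ δ →
          ∃ μ : Fin (N + 1) → indexSet d Δx C → ℝ,
            IsDiscreteMFGSolution T L F G m₀ ρ Cb C N Δx ε μ := by
  obtain ⟨A, K₁, K₂, h⟩ := exists_schemeBounds hT hL hFG hCb
  refine ⟨h.exists_isSupportBound hL hm₀ hρ hc, fun C hC hsupp εmax hεmax => ?_⟩
  set V := valueLip d T K₁ K₂
  have hV : 0 ≤ V := h.valueLip_nonneg
  have hM := gradMass_nonneg ρ
  -- As Δx ≤ cT, every cell indexed by 𝓘_Δx lies in the ball of this radius, so K is independent of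
  -- N, Δx and ε.
  obtain ⟨K, hK0, hK⟩ := hL.exists_gradient_hamiltonian_lipschitz (d * (C + c * T / 2)) V
  -- Chosen so that Δt Lip(b) ≤ (Δt/ε) K(ε + V‖∇ρ‖₁) ≤ 1/2 for ε ≤ εmax; the added 1 keeps the
  -- denominator positive.
  refine ⟨1 / (2 * (K * (εmax + V * gradMass ρ) + 1)), by positivity,
    fun N Δx ε hN hΔx hε hεle hcΔ hδ => ?_⟩
  have hN' : (1 : ℝ) ≤ N := by exact_mod_cast hN
  have hΔ : Δx ≤ c * T := hcΔ.trans (by gcongr; exact div_le_self hT.le hN')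
  refine h.exists_isDiscreteMFGSolution hL hFG hm₀ hρ hN hΔx hε hC (fun i hi x hx =>
    (norm_le_of_mem_cell ((mem_indexSet hΔx i).1 hi) hx).trans (by gcongr)) (by positivity)
    hK0 hK ?_ fun μ hμ k hk i hi => hsupp N Δx ε μ hN hΔx hε hcΔ hμ k hk i hi
  have h1 : T / N * (K * (1 + V * (gradMass ρ / ε))) =
      T / N / ε * (K * (ε + V * gradMass ρ)) := by field_simp
  rw [h1]
  have h2 : K * (ε + V * gradMass ρ) ≤ K * (εmax + V * gradMass ρ) + 1 := by
    have : K * (ε + V * gradMass ρ) ≤ K * (εmax + V * gradMass ρ) := by gcongr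
    linarith
  refine (mul_le_mul hδ h2 (by positivity) (by positivity)).trans (le_of_eq ?_)
  field_simp
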